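/- Let $(M,\omega)$ be a closed symplectic manifold. A Hamiltonian is a smooth function $H\colon S^1\times M\to\mathbb R$, $S^1=\mathbb R/\mathbb Z$, with Hamiltonian vector field given by $i_{X_{H_t}}\omega=-dH_t$; it is non-degenerate if at every contractible one-periodic orbit the linearized time-one map does not have $1$ as an eigenvalue. Let $J=(J_t)_{t\in S^1}$ be a smooth family of $\omega$-compatible almost complex structures, with metrics $g_t=\omega(\cdot,J_t\cdot)$. A Floer trajectory of $(H,J)$ is a smooth map $u\colon \mathbb R\times S^1\to M$ solving $\partial_su+J_t(u)\,\partial_tu=-\nabla H_t(u)$, with energy $E(u)=\int_{\mathbb R}\int_{S^1}\|\partial_su\|^2\,dt\,ds\in[0,\infty]$. An open set is bounded by level sets of $H$ if its boundary lies in a finite union of level sets of $H$. Proposition. Let $U,V\subset M$ be open with $\bar U\subset V$, and let $K$ be a non-degenerate Hamiltonian such that $U$ and $V$ are bounded by level sets of $K$, and such that on the shell $\bar V\setminus U$ the Hamiltonian $K$ is autonomous and has no contractible one-periodic orbits (that is, no such orbit is contained in $\bar V\setminus U$). Then there is a constant $\epsilon>0$, depending only on $U$, $V$ and the restrictions of $K$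 and $J$ to $\bar V\setminus U$, such that every Floer trajectory $u$ of $(K,J)$ whose loops $u(s,\cdot)$ are contractible and which intersects both $\partial U$ and $\partial V$ satisfies $E(u)>\epsilon$. If $K$ has no one-periodic orbits at all in $\bar V\setminus U$, contractible or not, this holds for every Floer trajectory $u$ intersecting both $\partial U$ and $\partial V$. The dependence of $\epsilon$ means: given $(M,\omega)$, $U$, $V$, $K$ and $J$ as above, one $\epsilon$ serves for all pairs $(K',J')$ of a non-degenerate Hamiltonian and a family of compatible almost complex structures that agree with $(K,J)$ on $\bar V\setminus U$ for all times. -/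

import Mathlib

open Set MeasureTheory
open scoped Manifold ContDiff Bundle ENNReal

noncomputable section

namespace Sympl

variable {E : Type*} [NormedAddCommGroup E] [NormedSpace ℝ E]
  {M : Type*} [TopologicalSpace M] [ChartedSpace E M]

/-- The tangent space at `x` of a boundaryless manifold `M` modelled on `E`. -/
abbrev Tan (E : Type*) [NormedAddCommGroup E] [NormedSpace ℝ E]
    {M : Type*} [TopologicalSpace M] [ChartedSpace E M] (x : M) : Type _ :=
  TangentSpace 𝓘(ℝ, E) x

/-- The coefficients of a bilinear form `Ω` in the chart around `x₀`: the value at the point with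
coordinates `y` on the coordinate vectors `v`, `w`. -/
def chartForm (Ω : ∀ x : M, Tan E x →L[ℝ] Tan E x →L[ℝ] ℝ) (x₀ : M) (v w y : E) : ℝ :=
  Ω ((extChartAt 𝓘(ℝ, E) x₀).symm y)
    (mfderiv 𝓘(ℝ, E) 𝓘(ℝ, E) (extChartAt 𝓘(ℝ, E) x₀).symm y v)
    (mfderiv 𝓘(ℝ, E) 𝓘(ℝ, E) (extChartAt 𝓘(ℝ, E) x₀).symm y w)

/-- `Ω` is a symplectic form: a smooth, closed, non-degenerate 2-form. -/
structure IsSymplecticForm [IsManifold 𝓘(ℝ, E) ∞ M]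
    (Ω : ∀ x : M, Tan E x →L[ℝ] Tan E x →L[ℝ] ℝ) : Prop where
  smooth : ContMDiff 𝓘(ℝ, E) (𝓘(ℝ, E).prod 𝓘(ℝ, E →L[ℝ] E →L[ℝ] ℝ)) ∞
    (fun x ↦ Bundle.TotalSpace.mk' (E →L[ℝ] E →L[ℝ] ℝ)
      (E := fun x : M ↦ Tan E x →L[ℝ] Tan E x →L[ℝ] ℝ) x (Ω x))
  alternating : ∀ (x : M) (v : Tan E x), Ω x v v = 0
  nondegenerate : ∀ (x : M) (v : Tan E x), (∀ w, Ω x v w = 0) → v = 0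
  /-- `dΩ = 0`, written out in every chart on constant coordinate vector fields. -/
  closed : ∀ (x₀ : M), ∀ y ∈ (extChartAt 𝓘(ℝ, E) x₀).target, ∀ v₁ v₂ v₃ : E,
    fderiv ℝ (chartForm Ω x₀ v₂ v₃) y v₁ + fderiv ℝ (chartForm Ω x₀ v₃ v₁) y v₂ +
      fderiv ℝ (chartForm Ω x₀ v₁ v₂) y v₃ = 0

/-- `J` is a smooth family, 1-periodic in time, of almost complex structures compatible with `Ω`.
The associated metrics are `g_t(v, w) = Ω(v, J_t w)`. -/
structure IsCompatible [IsManifold 𝓘(ℝ, E) ∞ M]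
    (Ω : ∀ x : M, Tan E x →L[ℝ] Tan E x →L[ℝ] ℝ)
    (J : ℝ → ∀ x : M, Tan E x →L[ℝ] Tan E x) : Prop where
  smooth : ContMDiff (𝓘(ℝ, ℝ).prod 𝓘(ℝ, E)) (𝓘(ℝ, E).prod 𝓘(ℝ, E →L[ℝ] E)) ∞
    (fun p : ℝ × M ↦ Bundle.TotalSpace.mk' (E →L[ℝ] E)
      (E := fun x : M ↦ Tan E x →L[ℝ] Tan E x) p.2 (J p.1 p.2))
  periodic : ∀ (t : ℝ) (x : M), J (t + 1) x = J t x
  sq_eq_neg : ∀ (t : ℝ) (x : M) (v : Tan E x), J t x (J t x v) = -v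
  invariant : ∀ (t : ℝ) (x : M) (v w : Tan E x), Ω x (J t x v) (J t x w) = Ω x v w
  pos : ∀ (t : ℝ) (x : M) (v : Tan E x), v ≠ 0 → 0 < Ω x v (J t x v)

/-- A one-periodic Hamiltonian: a smooth function on `ℝ/ℤ × M`. -/
structure IsHamiltonian (E : Type*) [NormedAddCommGroup E] [NormedSpace ℝ E]
    {M : Type*} [TopologicalSpace M] [ChartedSpace E M] (H : ℝ → M → ℝ) : Prop where
  smooth : ContMDiff (𝓘(ℝ, ℝ).prod 𝓘(ℝ, E)) 𝓘(ℝ, ℝ) ∞ (fun p : ℝ × M ↦ H p.1 p.2)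
  periodic : ∀ (t : ℝ) (x : M), H (t + 1) x = H t x

/-- The differential at `x` of a function on `M`. -/
def diff (f : M → ℝ) (x : M) : Tan E x →L[ℝ] ℝ := mfderiv 𝓘(ℝ, E) 𝓘(ℝ, ℝ) f x

/-- The velocity at time `t` of a curve in `M`. -/
def velocity (γ : ℝ → M) (t : ℝ) : Tan E (γ t) := mfderiv 𝓘(ℝ, ℝ) 𝓘(ℝ, E) γ t (1 : ℝ)

/-- `X` is the value at `x` of the Hamiltonian vector field of `f`: `i_X Ω = -df`. -/
def IsHamiltonianVector (Ω : ∀ x : M, Tan E x →L[ℝ] Tan E x →L[ℝ] ℝ) (f : M → ℝ)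
    (x : M) (X : Tan E x) : Prop :=
  ∀ w : Tan E x, Ω x X w = -diff f x w

/-- `G` is the gradient of `f` at `x` for the metric `g(v, w) = Ω(v, J w)`. -/
def IsGradient (Ω : ∀ x : M, Tan E x →L[ℝ] Tan E x →L[ℝ] ℝ)
    (J : ∀ x : M, Tan E x →L[ℝ] Tan E x) (f : M → ℝ) (x : M) (G : Tan E x) : Prop :=
  ∀ w : Tan E x, Ω x G (J x w) = diff f x w

/-- `x` is an integral curve of the time-dependent Hamiltonian vector field of `H`. -/
def IsHamiltonianCurve (Ω : ∀ x : M, Tan E x →L[ℝ] Tan E x →L[ℝ] ℝ) (H : ℝ → M → ℝ)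
    (x : ℝ → M) : Prop :=
  MDifferentiable 𝓘(ℝ, ℝ) 𝓘(ℝ, E) x ∧
    ∀ t, IsHamiltonianVector Ω (H t) (x t) (velocity x t)

/-- `x` is a one-periodic orbit of `H`, contractible or not. -/
def IsOnePeriodicOrbit (Ω : ∀ x : M, Tan E x →L[ℝ] Tan E x →L[ℝ] ℝ) (H : ℝ → M → ℝ)
    (x : ℝ → M) : Prop :=
  IsHamiltonianCurve Ω H x ∧ ∀ t, x (t + 1) = x t

/-- The 1-periodic curve `γ` descends to a contractible loop `ℝ/ℤ → M`. -/
def IsContractibleLoop {M : Type*} [TopologicalSpace M] (γ : ℝ → M) : Prop :=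
  ∃ f : C(UnitAddCircle, M), (∀ t : ℝ, f (t : UnitAddCircle) = γ t) ∧ f.Nullhomotopic

/-- `φ` is the Hamiltonian flow of `H`, started at time zero. -/
def IsHamiltonianFlow (Ω : ∀ x : M, Tan E x →L[ℝ] Tan E x →L[ℝ] ℝ) (H : ℝ → M → ℝ)
    (φ : ℝ → M → M) : Prop :=
  (∀ p, φ 0 p = p) ∧ ∀ p, IsHamiltonianCurve Ω H (fun t ↦ φ t p)

/-- `H` is non-degenerate: at each contractible one-periodic orbit `x`, the linearized return map
`dφ¹` at `x 0` (an endomorphism of the tangent space at `x 0 = φ¹ (x 0)`) does not have `1` as an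
eigenvalue. -/
def IsNondegenerate (Ω : ∀ x : M, Tan E x →L[ℝ] Tan E x →L[ℝ] ℝ) (H : ℝ → M → ℝ) : Prop :=
  ∀ φ : ℝ → M → M, IsHamiltonianFlow Ω H φ →
    ∀ x : ℝ → M, IsOnePeriodicOrbit Ω H x → IsContractibleLoop x →
      ∀ v : E, (mfderiv 𝓘(ℝ, E) 𝓘(ℝ, E) (φ 1) (x 0) : E →L[ℝ] E) v = v → v = 0

/-- `U` is bounded by level sets of `H`: its boundary lies in a finite union of level sets, or,
equivalently for the compact boundaries considered here, `H` is locally constant on it. -/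
def IsBoundedByLevelSets (H : ℝ → M → ℝ) (U : Set M) : Prop :=
  ∃ c : Finset ℝ, ∀ t : ℝ, ∀ x ∈ frontier U, H t x ∈ c

/-- The closed shell between `U` and `V`. -/
def shell (U V : Set M) : Set M := closure V \ U

/-- `u : ℝ × ℝ/ℤ → M`, `(s, t) ↦ u s t`, is a smooth solution of the Floer equation
`∂u/∂s + J_t(u) ∂u/∂t = -∇H_t(u)`. -/
structure IsFloerTrajectory (Ω : ∀ x : M, Tan E x →L[ℝ] Tan E x →L[ℝ] ℝ)
    (J : ℝ → ∀ x : M, Tan E x →L[ℝ] Tan E x) (H : ℝ → M → ℝ) (u : ℝ → ℝ → M) : Prop where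
  smooth : ContMDiff 𝓘(ℝ, ℝ × ℝ) 𝓘(ℝ, E) ∞ (fun z : ℝ × ℝ ↦ u z.1 z.2)
  periodic : ∀ s t, u s (t + 1) = u s t
  floer : ∀ s t, IsGradient Ω (J t) (H t) (u s t)
    (-(velocity (fun s' ↦ u s' t) s + J t (u s t) (velocity (u s) t)))

/-- The energy `E(u) = ∫∫ ‖∂u/∂s‖² dt ds` in `[0, ∞]`, with the norm of `g_t(v, w) = Ω(v, J_t w)`
at time `t`. -/
def energy (Ω : ∀ x : M, Tan E x →L[ℝ] Tan E x →L[ℝ] ℝ)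
    (J : ℝ → ∀ x : M, Tan E x →L[ℝ] Tan E x) (u : ℝ → ℝ → M) : ℝ≥0∞ :=
  ∫⁻ s : ℝ, ∫⁻ t in Ioc (0 : ℝ) 1,
    ENNReal.ofReal (Ω (u s t) (velocity (fun s' ↦ u s' t) s)
      (J t (u s t) (velocity (fun s' ↦ u s' t) s)))

end Sympl

end

/-! Put W = V \ closure U, let k be the time-independent Hamiltonian on W and X its Hamiltonian
field. Over W the Floer equation reads ∂_t u = X(u) + J ∂_s u, and J is an isometry, so a loop
u(s,·) fails to be an orbit of X exactly by the length of ∂_s u. Suppose that u crosses the shell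
with very little energy.

Crossing. A critical point of k in the shell would be a constant, hence contractible, orbit. So k is
regular where W touches the closure of U. As k takes only finitely many values on the two
boundaries, a connected set meeting both must contain a point of W where k differs from all these
values by a fixed δ (`exists_crossing_constant`). Cutoffs Θ that are functions of k inside W and
vanish elsewhere (`exists_levelCutoff`) detect this: Θ₁ = 1 somewhere on the trajectory.

Slices. The flow of X preserves k and hence Θ, so by Cauchy-Schwarz the oscillation of Θ along a
slice is at most of the order of the root of the slice energy. A slice of low energy that touches Θ₂
= 1 therefore stays in W. If such energies tended to zero, Arzelà-Ascoli would produce a closed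
orbit in W, homotopic to the slices, against the hypothesis. Hence each slice that touches Θ₂ = 1
has energy more than some η (`exists_energy_gap`).

Boxes. If the total energy is at most ε, the slices meeting the support of Θ₁ fill a set of s of
measure at most ε/η, so a point with Θ₁ = 1 lies between two nearby slices on which Θ₁ vanishes. A
Chebyshev argument in t (`volume_times_le`) supplies the other two sides of a box on whose boundary
Θ₁ ≤ 1/2. Its area and its energy are O(ε).

Monotonicity. The graph (s,t) ↦ (s,t,u) is a holomorphic curve in ℝ × ℝ × M, and a holomorphic curve
through the centre of a ball that leaves the ball has area at least a constant
(`exists_monotonicity_constant`, transferred by `exists_local_energy_bound` and made uniform in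
`exists_trajectory_bound`). For small ε this contradicts the O(ε) bound; `exists_energy_bound`
combines the two. The monotonicity constant comes from integrating the Laplacian of a truncated
logarithm of the squared distance: a unit of mass at the centre must be balanced by the energy in
the truncation region.

All constants are computed from the fixed pair (K, J). A trajectory of another pair enters only
through its equation and energy density over W (`IsLocalTrajectory`), where the pairs agree; this is
the asserted uniformity of ε. -/

noncomputable section

namespace Sympl

/-! ### Tensors, functions and curves in charts, with values in the model space. -/

section Coordinates

variable {E : Type*} [NormedAddCommGroup E] [NormedSpace ℝ E]
  {M : Type*} [TopologicalSpace M] [ChartedSpace E M]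

/-- The differential at the point `x` of the chart around `x₀`. -/
def chartD (x₀ x : M) : E →L[ℝ] E :=
  mfderiv 𝓘(ℝ, E) 𝓘(ℝ, E) (extChartAt 𝓘(ℝ, E) x₀) x

/-- The differential at the coordinates `y` of the inverse of the chart around `x₀`. -/
def chartDsymm (x₀ : M) (y : E) : E →L[ℝ] E :=
  mfderiv 𝓘(ℝ, E) 𝓘(ℝ, E) (extChartAt 𝓘(ℝ, E) x₀).symm y

/-- A bilinear form on the tangent space, on the model vector space. -/
def modelForm (Ω : ∀ x : M, Tan E x →L[ℝ] Tan E x →L[ℝ] ℝ) (x : M) : E →L[ℝ] E →L[ℝ] ℝ := Ω x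

/-- An endomorphism of the tangent space, on the model vector space. -/
def modelEnd (J : ℝ → ∀ x : M, Tan E x →L[ℝ] Tan E x) (t : ℝ) (x : M) : E →L[ℝ] E := J t x

/-- A bilinear form on the tangent spaces in the chart around `x₀`. -/
def coordForm (Ω : ∀ x : M, Tan E x →L[ℝ] Tan E x →L[ℝ] ℝ) (x₀ : M) (y : E) : E →L[ℝ] E →L[ℝ] ℝ :=
  (modelForm Ω ((extChartAt 𝓘(ℝ, E) x₀).symm y)).bilinearComp (chartDsymm x₀ y) (chartDsymm x₀ y)

/-- The differential of a vector-valued function, on the model vector space. -/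
def modelD (E : Type*) [NormedAddCommGroup E] [NormedSpace ℝ E]
    {M : Type*} [TopologicalSpace M] [ChartedSpace E M]
    {F : Type*} [NormedAddCommGroup F] [NormedSpace ℝ F] (f : M → F) (x : M) : E →L[ℝ] F :=
  mfderiv 𝓘(ℝ, E) 𝓘(ℝ, F) f x

/-- The velocity of a curve, on the model vector space. -/
def modelVel (E : Type*) [NormedAddCommGroup E] [NormedSpace ℝ E]
    {M : Type*} [TopologicalSpace M] [ChartedSpace E M] (γ : ℝ → M) (t : ℝ) : E :=
  velocity (E := E) γ t

/-- A family of endomorphisms of the tangent spaces in the chart around `x₀`. -/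
def coordEnd (J : ℝ → ∀ x : M, Tan E x →L[ℝ] Tan E x) (x₀ : M) (p : ℝ × E) : E →L[ℝ] E :=
  (chartD x₀ ((extChartAt 𝓘(ℝ, E) x₀).symm p.2)).comp
    ((modelEnd J p.1 ((extChartAt 𝓘(ℝ, E) x₀).symm p.2)).comp (chartDsymm x₀ p.2))

variable [IsManifold 𝓘(ℝ, E) ∞ M]

theorem isManifold_one (E : Type*) [NormedAddCommGroup E] [NormedSpace ℝ E]
    (M : Type*) [TopologicalSpace M] [ChartedSpace E M] [IsManifold 𝓘(ℝ, E) ∞ M] :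
    IsManifold 𝓘(ℝ, E) 1 M := IsManifold.of_le (n := ∞) (by simp)

theorem chartD_chartDsymm (x₀ : M) {y : E} (hy : y ∈ (extChartAt 𝓘(ℝ, E) x₀).target) (v : E) :
    chartD x₀ ((extChartAt 𝓘(ℝ, E) x₀).symm y) (chartDsymm x₀ y v) = v := by
  have := isManifold_one E M
  have := mfderiv_extChartAt_comp_mfderivWithin_extChartAt_symm (I := 𝓘(ℝ, E)) hy
  simp only [modelWithCornersSelf_coe, range_id, mfderivWithin_univ] at this
  exact congrArg (fun A : E →L[ℝ] E => A v) this

theorem chartDsymm_chartD' (x₀ : M) {x : M} (hx : x ∈ (extChartAt 𝓘(ℝ, E) x₀).source)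
    (v : E) : chartDsymm x₀ (extChartAt 𝓘(ℝ, E) x₀ x) (chartD x₀ x v) = v := by
  have := isManifold_one E M
  have := mfderivWithin_extChartAt_symm_comp_mfderiv_extChartAt' (I := 𝓘(ℝ, E)) hx
  simp only [modelWithCornersSelf_coe, range_id, mfderivWithin_univ] at this
  exact congrArg (fun A : E →L[ℝ] E => A v) this

theorem chartDsymm_chartD (x₀ : M) {y : E} (hy : y ∈ (extChartAt 𝓘(ℝ, E) x₀).target) (v : E) :
    chartDsymm x₀ y (chartD x₀ ((extChartAt 𝓘(ℝ, E) x₀).symm y) v) = v := by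
  have := chartDsymm_chartD' x₀ ((extChartAt 𝓘(ℝ, E) x₀).map_target hy) v
  rwa [(extChartAt 𝓘(ℝ, E) x₀).right_inv hy] at this

theorem coordForm_chartD (Ω : ∀ x : M, Tan E x →L[ℝ] Tan E x →L[ℝ] ℝ) (x₀ : M) {x : M}
    (hx : x ∈ (extChartAt 𝓘(ℝ, E) x₀).source) (v w : E) :
    coordForm Ω x₀ (extChartAt 𝓘(ℝ, E) x₀ x) (chartD x₀ x v) (chartD x₀ x w) = modelForm Ω x v w := by
  obtain ⟨y, hy, rfl⟩ : ∃ y ∈ (extChartAt 𝓘(ℝ, E) x₀).target,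
      (extChartAt 𝓘(ℝ, E) x₀).symm y = x :=
    ⟨_, (extChartAt 𝓘(ℝ, E) x₀).map_source hx, (extChartAt 𝓘(ℝ, E) x₀).left_inv hx⟩
  rw [(extChartAt 𝓘(ℝ, E) x₀).right_inv hy, coordForm, ContinuousLinearMap.bilinearComp_apply,
    chartDsymm_chartD x₀ hy, chartDsymm_chartD x₀ hy]

theorem coordEnd_chartD (J : ℝ → ∀ x : M, Tan E x →L[ℝ] Tan E x) (x₀ : M) {x : M}
    (hx : x ∈ (extChartAt 𝓘(ℝ, E) x₀).source) (t : ℝ) (v : E) :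
    coordEnd J x₀ (t, extChartAt 𝓘(ℝ, E) x₀ x) (chartD x₀ x v) = chartD x₀ x (modelEnd J t x v) := by
  obtain ⟨y, hy, rfl⟩ : ∃ y ∈ (extChartAt 𝓘(ℝ, E) x₀).target,
      (extChartAt 𝓘(ℝ, E) x₀).symm y = x :=
    ⟨_, (extChartAt 𝓘(ℝ, E) x₀).map_source hx, (extChartAt 𝓘(ℝ, E) x₀).left_inv hx⟩
  rw [(extChartAt 𝓘(ℝ, E) x₀).right_inv hy]
  simp only [coordEnd, ContinuousLinearMap.comp_apply, chartDsymm_chartD x₀ hy]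

/-- Bundle smoothness is expressed through the trivializations of the tangent bundle; identifying
these with chart differentials turns it into smoothness of coordinate matrices. -/
theorem tangentTrivialization_symmL (x₀ : M) {y : E} (hy : y ∈ (extChartAt 𝓘(ℝ, E) x₀).target)
    (v : E) :
    (trivializationAt E (Tan E) x₀).symmL ℝ ((extChartAt 𝓘(ℝ, E) x₀).symm y) v
      = chartDsymm x₀ y v := by
  have := isManifold_one E M
  have hx : (extChartAt 𝓘(ℝ, E) x₀).symm y ∈ (chartAt E x₀).source := by
    simpa using (extChartAt 𝓘(ℝ, E) x₀).map_target hy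
  have h := TangentBundle.symmL_trivializationAt (I := 𝓘(ℝ, E)) hx
  simp only [modelWithCornersSelf_coe, range_id, mfderivWithin_univ] at h
  have h' : (trivializationAt E (Tan E) x₀).symmL ℝ ((extChartAt 𝓘(ℝ, E) x₀).symm y) v =
      chartDsymm x₀ (extChartAt 𝓘(ℝ, E) x₀ ((extChartAt 𝓘(ℝ, E) x₀).symm y)) v :=
    congrArg (fun A : E →L[ℝ] E => A v) h
  rwa [(extChartAt 𝓘(ℝ, E) x₀).right_inv hy] at h'

theorem tangentTrivialization_continuousLinearMapAt (x₀ : M) {y : E}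
    (hy : y ∈ (extChartAt 𝓘(ℝ, E) x₀).target) (v : E) :
    (trivializationAt E (Tan E) x₀).continuousLinearMapAt ℝ ((extChartAt 𝓘(ℝ, E) x₀).symm y) v
      = chartD x₀ ((extChartAt 𝓘(ℝ, E) x₀).symm y) v := by
  have := isManifold_one E M
  have hx : (extChartAt 𝓘(ℝ, E) x₀).symm y ∈ (chartAt E x₀).source := by
    simpa using (extChartAt 𝓘(ℝ, E) x₀).map_target hy
  have h := TangentBundle.continuousLinearMapAt_trivializationAt (I := 𝓘(ℝ, E)) hx
  exact congrArg (fun A : E →L[ℝ] E => A v) h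

/-- Smoothness of a section of a hom bundle is read in the trivialization centred at the point, so
the conclusion is stated at the centre of the chart. Local bounds need no more. -/
theorem contDiffAt_coordForm {Ω : ∀ x : M, Tan E x →L[ℝ] Tan E x →L[ℝ] ℝ}
    (hΩ : IsSymplecticForm Ω) (x₀ : M) :
    ContDiffAt ℝ ∞ (coordForm Ω x₀) (extChartAt 𝓘(ℝ, E) x₀ x₀) := by
  have h1 := isManifold_one E M
  have h := (contMDiffAt_hom_bundle _).1 (hΩ.smooth x₀)
  have h2 := h.2
  have hy := mem_extChartAt_target (I := 𝓘(ℝ, E)) x₀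
  have h3 := h2.comp_of_eq (x := extChartAt 𝓘(ℝ, E) x₀ x₀)
    ((contMDiffOn_extChartAt_symm (n := ∞) (I := 𝓘(ℝ, E)) x₀).contMDiffAt
      ((isOpen_extChartAt_target x₀).mem_nhds hy)) (by simp)
  have h4 := h3.contDiffAt
  refine h4.congr_of_eventuallyEq ?_
  filter_upwards [(isOpen_extChartAt_target x₀).mem_nhds hy] with y hy
  have hx : (extChartAt 𝓘(ℝ, E) x₀).symm y ∈ (chartAt E x₀).source := by
    simpa using (extChartAt 𝓘(ℝ, E) x₀).map_target hy
  ext v w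
  have e := inCoordinates_apply_eq₂ (F₁ := E) (E₁ := (Tan E : M → Type _)) (F₂ := E)
    (E₂ := (Tan E : M → Type _)) (F₃ := ℝ) (E₃ := fun _ : M => ℝ) (x₀ := x₀)
    (x := (extChartAt 𝓘(ℝ, E) x₀).symm y) (ϕ := Ω ((extChartAt 𝓘(ℝ, E) x₀).symm y)) (v := v) (w := w)
    (by simpa using hx) (by simpa using hx) (by simp)
  refine Eq.trans ?_ e.symm
  have h5 : ∀ v : E, (trivializationAt E (Tan E) x₀).symm ((extChartAt 𝓘(ℝ, E) x₀).symm y) v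
      = chartDsymm x₀ y v := fun v => by
    exact (Bundle.Trivialization.symmL_apply (R := ℝ) (trivializationAt E (Tan E) x₀)
      (by simpa using hx) v).symm.trans (tangentTrivialization_symmL x₀ hy v)
  rw [h5 v, h5 w]
  rw [coordForm, ContinuousLinearMap.bilinearComp_apply]
  simp [modelForm]
  rfl

theorem contDiffAt_coordEnd {Ω : ∀ x : M, Tan E x →L[ℝ] Tan E x →L[ℝ] ℝ}
    {J : ℝ → ∀ x : M, Tan E x →L[ℝ] Tan E x}
    (hJ : IsCompatible Ω J) (t₀ : ℝ) (x₀ : M) :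
    ContDiffAt ℝ ∞ (coordEnd J x₀) (t₀, extChartAt 𝓘(ℝ, E) x₀ x₀) := by
  have h1 := isManifold_one E M
  have h := (contMDiffAt_hom_bundle _).1 (hJ.smooth (t₀, x₀))
  have h2 := h.2
  have hy := mem_extChartAt_target (I := 𝓘(ℝ, E)) x₀
  have h3 := h2.comp_of_eq (I := 𝓘(ℝ, ℝ × E)) (x := (t₀, extChartAt 𝓘(ℝ, E) x₀ x₀))
    (f := fun p : ℝ × E => (p.1, (extChartAt 𝓘(ℝ, E) x₀).symm p.2))
    (ContMDiffAt.prodMk contDiff_fst.contMDiff.contMDiffAt (((contMDiffOn_extChartAt_symm (n := ∞) (I := 𝓘(ℝ, E)) x₀).contMDiffAt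
      ((isOpen_extChartAt_target x₀).mem_nhds hy)).comp_of_eq contDiff_snd.contMDiff.contMDiffAt rfl)) (by simp)
  have h4 := h3.contDiffAt
  refine h4.congr_of_eventuallyEq ?_
  filter_upwards [continuous_snd.continuousAt.preimage_mem_nhds ((isOpen_extChartAt_target x₀).mem_nhds hy)] with p hy
  have hx : (extChartAt 𝓘(ℝ, E) x₀).symm p.2 ∈ (chartAt E x₀).source := by
    simpa using (extChartAt 𝓘(ℝ, E) x₀).map_target hy
  ext v
  have h5 := tangentTrivialization_symmL x₀ hy v
  have h6 := fun v => tangentTrivialization_continuousLinearMapAt x₀ hy v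
  simp only [ContinuousLinearMap.inCoordinates, coordEnd, Function.comp_apply,
    ContinuousLinearMap.comp_apply]
  refine (h6 _).symm.trans ?_
  rw [← h5]
  rfl

omit [IsManifold 𝓘(ℝ, E) ∞ M] in
/-- The derivative of a function along a curve. -/
theorem hasDerivAt_comp_curve {F : Type*} [NormedAddCommGroup F] [NormedSpace ℝ F]
    {f : M → F} {γ : ℝ → M} {t : ℝ} (hf : MDifferentiableAt 𝓘(ℝ, E) 𝓘(ℝ, F) f (γ t))
    (hγ : MDifferentiableAt 𝓘(ℝ, ℝ) 𝓘(ℝ, E) γ t) :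
    HasDerivAt (fun τ => f (γ τ))
      (modelD E f (γ t) (modelVel E γ t)) t := by
  have h : HasFDerivAt (fun τ => f (γ τ)) ((modelD E f (γ t)).comp
      (mfderiv 𝓘(ℝ, ℝ) 𝓘(ℝ, E) γ t : ℝ →L[ℝ] E)) t :=
    hasMFDerivAt_iff_hasFDerivAt.1 (hf.hasMFDerivAt.comp t hγ.hasMFDerivAt)
  exact h.hasDerivAt

theorem hasDerivAt_chart_curve (x₀ : M) {γ : ℝ → M} {t : ℝ}
    (hγ : MDifferentiableAt 𝓘(ℝ, ℝ) 𝓘(ℝ, E) γ t)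
    (h : γ t ∈ (extChartAt 𝓘(ℝ, E) x₀).source) :
    HasDerivAt (fun τ => extChartAt 𝓘(ℝ, E) x₀ (γ τ)) (chartD x₀ (γ t) (modelVel E γ t)) t := by
  have := isManifold_one E M
  exact hasDerivAt_comp_curve (mdifferentiableAt_extChartAt (by simpa using h)) hγ

/-- Limits of almost orbits are a priori only continuous; this recovers differentiability on the
manifold from differentiability in one chart. -/
theorem velocity_of_hasDerivAt_chart (x₀ : M) {γ : ℝ → M} {t : ℝ} (hc : ContinuousAt γ t)
    (h : γ t ∈ (extChartAt 𝓘(ℝ, E) x₀).source) {v : E}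
    (hd : HasDerivAt (fun τ => extChartAt 𝓘(ℝ, E) x₀ (γ τ)) v t) :
    MDifferentiableAt 𝓘(ℝ, ℝ) 𝓘(ℝ, E) γ t ∧ chartD x₀ (γ t) (modelVel E γ t) = v := by
  have := isManifold_one E M
  have hs : MDifferentiableAt 𝓘(ℝ, E) 𝓘(ℝ, E) (extChartAt 𝓘(ℝ, E) x₀).symm
      (extChartAt 𝓘(ℝ, E) x₀ (γ t)) :=
    ((contMDiffOn_extChartAt_symm (n := 1) (I := 𝓘(ℝ, E)) x₀).contMDiffAt
      ((isOpen_extChartAt_target x₀).mem_nhds ((extChartAt 𝓘(ℝ, E) x₀).map_source h))).mdifferentiableAt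
      one_ne_zero
  have hm : MDifferentiableAt 𝓘(ℝ, ℝ) 𝓘(ℝ, E) γ t := by
    have h2 := hs.comp t hd.differentiableAt.mdifferentiableAt
    refine h2.congr_of_eventuallyEq ?_
    filter_upwards [hc.preimage_mem_nhds ((isOpen_extChartAt_source x₀).mem_nhds h)] with τ hτ
    exact ((extChartAt 𝓘(ℝ, E) x₀).left_inv hτ).symm
  exact ⟨hm, (hasDerivAt_chart_curve x₀ hm h).unique hd⟩

/-- The differential of a function in a chart. -/
theorem mfderiv_eq_fderiv_chart {F : Type*} [NormedAddCommGroup F] [NormedSpace ℝ F]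
    {f : M → F} (x₀ : M) {x : M} (hx : x ∈ (extChartAt 𝓘(ℝ, E) x₀).source)
    (hf : MDifferentiableAt 𝓘(ℝ, E) 𝓘(ℝ, F) f x) (v : E) :
    modelD E f x v =
      fderiv ℝ (fun y => f ((extChartAt 𝓘(ℝ, E) x₀).symm y)) (extChartAt 𝓘(ℝ, E) x₀ x)
        (chartD x₀ x v) := by
  have := isManifold_one E M
  have hs : MDifferentiableAt 𝓘(ℝ, E) 𝓘(ℝ, E) (extChartAt 𝓘(ℝ, E) x₀).symm
      (extChartAt 𝓘(ℝ, E) x₀ x) :=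
    ((contMDiffOn_extChartAt_symm (n := 1) (I := 𝓘(ℝ, E)) x₀).contMDiffAt
      ((isOpen_extChartAt_target x₀).mem_nhds ((extChartAt 𝓘(ℝ, E) x₀).map_source hx))).mdifferentiableAt
      one_ne_zero
  have hl := (extChartAt 𝓘(ℝ, E) x₀).left_inv hx
  have hf' : MDifferentiableAt 𝓘(ℝ, E) 𝓘(ℝ, F) f
      ((extChartAt 𝓘(ℝ, E) x₀).symm (extChartAt 𝓘(ℝ, E) x₀ x)) := by rwa [hl]
  have h : HasFDerivAt (fun y => f ((extChartAt 𝓘(ℝ, E) x₀).symm y)) ((modelD E f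
      ((extChartAt 𝓘(ℝ, E) x₀).symm (extChartAt 𝓘(ℝ, E) x₀ x))).comp
      (chartDsymm x₀ (extChartAt 𝓘(ℝ, E) x₀ x))) (extChartAt 𝓘(ℝ, E) x₀ x) :=
    hasMFDerivAt_iff_hasFDerivAt.1 (hf'.hasMFDerivAt.comp _ hs.hasMFDerivAt)
  have h2 : fderiv ℝ (fun y => f ((extChartAt 𝓘(ℝ, E) x₀).symm y)) (extChartAt 𝓘(ℝ, E) x₀ x)
        (chartD x₀ x v) = modelD E f
      ((extChartAt 𝓘(ℝ, E) x₀).symm (extChartAt 𝓘(ℝ, E) x₀ x))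
      (chartDsymm x₀ (extChartAt 𝓘(ℝ, E) x₀ x) (chartD x₀ x v)) :=
    congrArg (fun A : E →L[ℝ] F => A (chartD x₀ x v)) h.fderiv
  rw [h2, chartDsymm_chartD' x₀ hx, hl]

theorem contDiffAt_coordFun {F : Type*} [NormedAddCommGroup F] [NormedSpace ℝ F] {f : M → F}
    (hf : ContMDiff 𝓘(ℝ, E) 𝓘(ℝ, F) ∞ f) (x₀ : M) {y : E}
    (hy : y ∈ (extChartAt 𝓘(ℝ, E) x₀).target) :
    ContDiffAt ℝ ∞ (fun y => f ((extChartAt 𝓘(ℝ, E) x₀).symm y)) y :=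
  (hf.contMDiffAt.comp y ((contMDiffOn_extChartAt_symm (n := ∞) (I := 𝓘(ℝ, E)) x₀).contMDiffAt
      ((isOpen_extChartAt_target x₀).mem_nhds hy))).contDiffAt

end Coordinates

/-! ### Pointwise inequalities behind the monotonicity estimate. -/

section Monotonicity

/-- A smooth function with slope one on `(-∞, -1]` which vanishes on `[0, ∞)`. -/
theorem exists_smooth_truncation : ∃ (T : ℝ → ℝ) (C : ℝ), ContDiff ℝ ∞ T ∧ 0 ≤ C ∧
    (∀ x, 0 ≤ x → T x = 0) ∧ (∀ x, 0 ≤ deriv T x) ∧ (∀ x, x ≤ -1 → deriv T x = 1) ∧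
    (∀ x, |deriv (deriv T) x| ≤ C) ∧ (∀ x, x < -1 → deriv (deriv T) x = 0) := by
  -- The truncation is the primitive, based at 0, of x ↦ `Real.smoothTransition (-x)`; its second
  -- derivative lives on [-1, 0].
  have hτ : ContDiff ℝ ∞ (fun x : ℝ => Real.smoothTransition (-x)) :=
    Real.smoothTransition.contDiff.comp contDiff_neg
  have hd : ∀ x, HasDerivAt (fun x => ∫ y in (0 : ℝ)..x, Real.smoothTransition (-y))
      (Real.smoothTransition (-x)) x := fun x =>
    intervalIntegral.integral_hasDerivAt_right (hτ.continuous.intervalIntegrable _ _)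
      (hτ.continuous.stronglyMeasurableAtFilter _ _) hτ.continuous.continuousAt
  have hderiv : deriv (fun x => ∫ y in (0 : ℝ)..x, Real.smoothTransition (-y)) =
      fun x => Real.smoothTransition (-x) := funext fun x => (hd x).deriv
  have hcont : Continuous (deriv fun x : ℝ => Real.smoothTransition (-x)) :=
    hτ.continuous_deriv (by simp)
  have hz1 : ∀ x : ℝ, x < -1 → deriv (fun x : ℝ => Real.smoothTransition (-x)) x = 0 := by
    intro x hx
    have : (fun x : ℝ => Real.smoothTransition (-x)) =ᶠ[nhds x] fun _ => 1 := by
      filter_upwards [Iio_mem_nhds hx] with y hy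
      exact Real.smoothTransition.one_of_one_le (by simp only [mem_Iio] at hy; linarith)
    rw [this.deriv_eq]; simp
  have hz2 : ∀ x : ℝ, 0 < x → deriv (fun x : ℝ => Real.smoothTransition (-x)) x = 0 := by
    intro x hx
    have : (fun x : ℝ => Real.smoothTransition (-x)) =ᶠ[nhds x] fun _ => 0 := by
      filter_upwards [Ioi_mem_nhds hx] with y hy
      exact Real.smoothTransition.zero_of_nonpos (by simp only [mem_Ioi] at hy; linarith)
    rw [this.deriv_eq]; simp
  obtain ⟨C, hC⟩ := (isCompact_Icc (a := (-1 : ℝ)) (b := 0)).exists_bound_of_continuousOn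
    hcont.continuousOn
  refine ⟨fun x => ∫ y in (0 : ℝ)..x, Real.smoothTransition (-y), max C 0, ?_,
    le_max_right _ _, ?_, ?_, ?_, ?_, ?_⟩
  · rw [contDiff_infty_iff_deriv]
    exact ⟨fun x => (hd x).differentiableAt, by rw [hderiv]; exact hτ⟩
  · intro x hx
    refine intervalIntegral.integral_zero_ae (Filter.Eventually.of_forall fun y hy => ?_)
    rw [uIoc_of_le hx] at hy
    exact Real.smoothTransition.zero_of_nonpos (by linarith [hy.1])
  · intro x; rw [hderiv]; exact Real.smoothTransition.nonneg _
  · intro x hx; rw [hderiv]; exact Real.smoothTransition.one_of_one_le (by linarith)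
  · intro x; rw [hderiv]
    rcases lt_or_ge x (-1) with h | h
    · rw [hz1 x h]; simp
    rcases lt_or_ge 0 x with h' | h'
    · rw [hz2 x h']; simp
    · exact (hC x ⟨h, h'⟩).trans (le_max_left _ _)
  · intro x hx; rw [hderiv]; exact hz1 x hx

/-- The differential inequality for `log q + 16 C √q`, `q = P + σ²` and `r = √q`. -/
theorem log_laplacian_lower_bound {C P e σ r LP dP : ℝ} (he : 0 ≤ e)
    (hr : 0 < r) (hrq : r ^ 2 = P + σ ^ 2) (hC : 0 ≤ C) (hCr : 8 * (C * r) ≤ 1)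
    (hLP : (4 - 4 * (C * r)) * e ≤ LP) (hdP : dP ≤ 4 * P * e * (1 + C * r)) :
    4 * σ ^ 2 * e / r ^ 4 ≤
      (1 / r ^ 2 + 8 * C / r) * LP + -(1 / r ^ 4 + 4 * C / r ^ 3) * dP := by
  have hx : 0 ≤ C * r := by positivity
  have e1 : (1 / r ^ 2 + 8 * C / r) * LP + -(1 / r ^ 4 + 4 * C / r ^ 3) * dP =
      (r ^ 2 * (1 + 8 * (C * r)) * LP - (1 + 4 * (C * r)) * dP) / r ^ 4 := by
    field_simp
    ring
  rw [e1]
  refine div_le_div_of_nonneg_right ?_ (by positivity)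
  set x := C * r with hxdef
  have h1 : r ^ 2 * (1 + 8 * x) * ((4 - 4 * x) * e) ≤ r ^ 2 * (1 + 8 * x) * LP := by gcongr
  have h2 : (1 + 4 * x) * dP ≤ (1 + 4 * x) * (4 * P * e * (1 + x)) := by gcongr
  have h3 : (1 + 4 * x) * (4 * P * e * (1 + x)) =
      4 * e * (1 + 4 * x) * (1 + x) * r ^ 2 - 4 * e * σ ^ 2 * ((1 + 4 * x) * (1 + x)) := by
    rw [hrq]; ring
  have h4 : 4 * e * σ ^ 2 * 1 ≤ 4 * e * σ ^ 2 * ((1 + 4 * x) * (1 + x)) := by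
    gcongr; nlinarith
  -- Without the √q term the first-order coefficient of 4 e r² would be -2x, with the wrong sign;
  -- the factors 1 + 8x and 1 + 4x coming from it change this to 2x - 12x².
  have h5 : 0 ≤ 4 * e * r ^ 2 * (x * (1 - 6 * x)) := by
    have : 0 ≤ 1 - 6 * x := by linarith
    positivity
  nlinarith

/-- As P ≤ r² and C r ≤ 1/8, the gradient of P has square at most 8 r² e and the derivative of the
profile is at most 2 / r². This controls the term with the second derivative of the truncation. -/
theorem log_gradient_upper_bound {C P e σ r dP : ℝ} (he : 0 ≤ e)
    (hr : 0 < r) (hrq : r ^ 2 = P + σ ^ 2) (hC : 0 ≤ C) (hCr : 8 * (C * r) ≤ 1)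
    (hdP : dP ≤ 4 * P * e * (1 + C * r)) :
    (1 / r ^ 2 + 8 * C / r) ^ 2 * dP ≤ 32 * e / r ^ 2 := by
  have hx : 0 ≤ C * r := by positivity
  have e1 : (1 / r ^ 2 + 8 * C / r) = (1 + 8 * (C * r)) / r ^ 2 := by field_simp
  have h2 : dP ≤ 8 * r ^ 2 * e := by
    refine hdP.trans ?_
    have : P ≤ r ^ 2 := by rw [hrq]; nlinarith [sq_nonneg σ]
    calc 4 * P * e * (1 + C * r) ≤ 4 * r ^ 2 * e * 2 := by gcongr; linarith
      _ = _ := by ring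
  calc (1 / r ^ 2 + 8 * C / r) ^ 2 * dP ≤ (1 / r ^ 2 + 8 * C / r) ^ 2 * (8 * r ^ 2 * e) := by gcongr
    _ ≤ (2 / r ^ 2) ^ 2 * (8 * r ^ 2 * e) := by
        have : 1 / r ^ 2 + 8 * C / r ≤ 2 / r ^ 2 := by rw [e1]; gcongr; linarith
        gcongr
    _ = 32 * e / r ^ 2 := by field_simp; ring

variable {F : Type*} [NormedAddCommGroup F] [NormedSpace ℝ F]

theorem form_sq_le {B : F →L[ℝ] F →L[ℝ] ℝ} (hsymm : ∀ v w, B v w = B w v)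
    (hpos : ∀ v, 0 ≤ B v v) (v w : F) : B v w ^ 2 ≤ B v v * B w w := by
  have h : ∀ t : ℝ, 0 ≤ B w w * (t * t) + (2 * B v w) * t + B v v := by
    intro t
    have := hpos (v + t • w)
    simp only [map_add, map_smul, add_apply, smul_apply,
      smul_eq_mul, hsymm w v] at this
    nlinarith
  have := discrim_le_zero h
  rw [discrim] at this
  nlinarith

theorem form_add_le {B : F →L[ℝ] F →L[ℝ] ℝ} (hsymm : ∀ v w, B v w = B w v)
    (hpos : ∀ v, 0 ≤ B v v) (v w : F) : B (v + w) (v + w) ≤ 2 * B v v + 2 * B w w := by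
  have := hpos (v - w)
  simp only [map_add, map_sub, add_apply, sub_apply,
      hsymm w v] at this ⊢
  linarith

/-- The vectors v and j v are orthogonal of equal length, so Cauchy-Schwarz for w against B w v • v
+ B w (j v) • j v gives the bound up to a common factor. -/
theorem form_bessel {B : F →L[ℝ] F →L[ℝ] ℝ} (hsymm : ∀ v w, B v w = B w v)
    (hpos : ∀ v, 0 ≤ B v v) {j : F →L[ℝ] F} (hj : ∀ v, j (j v) = -v)
    (hjB : ∀ v w, B (j v) (j w) = B v w) (w v : F) :
    B w v ^ 2 + B w (j v) ^ 2 ≤ B w w * B v v := by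
  have h0 : B v (j v) = 0 := by
    have := hjB v (j v)
    rw [hj, map_neg, hsymm] at this
    linarith
  have h0' : B (j v) v = 0 := by rw [hsymm, h0]
  set S := B w v ^ 2 + B w (j v) ^ 2 with hS
  have hS0 : 0 ≤ S := by positivity
  have h1 := form_sq_le hsymm hpos w (B w v • v + B w (j v) • j v)
  simp only [map_add, map_smul, add_apply, smul_apply,
      smul_eq_mul, h0, h0', hjB] at h1
  have h2 : S * S ≤ S * (B w w * B v v) := by
    rw [hS]; nlinarith
  rcases hS0.eq_or_lt with h | h
  · rw [← h]; exact mul_nonneg (hpos _) (hpos _)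
  · exact le_of_mul_le_mul_left h2 h

/-- The pointwise estimates behind monotonicity: the squared distance to the centre is, up to
a relative error of the order of the distance, as for a holomorphic curve. -/
theorem pointwise_monotonicity {C : ℝ} (hC : 1 ≤ C) {B : F →L[ℝ] F →L[ℝ] ℝ}
    (hsymm : ∀ v w, B v w = B w v)
    (hlow : ∀ v, ‖v‖ ^ 2 ≤ C * B v v) (hup : ∀ v w, |B v w| ≤ C * ‖v‖ * ‖w‖)
    {j₀ j : F →L[ℝ] F} (hj : ∀ v, j₀ (j₀ v) = -v) (hjB : ∀ v w, B (j₀ v) (j₀ w) = B v w)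
    {w ξ D : F} (hjj : ‖j - j₀‖ ≤ C * ‖w‖) (hD : ‖D‖ ≤ 2 * C ^ 2 * ‖ξ‖ ^ 2) {p : ℝ} (hp : 0 ≤ p)
    (hpw : B w w ≤ p ^ 2) (hp1 : 3 * C ^ 5 * p ≤ 1) :
    (4 - 4 * (3 * C ^ 5 * p)) * B ξ ξ ≤ 2 * B ξ ξ + 2 * B (j ξ) (j ξ) + 2 * B w D ∧
    B w ξ ^ 2 + B w (j ξ) ^ 2 ≤ B w w * B ξ ξ * (1 + 3 * C ^ 5 * p) := by
  have hC0 : 0 < C := by linarith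
  have hpos : ∀ v, 0 ≤ B v v := fun v =>
    nonneg_of_mul_nonneg_right ((sq_nonneg ‖v‖).trans (hlow v)) hC0
  have hk : C ^ 3 ≤ C ^ 5 := pow_le_pow_right₀ hC (by norm_num)
  set e := B ξ ξ with he
  have he0 : 0 ≤ e := hpos ξ
  -- Only j₀ is an isometry of B. The defect δ is of relative size C³ p, and all errors below come
  -- from it and from the Laplacian term D.
  set δ := (j - j₀) ξ with hδ
  have hjξ : j ξ = j₀ ξ + δ := by simp [hδ]
  have hw : ‖w‖ ^ 2 ≤ C * p ^ 2 := (hlow w).trans (by gcongr)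
  have hξ : ‖ξ‖ ^ 2 ≤ C * e := hlow ξ
  have hδn : ‖δ‖ ≤ C * ‖w‖ * ‖ξ‖ := (ContinuousLinearMap.le_opNorm _ _).trans (by gcongr)
  have hδB : B δ δ ≤ (C ^ 3 * p) ^ 2 * e := by
    calc B δ δ ≤ C * ‖δ‖ * ‖δ‖ := (le_abs_self _).trans (hup _ _)
      _ ≤ C * (C * ‖w‖ * ‖ξ‖) * (C * ‖w‖ * ‖ξ‖) := by gcongr
      _ = C ^ 3 * ‖w‖ ^ 2 * ‖ξ‖ ^ 2 := by ring
      _ ≤ C ^ 3 * (C * p ^ 2) * (C * e) := by gcongr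
      _ = C ^ 5 * (p ^ 2 * e) := by ring
      _ ≤ C ^ 6 * (p ^ 2 * e) := by
          have : C ^ 5 ≤ C ^ 6 := pow_le_pow_right₀ hC (by norm_num)
          gcongr
      _ = _ := by ring
  set x := C ^ 3 * p with hx
  have hx0 : 0 ≤ x := by positivity
  have hxC : x ≤ C ^ 5 * p := by rw [hx]; gcongr
  have hx1 : x ≤ 1 := by nlinarith
  -- cross term
  have hcross : |B (j₀ ξ) δ| ≤ x * e := by
    refine abs_le_of_sq_le_sq ?_ (by positivity)
    calc B (j₀ ξ) δ ^ 2 ≤ B (j₀ ξ) (j₀ ξ) * B δ δ := form_sq_le hsymm hpos _ _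
      _ ≤ e * (x ^ 2 * e) := by rw [hjB]; gcongr
      _ = _ := by ring
  constructor
  · have h1 : B (j ξ) (j ξ) = e + 2 * B (j₀ ξ) δ + B δ δ := by
      rw [hjξ]; simp only [map_add, add_apply, hjB, hsymm δ]; ring
    have h2 : -(2 * (C ^ 5 * p) * e) ≤ B w D := by
      have : |B w D| ≤ 2 * (C ^ 5 * p) * e := by
        have hwp : ‖w‖ ≤ C * p := by
          refine abs_le_of_sq_le_sq' ?_ (by positivity) |>.2
          calc ‖w‖ ^ 2 ≤ C * p ^ 2 := hw
            _ ≤ C ^ 2 * p ^ 2 := by gcongr; nlinarith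
            _ = _ := by ring
        calc |B w D| ≤ C * ‖w‖ * ‖D‖ := hup _ _
          _ ≤ C * (C * p) * (2 * C ^ 2 * (C * e)) := by
              have : ‖D‖ ≤ 2 * C ^ 2 * (C * e) := hD.trans (by gcongr)
              gcongr
          _ = _ := by ring
      exact (abs_le.1 this).1
    have h3 := (abs_le.1 hcross).1
    have h4 := hpos δ
    have h5 : x * e ≤ C ^ 5 * p * e := by gcongr
    rw [h1]
    have h6 : 0 ≤ C ^ 5 * p * e := by positivity
    nlinarith
  · have hb := form_bessel hsymm hpos hj hjB w ξ
    have hwj : |B w (j₀ ξ)| ≤ p * √e := by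
      refine abs_le_of_sq_le_sq ?_ (by positivity)
      calc _ ≤ B w w * B (j₀ ξ) (j₀ ξ) := form_sq_le hsymm hpos _ _
        _ ≤ p ^ 2 * e := by rw [hjB]; gcongr
        _ = _ := by rw [mul_pow, Real.sq_sqrt he0]
    -- use the relative estimates
    have hA : B w (j₀ ξ) ^ 2 ≤ B w w * e := by
      have := form_sq_le hsymm hpos w (j₀ ξ); rwa [hjB] at this
    have hBd : B w δ ^ 2 ≤ x ^ 2 * (B w w * e) := by
      calc _ ≤ B w w * B δ δ := form_sq_le hsymm hpos _ _
        _ ≤ B w w * (x ^ 2 * e) := by gcongr; exact hpos w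
        _ = _ := by ring
    have hprod : B w (j₀ ξ) * B w δ ≤ x * (B w w * e) := by
      refine (le_abs_self _).trans (abs_le_of_sq_le_sq ?_ (by have := hpos w; positivity))
      calc (B w (j₀ ξ) * B w δ) ^ 2 = B w (j₀ ξ) ^ 2 * B w δ ^ 2 := by ring
        _ ≤ (B w w * e) * (x ^ 2 * (B w w * e)) := by
            have := hpos w; gcongr
        _ = _ := by ring
    rw [hjξ, map_add]
    have hPe : 0 ≤ B w w * e := mul_nonneg (hpos w) he0
    have hq : x ^ 2 * (B w w * e) ≤ x * (B w w * e) := by gcongr; nlinarith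
    have hq2 : x * (B w w * e) ≤ C ^ 5 * p * (B w w * e) := by gcongr
    nlinarith

end Monotonicity

/-! ### Second directional derivatives and the Laplacian of a quasilinear Cauchy-Riemann solution.
-/

section SecondDerivative

variable {Z : Type*} [NormedAddCommGroup Z] [NormedSpace ℝ Z]
  {F : Type*} [NormedAddCommGroup F] [NormedSpace ℝ F]

/-- The second derivative in the direction `v`. -/
def secondDeriv (f : Z → F) (v z : Z) : F := fderiv ℝ (fun z' => fderiv ℝ f z' v) z v

theorem differentiableAt_fderiv_apply {f : Z → F} {z : Z} (hf : ContDiffAt ℝ 2 f z) (v : Z) :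
    DifferentiableAt ℝ (fun z' => fderiv ℝ f z' v) z := by
  have h : ContDiffAt ℝ 1 (fderiv ℝ f) z := hf.fderiv_right (by norm_num)
  exact (h.differentiableAt one_ne_zero).clm_apply (differentiableAt_const v)

theorem fderiv_fderiv_apply {f : Z → F} {z : Z} (hf : ContDiffAt ℝ 2 f z) (v u : Z) :
    fderiv ℝ (fun z' => fderiv ℝ f z' v) z u = fderiv ℝ (fderiv ℝ f) z u v := by
  have h : ContDiffAt ℝ 1 (fderiv ℝ f) z := hf.fderiv_right (by norm_num)
  have := (h.differentiableAt one_ne_zero).hasFDerivAt.clm_apply (hasFDerivAt_const v z)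
  rw [this.fderiv]; simp

theorem fderiv_fderiv_comm {f : Z → F} {z : Z} (hf : ContDiffAt ℝ 2 f z) (v u : Z) :
    fderiv ℝ (fun z' => fderiv ℝ f z' v) z u = fderiv ℝ (fun z' => fderiv ℝ f z' u) z v := by
  rw [fderiv_fderiv_apply hf, fderiv_fderiv_apply hf]
  exact (hf.isSymmSndFDerivAt (by simp)) u v

theorem ContDiffAt.eventually_two {f : Z → F} {z : Z} (hf : ContDiffAt ℝ 2 f z) :
    ∀ᶠ z' in nhds z, ContDiffAt ℝ 2 f z' :=
  hf.eventually (by decide)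

theorem fderiv_comp_scalar {P : Z → ℝ} {g : ℝ → ℝ} {z : Z} (hP : ContDiffAt ℝ 2 P z)
    (hg : ContDiffAt ℝ 2 g (P z)) (v : Z) :
    fderiv ℝ (fun x => g (P x)) z v = deriv g (P z) * fderiv ℝ P z v := by
  have := (hg.differentiableAt two_ne_zero).hasDerivAt.comp_hasFDerivAt z
    (hP.differentiableAt two_ne_zero).hasFDerivAt
  have h2 : HasFDerivAt (fun x => g (P x)) (deriv g (P z) • fderiv ℝ P z) z := this
  rw [h2.fderiv]; simp

theorem secondDeriv_comp_scalar {P : Z → ℝ} {g : ℝ → ℝ} {z : Z} (hP : ContDiffAt ℝ 2 P z)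
    (hg : ContDiffAt ℝ 2 g (P z)) (v : Z) :
    secondDeriv (fun x => g (P x)) v z =
      deriv (deriv g) (P z) * fderiv ℝ P z v ^ 2 + deriv g (P z) * secondDeriv P v z := by
  have hev : (fun z' => fderiv ℝ (fun x => g (P x)) z' v) =ᶠ[nhds z]
      fun z' => deriv g (P z') * fderiv ℝ P z' v := by
    filter_upwards [ContDiffAt.eventually_two hP, hP.continuousAt.eventually
      (ContDiffAt.eventually_two hg)] with z' h1 h2
    exact fderiv_comp_scalar h1 h2 v
  rw [secondDeriv, hev.fderiv_eq]
  have hg' : DifferentiableAt ℝ (deriv g) (P z) := by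
    have := differentiableAt_fderiv_apply hg 1
    simpa only [fderiv_apply_one_eq_deriv] using this
  have h1 : HasFDerivAt (fun x => deriv g (P x)) (deriv (deriv g) (P z) • fderiv ℝ P z) z :=
    hg'.hasDerivAt.comp_hasFDerivAt z (hP.differentiableAt two_ne_zero).hasFDerivAt
  have h2 : HasFDerivAt (fun z' => deriv g (P z') * fderiv ℝ P z' v) _ z :=
    h1.mul (differentiableAt_fderiv_apply hP v).hasFDerivAt
  rw [h2.fderiv]
  simp [secondDeriv]
  ring

theorem fderiv_form_self {B : F →L[ℝ] F →L[ℝ] ℝ} (hsymm : ∀ v w, B v w = B w v) {w : Z → F}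
    {c : F} {z : Z} (hw : ContDiffAt ℝ 2 w z) (v : Z) :
    fderiv ℝ (fun x => B (w x - c) (w x - c)) z v = 2 * B (w z - c) (fderiv ℝ w z v) := by
  have h1 := (hw.differentiableAt two_ne_zero).hasFDerivAt.sub_const c
  have h2 := (B.hasFDerivAt.comp z h1).clm_apply h1
  have h3 : HasFDerivAt (fun x => B (w x - c) (w x - c)) _ z := h2
  rw [h3.fderiv]
  simp [hsymm (fderiv ℝ w z v)]
  ring

theorem secondDeriv_form_self {B : F →L[ℝ] F →L[ℝ] ℝ} (hsymm : ∀ v w, B v w = B w v) {w : Z → F}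
    {c : F} {z : Z} (hw : ContDiffAt ℝ 2 w z) (v : Z) :
    secondDeriv (fun x => B (w x - c) (w x - c)) v z =
      2 * B (fderiv ℝ w z v) (fderiv ℝ w z v) + 2 * B (w z - c) (secondDeriv w v z) := by
  have hev : (fun z' => fderiv ℝ (fun x => B (w x - c) (w x - c)) z' v) =ᶠ[nhds z]
      fun z' => 2 * B (w z' - c) (fderiv ℝ w z' v) := by
    filter_upwards [ContDiffAt.eventually_two hw] with z' h1
    exact fderiv_form_self hsymm h1 v
  rw [secondDeriv, hev.fderiv_eq]
  have h1 := (hw.differentiableAt two_ne_zero).hasFDerivAt.sub_const c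
  have h2 := (B.hasFDerivAt.comp z h1).clm_apply (differentiableAt_fderiv_apply hw v).hasFDerivAt
  have h3 : HasFDerivAt (fun z' => 2 * B (w z' - c) (fderiv ℝ w z' v)) _ z := h2.const_mul 2
  rw [h3.fderiv]
  simp [secondDeriv]
  ring

/-- The Laplacian of a solution of a quasilinear Cauchy-Riemann equation. -/
theorem laplacian_of_cauchyRiemann {w : Z → F} {j : F → F →L[ℝ] F} {z e₁ e₂ : Z}
    (hw : ContDiffAt ℝ 2 w z) (hj : DifferentiableAt ℝ j (w z))
    (hsq : ∀ v, j (w z) (j (w z) v) = -v)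
    (hCR : ∀ᶠ z' in nhds z, fderiv ℝ w z' e₂ = j (w z') (fderiv ℝ w z' e₁)) :
    secondDeriv w e₁ z + secondDeriv w e₂ z =
      fderiv ℝ j (w z) (fderiv ℝ w z e₂) (fderiv ℝ w z e₁) +
        j (w z) (fderiv ℝ j (w z) (fderiv ℝ w z e₁) (fderiv ℝ w z e₁)) := by
  have h1 : HasFDerivAt (fun z' => j (w z')) ((fderiv ℝ j (w z)).comp (fderiv ℝ w z)) z :=
    hj.hasFDerivAt.comp z (hw.differentiableAt two_ne_zero).hasFDerivAt
  have h2 := (h1.clm_apply (differentiableAt_fderiv_apply hw e₁).hasFDerivAt).fderiv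
  have h3 : (fun z' => fderiv ℝ w z' e₂) =ᶠ[nhds z] fun z' => j (w z') (fderiv ℝ w z' e₁) := hCR
  -- Differentiate the equation along e₂, exchange the mixed derivatives and use the equation again
  -- along e₁. By j² = -1 the second-order terms cancel and only terms quadratic in the first
  -- derivatives remain.
  have h4 : secondDeriv w e₂ z = fderiv ℝ j (w z) (fderiv ℝ w z e₂) (fderiv ℝ w z e₁) +
      j (w z) (fderiv ℝ (fun z' => fderiv ℝ w z' e₁) z e₂) := by
    rw [secondDeriv, h3.fderiv_eq, h2]; simp [add_comm]
  have h5 : fderiv ℝ (fun z' => fderiv ℝ w z' e₁) z e₂ =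
      fderiv ℝ j (w z) (fderiv ℝ w z e₁) (fderiv ℝ w z e₁) + j (w z) (secondDeriv w e₁ z) := by
    rw [fderiv_fderiv_comm hw, h3.fderiv_eq, h2]; simp [add_comm, secondDeriv]
  rw [h4, h5, map_add, hsq]
  abel

end SecondDerivative

/-! ### Derivatives of the radial profile log q + A √q - k. -/

section Logarithm

theorem deriv_log_add_sqrt (A k : ℝ) {q : ℝ} (hq : 0 < q) :
    deriv (fun q => Real.log q + A * √q - k) q = 1 / q + A / (2 * √q) := by
  have h := ((Real.hasDerivAt_log hq.ne').add
    ((Real.hasDerivAt_sqrt hq.ne').const_mul A)).sub_const k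
  have h' : HasDerivAt (fun q => Real.log q + A * √q - k) _ q := h
  rw [h'.deriv]; simp [div_eq_mul_inv]

theorem deriv_deriv_log_add_sqrt (A k : ℝ) {q : ℝ} (hq : 0 < q) :
    deriv (deriv (fun q => Real.log q + A * √q - k)) q = -(1 / q ^ 2 + A / (4 * q * √q)) := by
  have hev : deriv (fun q => Real.log q + A * √q - k) =ᶠ[nhds q]
      fun q => q⁻¹ + A / 2 * (√q)⁻¹ := by
    filter_upwards [Ioi_mem_nhds hq] with x hx
    rw [deriv_log_add_sqrt A k hx]
    field_simp
  rw [hev.deriv_eq]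
  have hs : 0 < √q := Real.sqrt_pos.2 hq
  have h := (hasDerivAt_inv hq.ne').add
    (((Real.hasDerivAt_sqrt hq.ne').inv hs.ne').const_mul (A / 2))
  have h' : HasDerivAt (fun q => q⁻¹ + A / 2 * (√q)⁻¹) _ q := h
  rw [h'.deriv]
  have key : ∀ r q : ℝ, 0 < r → r ^ 2 = q →
      -(q ^ 2)⁻¹ + A / 2 * (-(1 / (2 * r)) / r ^ 2) = -(1 / q ^ 2 + A / (4 * q * r)) := by
    rintro r _ hr rfl
    field_simp
    ring
  exact key _ _ hs (Real.sq_sqrt hq.le)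

theorem contDiffAt_log_add_sqrt (A k : ℝ) {q : ℝ} (hq : 0 < q) {n : WithTop ℕ∞} :
    ContDiffAt ℝ n (fun q => Real.log q + A * √q - k) q :=
  ((contDiffAt_id.log hq.ne').add (contDiffAt_const.mul (contDiffAt_id.sqrt hq.ne'))).sub
    contDiffAt_const

end Logarithm

/-! ### Almost complex curves and almost subharmonicity of the truncated logarithm. -/

section AlmostComplexCurve

variable {F : Type*} [NormedAddCommGroup F] [NormedSpace ℝ F]

/-- `w` solves `∂w/∂t = j(w) ∂w/∂s` on the open set `N` for an almost complex structure `j`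
whose value `j₀` at the centre `c` is an isometry of the scalar product `B`; the constant `C` bounds
the geometry. -/
structure IsAlmostComplexCurve (C : ℝ) (B : F →L[ℝ] F →L[ℝ] ℝ) (j₀ : F →L[ℝ] F)
    (j : F → F →L[ℝ] F) (c : F) (w : ℝ × ℝ → F) (N : Set (ℝ × ℝ)) : Prop where
  one_le : 1 ≤ C
  symm : ∀ v w, B v w = B w v
  low : ∀ v, ‖v‖ ^ 2 ≤ C * B v v
  up : ∀ v w, |B v w| ≤ C * ‖v‖ * ‖w‖
  sq₀ : ∀ v, j₀ (j₀ v) = -v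
  isom : ∀ v w, B (j₀ v) (j₀ w) = B v w
  isOpen : IsOpen N
  smooth : ∀ z ∈ N, ContDiffAt ℝ 2 w z
  diff : ∀ z ∈ N, DifferentiableAt ℝ j (w z)
  sq : ∀ z ∈ N, ∀ v, j (w z) (j (w z) v) = -v
  lip : ∀ z ∈ N, ‖j (w z) - j₀‖ ≤ C * ‖w z - c‖
  norm_le : ∀ z ∈ N, ‖j (w z)‖ ≤ C
  norm_fderiv_le : ∀ z ∈ N, ‖fderiv ℝ j (w z)‖ ≤ C
  cauchyRiemann : ∀ z ∈ N, fderiv ℝ w z (0, 1) = j (w z) (fderiv ℝ w z (1, 0))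

namespace IsAlmostComplexCurve

variable {C : ℝ} {B : F →L[ℝ] F →L[ℝ] ℝ} {j₀ : F →L[ℝ] F} {j : F → F →L[ℝ] F} {c : F}
  {w : ℝ × ℝ → F} {N : Set (ℝ × ℝ)}

theorem nonneg (h : IsAlmostComplexCurve C B j₀ j c w N) (v : F) : 0 ≤ B v v :=
  nonneg_of_mul_nonneg_right ((sq_nonneg ‖v‖).trans (h.low v)) (by linarith [h.one_le])

/-- By `laplacian_of_cauchyRiemann` the Laplacian is quadratic in the first derivatives, and ∂w/∂t
is bounded by ∂w/∂s through the equation. -/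
theorem norm_laplacian_le (h : IsAlmostComplexCurve C B j₀ j c w N) {z : ℝ × ℝ} (hz : z ∈ N) :
    ‖secondDeriv w (1, 0) z + secondDeriv w (0, 1) z‖ ≤
      2 * C ^ 2 * ‖fderiv ℝ w z (1, 0)‖ ^ 2 := by
  have hC : 0 ≤ C := by linarith [h.one_le]
  rw [laplacian_of_cauchyRiemann (h.smooth z hz) (h.diff z hz) (h.sq z hz)
    (Filter.mem_of_superset (h.isOpen.mem_nhds hz) h.cauchyRiemann)]
  set ξ := fderiv ℝ w z (1, 0)
  have h1 : ‖fderiv ℝ w z (0, 1)‖ ≤ C * ‖ξ‖ := by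
    rw [h.cauchyRiemann z hz]
    exact (ContinuousLinearMap.le_opNorm _ _).trans (by gcongr; exact h.norm_le z hz)
  have hdj : ∀ a b : F, ‖fderiv ℝ j (w z) a b‖ ≤ C * ‖a‖ * ‖b‖ := fun a b =>
    (ContinuousLinearMap.le_opNorm₂ _ _ _).trans (by gcongr; exact h.norm_fderiv_le z hz)
  calc _ ≤ C * (C * ‖ξ‖) * ‖ξ‖ + C * (C * ‖ξ‖ * ‖ξ‖) := by
        refine (norm_add_le _ _).trans (add_le_add ?_ ?_)
        · exact (hdj _ _).trans (by gcongr)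
        · refine (ContinuousLinearMap.le_opNorm _ _).trans ?_
          gcongr
          · exact h.norm_le z hz
          · exact hdj _ _
    _ = _ := by ring

/-- The truncated logarithm of the squared distance to the centre is almost subharmonic. -/
theorem laplacian_truncation_ge (h : IsAlmostComplexCurve C B j₀ j c w N) {T : ℝ → ℝ}
    (hT : ContDiff ℝ ∞ T) (hT0 : ∀ x, 0 ≤ deriv T x) {σ k : ℝ} {z : ℝ × ℝ}
    (hz : z ∈ N) {r : ℝ} (hr : 0 < r)
    (hrq : r ^ 2 = B (w z - c) (w z - c) + σ ^ 2) (hCr : 24 * (C ^ 5 * r) ≤ 1) :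
    deriv T (Real.log (r ^ 2) + 48 * C ^ 5 * r - k) *
        (4 * σ ^ 2 * B (fderiv ℝ w z (1, 0)) (fderiv ℝ w z (1, 0)) / r ^ 4) -
      |deriv (deriv T) (Real.log (r ^ 2) + 48 * C ^ 5 * r - k)| *
        (32 * B (fderiv ℝ w z (1, 0)) (fderiv ℝ w z (1, 0)) / r ^ 2) ≤
    secondDeriv (fun z => T (Real.log (B (w z - c) (w z - c) + σ ^ 2) +
        48 * C ^ 5 * √(B (w z - c) (w z - c) + σ ^ 2) - k)) (1, 0) z +
      secondDeriv (fun z => T (Real.log (B (w z - c) (w z - c) + σ ^ 2) +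
        48 * C ^ 5 * √(B (w z - c) (w z - c) + σ ^ 2) - k)) (0, 1) z := by
  have hC := h.one_le
  have hw := h.smooth z hz
  have hq : 0 < r ^ 2 := by positivity
  have hsr : √(r ^ 2) = r := Real.sqrt_sq hr.le
  set P : ℝ × ℝ → ℝ := fun z => B (w z - c) (w z - c) + σ ^ 2 with hPdef
  have hPz : P z = r ^ 2 := hrq.symm
  have hP : ContDiffAt ℝ 2 P z :=
    ((B.contDiff.contDiffAt.comp z (hw.sub contDiffAt_const)).clm_apply
      (hw.sub contDiffAt_const)).add contDiffAt_const
  set L : ℝ → ℝ := fun q => Real.log q + 48 * C ^ 5 * √q - k with hL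
  have hLs : ContDiffAt ℝ 2 L (P z) := by
    rw [hPz]; exact contDiffAt_log_add_sqrt _ _ hq
  have hTs : ContDiffAt ℝ 2 T (L (P z)) := (contDiff_infty.1 hT 2).contDiffAt
  have hLP : ContDiffAt ℝ 2 (fun z => L (P z)) z := hLs.comp z hP
  have hP1 : ∀ v, fderiv ℝ P z v = 2 * B (w z - c) (fderiv ℝ w z v) := fun v => by
    rw [hPdef, fderiv_add_const, fderiv_form_self h.symm hw]
  have hP2 : ∀ v, secondDeriv P v z = 2 * B (fderiv ℝ w z v) (fderiv ℝ w z v) +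
      2 * B (w z - c) (secondDeriv w v z) := fun v => by
    rw [← secondDeriv_form_self h.symm hw, secondDeriv, secondDeriv, hPdef]
    simp only [fderiv_add_const]
  have hmain : ∀ v, secondDeriv (fun z => T (L (P z))) v z =
      deriv (deriv T) (L (P z)) * (deriv L (P z) * fderiv ℝ P z v) ^ 2 +
      deriv T (L (P z)) * (deriv (deriv L) (P z) * fderiv ℝ P z v ^ 2 +
        deriv L (P z) * secondDeriv P v z) := fun v => by
    rw [secondDeriv_comp_scalar hLP hTs, fderiv_comp_scalar hP hLs, secondDeriv_comp_scalar hP hLs]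
  have hLPz : L (P z) = Real.log (r ^ 2) + 48 * C ^ 5 * r - k := by
    rw [hL, hPz]; simp only [hsr]
  have hd1 : deriv L (P z) = 1 / r ^ 2 + 8 * (3 * C ^ 5) / r := by
    rw [hPz, hL, deriv_log_add_sqrt _ _ hq, hsr]; field_simp; ring
  have hd2 : deriv (deriv L) (P z) = -(1 / r ^ 4 + 4 * (3 * C ^ 5) / r ^ 3) := by
    rw [hPz, hL, deriv_deriv_log_add_sqrt _ _ hq, hsr]; field_simp; ring
  rw [← hLPz]
  change _ ≤ secondDeriv (fun z => T (L (P z))) (1, 0) z + secondDeriv (fun z => T (L (P z))) (0, 1) z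
  rw [hmain, hmain]
  set ξ := fderiv ℝ w z (1, 0) with hξ
  have hpw := pointwise_monotonicity hC h.symm h.low h.up h.sq₀ h.isom (j := j (w z))
    (w := w z - c) (ξ := ξ) (h.lip z hz) (h.norm_laplacian_le hz) hr.le
    (by rw [hrq]; nlinarith) (by nlinarith [pow_pos (show 0 < C by linarith) 5])
  rw [← h.cauchyRiemann z hz] at hpw
  set e := B ξ ξ
  have he : 0 ≤ e := h.nonneg ξ
  set LP := secondDeriv P (1, 0) z + secondDeriv P (0, 1) z with hLPdef
  set dP := fderiv ℝ P z (1, 0) ^ 2 + fderiv ℝ P z (0, 1) ^ 2 with hdPdef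
  have hLPe : LP = 2 * e + 2 * B (fderiv ℝ w z (0, 1)) (fderiv ℝ w z (0, 1)) +
      2 * B (w z - c) (secondDeriv w (1, 0) z + secondDeriv w (0, 1) z) := by
    rw [hLPdef, hP2, hP2, map_add]; ring
  have hdPe : dP = 4 * (B (w z - c) ξ ^ 2 + B (w z - c) (fderiv ℝ w z (0, 1)) ^ 2) := by
    rw [hdPdef, hP1, hP1]; ring
  have hC5 : 0 ≤ 3 * C ^ 5 := by positivity
  have hdP : dP ≤ 4 * B (w z - c) (w z - c) * e * (1 + 3 * C ^ 5 * r) := by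
    rw [hdPe]; nlinarith [hpw.2]
  have hdP0 : 0 ≤ dP := by positivity
  -- The estimates are used with 3 C⁵ as the constant, which makes the correction term 16 · 3 C⁵ √q
  -- = 48 C⁵ √q.
  have g1 := log_laplacian_lower_bound he hr hrq hC5 (by linarith) (hpw.1.trans_eq hLPe.symm) hdP
  have g2 := log_gradient_upper_bound he hr hrq hC5 (by linarith) hdP
  rw [← hd1] at g1 g2
  rw [← hd2] at g1
  -- The second derivative of T has no sign, so its contribution is merely bounded; T' ≥ 0 preserves
  -- the lower bound `g1`.
  have g3 : deriv (deriv T) (L (P z)) * (deriv L (P z) ^ 2 * dP) ≥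
      -(|deriv (deriv T) (L (P z))| * (32 * e / r ^ 2)) := by
    have h0 : 0 ≤ deriv L (P z) ^ 2 * dP := by positivity
    have := neg_abs_le (deriv (deriv T) (L (P z)))
    calc _ ≥ -|deriv (deriv T) (L (P z))| * (deriv L (P z) ^ 2 * dP) := by gcongr
      _ ≥ -(|deriv (deriv T) (L (P z))| * (32 * e / r ^ 2)) := by
        rw [neg_mul]; gcongr
  have g4 := mul_le_mul_of_nonneg_left g1 (hT0 (L (P z)))
  calc _ ≤ deriv T (L (P z)) * (deriv L (P z) * LP + deriv (deriv L) (P z) * dP) +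
      deriv (deriv T) (L (P z)) * (deriv L (P z) ^ 2 * dP) := by linarith
    _ = _ := by rw [hLPdef, hdPdef]; ring

end IsAlmostComplexCurve

end AlmostComplexCurve

/-! ### Integration over a rectangle and the monotonicity estimate. -/

/-- The Laplacian of a function whose differential vanishes on the boundary of a rectangle has
integral zero. -/
theorem integral_laplacian_eq_zero {G : ℝ × ℝ → ℝ} (hG : ContDiff ℝ 2 G) {a b : ℝ × ℝ}
    (hab : a ≤ b)
    (hbd : ∀ z ∈ Icc a b, (z.1 = a.1 ∨ z.1 = b.1 ∨ z.2 = a.2 ∨ z.2 = b.2) → fderiv ℝ G z = 0) :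
    ∫ z in Icc a b, (secondDeriv G (1, 0) z + secondDeriv G (0, 1) z) = 0 := by
  have hc : ∀ v, ContDiff ℝ 1 (fun z => fderiv ℝ G z v) := fun v =>
    (hG.fderiv_right (m := 1) (by norm_num)).clm_apply contDiff_const
  have hd : ∀ v z, HasFDerivAt (fun z => fderiv ℝ G z v)
      (fderiv ℝ (fun z => fderiv ℝ G z v) z) z := fun v z =>
    ((hc v).differentiable one_ne_zero z).hasFDerivAt
  have hcc : ∀ v, Continuous (fun z => secondDeriv G v z) := fun v =>
    ((hc v).continuous_fderiv one_ne_zero).clm_apply continuous_const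
  have h := integral_divergence_prod_Icc_of_hasFDerivAt_of_le
    (fun z => fderiv ℝ G z (1, 0)) (fun z => fderiv ℝ G z (0, 1))
    (fun z => fderiv ℝ (fun z => fderiv ℝ G z (1, 0)) z)
    (fun z => fderiv ℝ (fun z => fderiv ℝ G z (0, 1)) z) a b hab
    (hc _).continuous.continuousOn (hc _).continuous.continuousOn (fun z _ => hd _ z)
    (fun z _ => hd _ z)
    (((hcc (1, 0)).add (hcc (0, 1))).continuousOn.integrableOn_compact isCompact_Icc)
  refine h.trans ?_
  have h1 : ∀ x ∈ uIcc a.1 b.1, ∀ y, (y = a.2 ∨ y = b.2) → fderiv ℝ G (x, y) (0, 1) = 0 := by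
    intro x hx y hy
    rw [uIcc_of_le hab.1] at hx
    rw [hbd (x, y) ?_ (by rcases hy with h | h <;> simp [h])]; · rfl
    rcases hy with rfl | rfl
    · exact ⟨⟨hx.1, le_rfl⟩, ⟨hx.2, hab.2⟩⟩
    · exact ⟨⟨hx.1, hab.2⟩, ⟨hx.2, le_rfl⟩⟩
  have h2 : ∀ y ∈ uIcc a.2 b.2, ∀ x, (x = a.1 ∨ x = b.1) → fderiv ℝ G (x, y) (1, 0) = 0 := by
    intro y hy x hx
    rw [uIcc_of_le hab.2] at hy
    rw [hbd (x, y) ?_ (by rcases hx with h | h <;> simp [h])]; · rfl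
    rcases hx with rfl | rfl
    · exact ⟨⟨le_rfl, hy.1⟩, ⟨hab.1, hy.2⟩⟩
    · exact ⟨⟨hab.1, hy.1⟩, ⟨le_rfl, hy.2⟩⟩
  rw [intervalIntegral.integral_congr (g := fun _ => (0 : ℝ)) fun x hx => h1 x hx b.2 (.inr rfl),
    intervalIntegral.integral_congr (g := fun _ => (0 : ℝ)) fun x hx => h1 x hx a.2 (.inl rfl),
    intervalIntegral.integral_congr (g := fun _ => (0 : ℝ)) fun x hx => h2 x hx b.1 (.inr rfl),
    intervalIntegral.integral_congr (g := fun _ => (0 : ℝ)) fun x hx => h2 x hx a.1 (.inl rfl)]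
  simp

section SecondDerivCongr

variable {Z : Type*} [NormedAddCommGroup Z] [NormedSpace ℝ Z]
  {F : Type*} [NormedAddCommGroup F] [NormedSpace ℝ F]

theorem secondDeriv_congr {f g : Z → F} {z : Z} (h : f =ᶠ[nhds z] g) (v : Z) :
    secondDeriv f v z = secondDeriv g v z := by
  have : (fun z' => fderiv ℝ f z' v) =ᶠ[nhds z] fun z' => fderiv ℝ g z' v := by
    filter_upwards [h.fderiv (𝕜 := ℝ)] with z' hz'
    rw [hz']
  rw [secondDeriv, secondDeriv, this.fderiv_eq]

end SecondDerivCongr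

theorem volume_real_closedBall_prod (z : ℝ × ℝ) {r : ℝ} (hr : 0 ≤ r) :
    volume.real (Metric.closedBall z r) = 4 * r ^ 2 := by
  rw [show z = (z.1, z.2) from rfl, ← closedBall_prod_same, measureReal_def, Measure.volume_eq_prod,
    Measure.prod_prod, Real.volume_closedBall, Real.volume_closedBall, ENNReal.toReal_mul,
    ENNReal.toReal_ofReal (by positivity)]
  ring

namespace IsAlmostComplexCurve

variable {F : Type*} [NormedAddCommGroup F] [NormedSpace ℝ F]
  {C : ℝ} {B : F →L[ℝ] F →L[ℝ] ℝ} {j₀ : F →L[ℝ] F} {j : F → F →L[ℝ] F} {c : F}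
  {w : ℝ × ℝ → F} {N : Set (ℝ × ℝ)}

/-- At the centre j equals j₀, so dw is conformal there for B, and the first-order expansion
controls the distance from c. The norm on ℝ × ℝ is the maximum norm, so balls are squares. -/
theorem near_center (h : IsAlmostComplexCurve C B j₀ j c w N) {z₁ : ℝ × ℝ} (hz : z₁ ∈ N)
    (hc : w z₁ = c) {m : ℝ} (hm : 0 < m)
    (hξ : B (fderiv ℝ w z₁ (1, 0)) (fderiv ℝ w z₁ (1, 0)) = m ^ 2) :
    ∀ᶠ z in nhds z₁, z ∈ N ∧ B (w z - c) (w z - c) ≤ 9 * m ^ 2 * dist z z₁ ^ 2 ∧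
      m ^ 2 / 2 ≤ B (fderiv ℝ w z (1, 0)) (fderiv ℝ w z (1, 0)) := by
  have hC := h.one_le
  have hw := h.smooth z₁ hz
  have hj : j (w z₁) = j₀ := by
    have := h.lip z₁ hz
    rw [hc, sub_self, norm_zero, mul_zero, norm_le_zero_iff, sub_eq_zero] at this
    rw [hc]; exact this
  have h1 := (hw.differentiableAt two_ne_zero).hasFDerivAt.isLittleO
  have hη : 0 < m / (2 * C) := by positivity
  have h2 := h1.def hη
  have hcont : ContinuousAt
      (fun z => B (fderiv ℝ w z (1, 0)) (fderiv ℝ w z (1, 0))) z₁ := by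
    have hd := (differentiableAt_fderiv_apply hw (1, 0)).continuousAt
    exact (B.continuous.continuousAt.comp hd).clm_apply hd
  have h3 : ∀ᶠ z in nhds z₁, m ^ 2 / 2 < B (fderiv ℝ w z (1, 0)) (fderiv ℝ w z (1, 0)) :=
    hcont.eventually_const_lt (by
    change _ < B (fderiv ℝ w z₁ (1, 0)) (fderiv ℝ w z₁ (1, 0))
    rw [hξ]; linarith [pow_pos hm 2])
  filter_upwards [h.isOpen.mem_nhds hz, h2, h3] with z hzN hz2 hz3
  refine ⟨hzN, ?_, hz3.le⟩
  set d := dist z z₁ with hd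
  have hd0 : 0 ≤ d := dist_nonneg
  set ξ := fderiv ℝ w z₁ (1, 0) with hξdef
  set ζ := fderiv ℝ w z₁ (0, 1) with hζdef
  have hζ : B ζ ζ = m ^ 2 := by
    rw [hζdef, h.cauchyRiemann z₁ hz, hj, h.isom, hξ]
  set x := (z - z₁).1 with hx
  set y := (z - z₁).2 with hy
  have hxd : x ^ 2 ≤ d ^ 2 := by
    rw [hd, dist_eq_norm, sq_le_sq, abs_of_nonneg (norm_nonneg (z - z₁))]
    exact norm_fst_le (z - z₁)
  have hyd : y ^ 2 ≤ d ^ 2 := by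
    rw [hd, dist_eq_norm, sq_le_sq, abs_of_nonneg (norm_nonneg (z - z₁))]
    exact norm_snd_le (z - z₁)
  have hL : fderiv ℝ w z₁ (z - z₁) = x • ξ + y • ζ := by
    rw [hξdef, hζdef, ← map_smul, ← map_smul, ← map_add]
    congr 1
    ext <;> simp [hx, hy]
  have hBs : ∀ (a : ℝ) v, B (a • v) (a • v) = a ^ 2 * B v v := fun a v => by
    simp only [map_smul, smul_apply, smul_eq_mul]; ring
  have hLB : B (x • ξ + y • ζ) (x • ξ + y • ζ) ≤ 4 * m ^ 2 * d ^ 2 := by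
    refine (form_add_le h.symm h.nonneg _ _).trans ?_
    rw [hBs, hBs, hξ, hζ]
    nlinarith [sq_nonneg m]
  set R := w z - w z₁ - fderiv ℝ w z₁ (z - z₁) with hR
  have hRn : ‖R‖ ≤ m / (2 * C) * d := by rw [hd, dist_eq_norm]; exact hz2
  have hRB : B R R ≤ m ^ 2 * d ^ 2 / 4 := by
    calc B R R ≤ C * ‖R‖ * ‖R‖ := (le_abs_self _).trans (h.up _ _)
      _ ≤ C * (m / (2 * C) * d) * (m / (2 * C) * d) := by gcongr
      _ = m ^ 2 * d ^ 2 / 4 * (1 / C) := by field_simp; ring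
      _ ≤ m ^ 2 * d ^ 2 / 4 * 1 := by
        gcongr; rw [div_le_one (by linarith)]; exact hC
      _ = _ := mul_one _
  have hsplit : w z - c = (x • ξ + y • ζ) + R := by rw [hR, hc, hL]; abel
  rw [hsplit]
  -- The linear part contributes 2 · 4 and the remainder 2 · 1/4 multiples of m² d², together less
  -- than 9.
  refine (form_add_le h.symm h.nonneg _ _).trans ?_
  nlinarith [sq_nonneg (m * d)]

/-- The truncated logarithm of the squared distance, extended by zero. -/
def logTruncation (C : ℝ) (B : F →L[ℝ] F →L[ℝ] ℝ) (c : F) (w : ℝ × ℝ → F) (N : Set (ℝ × ℝ))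
    (T : ℝ → ℝ) (σ k : ℝ) : ℝ × ℝ → ℝ :=
  N.indicator fun z => T (Real.log (B (w z - c) (w z - c) + σ ^ 2) +
        48 * C ^ 5 * √(B (w z - c) (w z - c) + σ ^ 2) - k)

theorem logTruncation_eventuallyEq (h : IsAlmostComplexCurve C B j₀ j c w N) (T : ℝ → ℝ)
    (σ k : ℝ) {z : ℝ × ℝ} (hz : z ∈ N) :
    logTruncation C B c w N T σ k =ᶠ[nhds z] fun z =>
      T (Real.log (B (w z - c) (w z - c) + σ ^ 2) +
        48 * C ^ 5 * √(B (w z - c) (w z - c) + σ ^ 2) - k) := by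
  filter_upwards [h.isOpen.mem_nhds hz] with z' hz'
  exact indicator_of_mem hz' _

/-- Outside the ball the argument of T is nonnegative. Closedness of the part of the curve in the
ball, in the whole plane, excludes a jump at the boundary of N, so the extension by zero is smooth.
-/
theorem logTruncation_eventuallyEq_zero (h : IsAlmostComplexCurve C B j₀ j c w N) {T : ℝ → ℝ}
    (hT : ∀ x, 0 ≤ x → T x = 0) {σ ρ : ℝ} (hρ : 0 < ρ)
    (hcl : IsClosed {z | z ∈ N ∧ B (w z - c) (w z - c) ≤ ρ ^ 2}) {z : ℝ × ℝ}
    (hz : z ∉ {z | z ∈ N ∧ B (w z - c) (w z - c) ≤ ρ ^ 2}) :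
    logTruncation C B c w N T σ (Real.log (ρ ^ 2)) =ᶠ[nhds z] fun _ => 0 := by
  filter_upwards [hcl.isOpen_compl.mem_nhds hz] with z' hz'
  by_cases hN : z' ∈ N
  · rw [logTruncation, indicator_of_mem hN]
    apply hT
    have h1 : ρ ^ 2 < B (w z' - c) (w z' - c) := by
      by_contra hcon
      exact hz' ⟨hN, not_lt.1 hcon⟩
    have h2 : Real.log (ρ ^ 2) ≤ Real.log (B (w z' - c) (w z' - c) + σ ^ 2) :=
      Real.log_le_log (by positivity) (by nlinarith)
    have h3 : 0 ≤ 48 * C ^ 5 * √(B (w z' - c) (w z' - c) + σ ^ 2) := by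
      have := h.one_le
      positivity
    linarith
  · exact indicator_of_notMem hN _

theorem contDiff_logTruncation (h : IsAlmostComplexCurve C B j₀ j c w N) {T : ℝ → ℝ}
    (hTs : ContDiff ℝ ∞ T)
    (hT : ∀ x, 0 ≤ x → T x = 0) {σ ρ : ℝ} (hσ : 0 < σ) (hρ : 0 < ρ)
    (hcl : IsClosed {z | z ∈ N ∧ B (w z - c) (w z - c) ≤ ρ ^ 2}) :
    ContDiff ℝ 2 (logTruncation C B c w N T σ (Real.log (ρ ^ 2))) := by
  rw [contDiff_iff_contDiffAt]
  intro z
  by_cases hz : z ∈ N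
  · refine ContDiffAt.congr_of_eventuallyEq ?_ (h.logTruncation_eventuallyEq T σ _ hz)
    have hw := h.smooth z hz
    have hP : ContDiffAt ℝ 2 (fun z => B (w z - c) (w z - c) + σ ^ 2) z :=
      ((B.contDiff.contDiffAt.comp z (hw.sub contDiffAt_const)).clm_apply
        (hw.sub contDiffAt_const)).add contDiffAt_const
    have hpos : 0 < B (w z - c) (w z - c) + σ ^ 2 := by
      have := h.nonneg (w z - c); positivity
    have hL := ContDiffAt.comp (n := 2) z (contDiffAt_log_add_sqrt (48 * C ^ 5) (Real.log (ρ ^ 2)) hpos) hP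
    exact ContDiffAt.comp (n := 2) z (contDiff_infty.1 hTs 2).contDiffAt hL
  · exact contDiffAt_const.congr_of_eventuallyEq
      (h.logTruncation_eventuallyEq_zero hT hρ hcl fun hz' => hz hz'.1)

end IsAlmostComplexCurve

/-- Since 48 C⁵ r ≤ 2 in the ball, r² < ρ² / 40 puts the argument of T below -3 + 2 = -1, where T
has slope one. -/
theorem exp_three_lt : Real.exp 3 < 40 := by
  have h : Real.exp 3 = Real.exp 1 ^ 3 := by rw [← Real.exp_nat_mul]; norm_num
  rw [h]
  have h1 := Real.exp_one_lt_d9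
  have h0 := Real.exp_pos 1
  calc Real.exp 1 ^ 3 < 3 ^ 3 := by gcongr; linarith
    _ < 40 := by norm_num

/-- Monotonicity: a curve through the centre of the ball of radius `ρ` whose part in the ball lies
in the interior of a rectangle has energy at least a multiple of `ρ²`. -/
theorem exists_monotonicity_constant : ∃ K : ℝ, 0 < K ∧
    ∀ {F : Type*} [NormedAddCommGroup F] [NormedSpace ℝ F]
      {C : ℝ} {B : F →L[ℝ] F →L[ℝ] ℝ} {j₀ : F →L[ℝ] F} {j : F → F →L[ℝ] F} {c : F}
      {w : ℝ × ℝ → F} {N : Set (ℝ × ℝ)} (_ : IsAlmostComplexCurve C B j₀ j c w N)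
      {ρ : ℝ} (_ : 0 < ρ) (_ : 48 * (C ^ 5 * ρ) ≤ 1)
      (_ : IsClosed {z | z ∈ N ∧ B (w z - c) (w z - c) ≤ ρ ^ 2})
      {a b z₁ : ℝ × ℝ} (_ : z₁ ∈ Icc a b) (_ : z₁ ∈ N) (_ : w z₁ = c)
      (_ : fderiv ℝ w z₁ (1, 0) ≠ 0)
      (_ : ∀ z ∈ Icc a b, z ∈ N → B (w z - c) (w z - c) ≤ ρ ^ 2 →
        a.1 < z.1 ∧ z.1 < b.1 ∧ a.2 < z.2 ∧ z.2 < b.2),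
      ρ ^ 2 ≤ K * ∫ z in Icc a b ∩ {z | z ∈ N ∧ B (w z - c) (w z - c) ≤ ρ ^ 2},
        B (fderiv ℝ w z (1, 0)) (fderiv ℝ w z (1, 0)) := by
  obtain ⟨T, CT, hTs, hCT, hT0, hTd, hT1, hT2, hT3⟩ := exists_smooth_truncation
  -- The first term is what the integral inequality yields; the 1 only ensures positivity when CT =
  -- 0.
  refine ⟨25 / 2 * (1280 * CT) + 1, by positivity, ?_⟩
  intro F _ _ C B j₀ j c w N h ρ hρ hCρ hcl a b z₁ hz₁ hz₁N hc hξ hbd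
  set Cl := {z | z ∈ N ∧ B (w z - c) (w z - c) ≤ ρ ^ 2} with hCl
  set e : ℝ × ℝ → ℝ := fun z => B (fderiv ℝ w z (1, 0)) (fderiv ℝ w z (1, 0)) with he
  have hC := h.one_le
  have he0 : ∀ z, 0 ≤ e z := fun z => h.nonneg _
  have hm2 : 0 < e z₁ := by
    have h1 := h.low (fderiv ℝ w z₁ (1, 0))
    have h2 : 0 < ‖fderiv ℝ w z₁ (1, 0)‖ ^ 2 := by have := norm_pos_iff.2 hξ; positivity
    exact pos_of_mul_pos_right (h2.trans_le h1) (by linarith)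
  set m := √(e z₁) with hm
  have hm0 : 0 < m := Real.sqrt_pos.2 hm2
  have hmsq : e z₁ = m ^ 2 := (Real.sq_sqrt hm2.le).symm
  have hint := hbd z₁ hz₁ hz₁N (by rw [hc]; simp; positivity)
  have hIoo : ∀ᶠ z in nhds z₁, z ∈ Icc a b := by
    have : Ioo a.1 b.1 ×ˢ Ioo a.2 b.2 ∈ nhds z₁ :=
      (isOpen_Ioo.prod isOpen_Ioo).mem_nhds ⟨⟨hint.1, hint.2.1⟩, hint.2.2⟩
    filter_upwards [this] with z hz
    exact ⟨⟨hz.1.1.le, hz.2.1.le⟩, ⟨hz.1.2.le, hz.2.2.le⟩⟩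
  obtain ⟨r₀, hr₀, hball⟩ := Metric.nhds_basis_closedBall.eventually_iff.1
    ((h.near_center hz₁N hc hm0 hmsq).and hIoo)
  -- The regularization σ is small enough for the square of half-side σ / m to lie where the
  -- first-order expansion holds and where the truncation is inactive.
  obtain ⟨σ, hσ, hσρ, hσr⟩ : ∃ σ : ℝ, 0 < σ ∧ 40 * σ ≤ ρ ∧ σ / m ≤ r₀ := by
    refine ⟨min (ρ / 40) (m * r₀), by positivity, ?_, ?_⟩
    · linarith [min_le_left (ρ / 40) (m * r₀)]
    · rw [div_le_iff₀ hm0, mul_comm]; exact min_le_right _ _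
  have hσρ2 : 1600 * σ ^ 2 ≤ ρ ^ 2 := by nlinarith
  have hσ2 : 0 < σ ^ 2 := by positivity
  set Sq := Metric.closedBall z₁ (σ / m) with hSq
  have hSqb : Sq ⊆ Metric.closedBall z₁ r₀ := Metric.closedBall_subset_closedBall hσr
  have hSqP : ∀ z ∈ Sq, B (w z - c) (w z - c) ≤ 9 * σ ^ 2 := fun z hz => by
    refine (hball (hSqb hz)).1.2.1.trans ?_
    have : dist z z₁ ≤ σ / m := hz
    calc 9 * m ^ 2 * dist z z₁ ^ 2 ≤ 9 * m ^ 2 * (σ / m) ^ 2 := by gcongr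
      _ = _ := by field_simp
  have hSqCl : Sq ⊆ Cl := fun z hz => ⟨(hball (hSqb hz)).1.1, (hSqP z hz).trans (by nlinarith)⟩
  have hSqI : Sq ⊆ Icc a b := fun z hz => (hball (hSqb hz)).2
  set G := IsAlmostComplexCurve.logTruncation C B c w N T σ (Real.log (ρ ^ 2)) with hG
  have hGs : ContDiff ℝ 2 G := h.contDiff_logTruncation hTs hT0 hσ hρ hcl
  have hG0 : ∀ z, z ∉ Cl → G =ᶠ[nhds z] fun _ => 0 := fun z hz =>
    h.logTruncation_eventuallyEq_zero hT0 hρ hcl hz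
  have hzero : ∫ z in Icc a b, (secondDeriv G (1, 0) z + secondDeriv G (0, 1) z) = 0 := by
    refine integral_laplacian_eq_zero hGs (hz₁.1.trans hz₁.2) fun z hz hzb => ?_
    have hzCl : z ∉ Cl := fun hz' => by
      have := hbd z hz hz'.1 hz'.2
      rcases hzb with h | h | h | h <;> rw [h] at this <;> simp at this
    rw [(hG0 z hzCl).fderiv_eq]; simp
  -- Lower bound for the Laplacian: a concentrated positive mass on the square around the centre,
  -- minus an energy term from the region where T bends. There r² ≥ ρ² / 40, whence 32 · 40 = 1280.
  have hpoint : ∀ z, Sq.indicator (fun _ => m ^ 2 / (50 * σ ^ 2)) z -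
      Cl.indicator (fun z => 1280 * CT / ρ ^ 2 * e z) z ≤
      secondDeriv G (1, 0) z + secondDeriv G (0, 1) z := by
    intro z
    by_cases hz : z ∈ Cl
    swap
    · rw [indicator_of_notMem hz, indicator_of_notMem (fun h => hz (hSqCl h)),
        secondDeriv_congr (hG0 z hz), secondDeriv_congr (hG0 z hz)]
      simp [secondDeriv]
    rw [indicator_of_mem hz, secondDeriv_congr (h.logTruncation_eventuallyEq T σ _ hz.1),
      secondDeriv_congr (h.logTruncation_eventuallyEq T σ _ hz.1)]
    set P := B (w z - c) (w z - c) with hP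
    have hP0 : 0 ≤ P := h.nonneg _
    set r := √(P + σ ^ 2) with hr
    have hr0 : 0 < r := Real.sqrt_pos.2 (by positivity)
    have hrq : r ^ 2 = P + σ ^ 2 := Real.sq_sqrt (by positivity)
    have hPρ : P ≤ ρ ^ 2 := hz.2
    have hr2 : r ≤ 2 * ρ := by
      refine abs_le_of_sq_le_sq' ?_ (by positivity) |>.2
      rw [hrq]; nlinarith
    have hC5 : 0 < C ^ 5 := by positivity
    have hCr : 24 * (C ^ 5 * r) ≤ 1 := by nlinarith
    have hmain := h.laplacian_truncation_ge hTs hTd (σ := σ) (k := Real.log (ρ ^ 2)) hz.1 hr0 hrq hCr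
    refine le_trans ?_ hmain
    set x := Real.log (r ^ 2) + 48 * C ^ 5 * r - Real.log (ρ ^ 2) with hx
    have hxl : ∀ {q : ℝ}, 0 < q → q < ρ ^ 2 / 40 → Real.log q < Real.log (ρ ^ 2) - 3 := by
      intro q hq0 hq
      rw [Real.log_lt_iff_lt_exp hq0, Real.exp_sub, Real.exp_log (by positivity)]
      refine hq.trans_le ?_
      gcongr
      exact exp_three_lt.le
    have hCr0 : 0 ≤ C ^ 5 * r := by positivity
    have hterm : 0 ≤ deriv T x * (4 * σ ^ 2 * e z / r ^ 4) := by
      have := hTd x; have := he0 z; positivity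
    have hK0 : 0 ≤ 1280 * CT / ρ ^ 2 * e z := by have := he0 z; positivity
    by_cases hxlt : x < -1
    · rw [hT3 x hxlt, abs_zero, zero_mul, sub_zero]
      by_cases hzS : z ∈ Sq
      · rw [indicator_of_mem hzS]
        have h9 := hSqP z hzS
        have hrs : r ^ 2 ≤ 10 * σ ^ 2 := by rw [hrq]; linarith
        have hr4 : r ^ 4 ≤ 100 * σ ^ 4 := by
          calc r ^ 4 = (r ^ 2) ^ 2 := by ring
            _ ≤ (10 * σ ^ 2) ^ 2 := by gcongr
            _ = _ := by ring
        have hez : m ^ 2 / 2 ≤ e z := (hball (hSqb hzS)).1.2.2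
        have h1 : m ^ 2 / (50 * σ ^ 2) ≤ 4 * σ ^ 2 * e z / r ^ 4 := by
          calc m ^ 2 / (50 * σ ^ 2) = 4 * σ ^ 2 * (m ^ 2 / 2) / (100 * σ ^ 4) := by
                field_simp; ring
            _ ≤ 4 * σ ^ 2 * e z / r ^ 4 := by have := he0 z; gcongr
        rw [hT1 x hxlt.le, one_mul]
        change _ ≤ 4 * σ ^ 2 * e z / r ^ 4
        linarith
      · rw [indicator_of_notMem hzS]
        change _ ≤ deriv T x * (4 * σ ^ 2 * e z / r ^ 4)
        linarith
    · have hzS : z ∉ Sq := fun hzS => by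
        apply hxlt
        have := hxl (q := r ^ 2) (by positivity) (by
          rw [hrq]
          have := hSqP z hzS
          linarith)
        rw [hx]; linarith
      rw [indicator_of_notMem hzS]
      have hr40 : ρ ^ 2 / 40 ≤ r ^ 2 := by
        by_contra hcon
        have := hxl (q := r ^ 2) (by positivity) (not_le.1 hcon)
        apply hxlt
        rw [hx]; linarith
      have h2 : |deriv (deriv T) x| * (32 * e z / r ^ 2) ≤ 1280 * CT / ρ ^ 2 * e z := by
        have := he0 z
        calc |deriv (deriv T) x| * (32 * e z / r ^ 2) ≤ CT * (32 * e z / (ρ ^ 2 / 40)) := by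
              gcongr; exact hT2 x
          _ = _ := by field_simp; ring
      change _ ≤ deriv T x * (4 * σ ^ 2 * e z / r ^ 4) -
        |deriv (deriv T) x| * (32 * e z / r ^ 2)
      linarith
  have hecont : ContinuousOn e Cl := fun z hz => by
    have hd := (differentiableAt_fderiv_apply (h.smooth z hz.1) (1, 0)).continuousAt
    exact ((B.continuous.continuousAt.comp hd).clm_apply hd).continuousWithinAt
  have hcompact : IsCompact (Icc a b ∩ Cl) := isCompact_Icc.inter_right hcl
  have heint : IntegrableOn e (Icc a b ∩ Cl) :=
    (hecont.mono inter_subset_right).integrableOn_compact hcompact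
  have hcc : ∀ v, Continuous (fun z => secondDeriv G v z) := fun v =>
    (((hGs.fderiv_right (m := 1) (by norm_num)).clm_apply
      contDiff_const).continuous_fderiv one_ne_zero).clm_apply continuous_const
  have hint1 : IntegrableOn (Sq.indicator (fun _ => m ^ 2 / (50 * σ ^ 2))) (Icc a b) := by
    refine IntegrableOn.integrable_indicator ?_ Metric.isClosed_closedBall.measurableSet |>.integrableOn
    exact integrableOn_const (isCompact_closedBall _ _).measure_lt_top.ne
  have hint2 : IntegrableOn (Cl.indicator (fun z => 1280 * CT / ρ ^ 2 * e z)) (Icc a b) := by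
    rw [IntegrableOn, integrable_indicator_iff hcl.measurableSet, IntegrableOn,
      Measure.restrict_restrict hcl.measurableSet, inter_comm]
    exact heint.const_mul _
  have hfin : ∫ z in Icc a b, (Sq.indicator (fun _ => m ^ 2 / (50 * σ ^ 2)) z -
      Cl.indicator (fun z => 1280 * CT / ρ ^ 2 * e z) z) ≤ 0 := by
    rw [← hzero]
    exact integral_mono (hint1.sub hint2)
      (((hcc (1, 0)).add (hcc (0, 1))).continuousOn.integrableOn_compact isCompact_Icc) hpoint
  rw [integral_sub hint1 hint2, setIntegral_indicator Metric.isClosed_closedBall.measurableSet,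
    setIntegral_indicator hcl.measurableSet, setIntegral_const, inter_eq_self_of_subset_right hSqI,
    volume_real_closedBall_prod _ (by positivity), integral_const_mul, smul_eq_mul] at hfin
  set I := ∫ z in Icc a b ∩ Cl, e z with hI
  have hI0 : 0 ≤ I := integral_nonneg he0
  -- The mass of the square depends neither on σ nor on the speed m: this is the point mass of the
  -- Laplacian of the logarithm.
  have e1 : 4 * (σ / m) ^ 2 * (m ^ 2 / (50 * σ ^ 2)) = 2 / 25 := by field_simp; norm_num
  rw [e1] at hfin
  have h3 : 2 / 25 ≤ 1280 * CT * I / ρ ^ 2 := by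
    calc (2 : ℝ) / 25 ≤ 1280 * CT / ρ ^ 2 * I := by linarith
      _ = _ := by ring
  rw [le_div_iff₀ (by positivity)] at h3
  linarith

/-! ### Nearby maps into a compact manifold are homotopic. -/

section Homotopy

open Topology

/-- A deformation of nearby pairs of points: `H x y` is a path starting at `x`, constant if `x = y`,
that ends at `y` for `y` near `x₀`. -/
theorem exists_local_deformation {E : Type*} [NormedAddCommGroup E] [NormedSpace ℝ E]
    [FiniteDimensional ℝ E] {M : Type*} [TopologicalSpace M] [ChartedSpace E M]
    [IsManifold 𝓘(ℝ, E) ∞ M] [T2Space M] (x₀ : M) :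
    ∃ (D : Set (M × M)) (H : (M × M) × ℝ → M) (O : Set M), IsOpen D ∧ (∀ x, (x, x) ∈ D) ∧
      IsOpen O ∧ x₀ ∈ O ∧
      ContinuousOn H (D ×ˢ Icc 0 1) ∧ (∀ x y, H ((x, y), 0) = x) ∧ (∀ y l, H ((y, y), l) = y) ∧
      ∀ x y, (x, y) ∈ D → y ∈ O → H ((x, y), 1) = y := by
  classical
  obtain ⟨χ⟩ : Nonempty (SmoothBumpFunction 𝓘(ℝ, E) x₀) := inferInstance
  set φ := extChartAt 𝓘(ℝ, E) x₀ with hφ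
  set A := tsupport χ with hA
  have hAs : A ⊆ φ.source := by
    rw [hφ, extChartAt_source]; exact χ.tsupport_subset_chartAt_source
  have hsrc : IsOpen φ.source := isOpen_extChartAt_source x₀
  have htgt : IsOpen φ.target := isOpen_extChartAt_target x₀
  -- The chart image need not be convex, so the whole coordinate segment is required to stay in it.
  set D₂ : Set (M × M) := {p | p.1 ∈ φ.source ∧ p.2 ∈ φ.source ∧
    ∀ l ∈ Icc (0 : ℝ) 1, φ p.1 + l • (φ p.2 - φ p.1) ∈ φ.target} with hD₂
  have hcφ : ∀ x ∈ φ.source, ContinuousAt φ x := fun x hx =>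
    (continuousOn_extChartAt (I := 𝓘(ℝ, E)) x₀).continuousAt (hsrc.mem_nhds hx)
  have hcφs : ∀ y ∈ φ.target, ContinuousAt φ.symm y := fun y hy =>
    (continuousOn_extChartAt_symm (I := 𝓘(ℝ, E)) x₀).continuousAt (htgt.mem_nhds hy)
  have hD₂o : IsOpen D₂ := by
    rw [isOpen_iff_eventually]
    rintro ⟨x, y⟩ ⟨hx, hy, hl⟩
    have h1 : ∀ᶠ p : M × M in 𝓝 (x, y), p.1 ∈ φ.source :=
      continuous_fst.continuousAt.eventually (hsrc.mem_nhds hx)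
    have h2 : ∀ᶠ p : M × M in 𝓝 (x, y), p.2 ∈ φ.source :=
      continuous_snd.continuousAt.eventually (hsrc.mem_nhds hy)
    have h3 : ∀ᶠ p : M × M in 𝓝 (x, y), ∀ l ∈ Icc (0 : ℝ) 1,
        φ p.1 + l • (φ p.2 - φ p.1) ∈ φ.target := by
      refine isCompact_Icc.eventually_forall_of_forall_eventually fun l hl' => ?_
      have hc1 : ContinuousAt (fun q : (M × M) × ℝ => φ q.1.1) ((x, y), l) :=
        ContinuousAt.comp (g := φ) (f := fun q : (M × M) × ℝ => q.1.1) (hcφ x hx) (by fun_prop)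
      have hc2 : ContinuousAt (fun q : (M × M) × ℝ => φ q.1.2) ((x, y), l) :=
        ContinuousAt.comp (g := φ) (f := fun q : (M × M) × ℝ => q.1.2) (hcφ y hy) (by fun_prop)
      exact (hc1.add (continuous_snd.continuousAt.smul (hc2.sub hc1))).eventually
        (htgt.mem_nhds (hl l hl'))
    filter_upwards [h1, h2, h3] with p a b c using ⟨a, b, c⟩
  set D : Set (M × M) := {p | p.2 ∉ A} ∪ D₂ with hD
  -- The point moves along the coordinate segment by the fraction χ(y): nothing happens for y off
  -- the support of χ, and y is reached where χ = 1.
  set H : (M × M) × ℝ → M := fun q =>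
    if q.1.1 ∈ φ.source ∧ q.1.2 ∈ φ.source then
      φ.symm (φ q.1.1 + (q.2 * χ q.1.2) • (φ q.1.2 - φ q.1.1)) else q.1.1 with hH
  have hAc : IsOpen {p : M × M | p.2 ∉ A} :=
    (isClosed_tsupport χ).isOpen_compl.preimage continuous_snd
  have hHA : ∀ x y l, y ∉ A → H ((x, y), l) = x := by
    intro x y l hy
    have : χ y = 0 := image_eq_zero_of_notMem_tsupport hy
    simp only [hH, this, mul_zero, zero_smul, add_zero]
    split_ifs with h
    · exact φ.left_inv h.1
    · rfl
  refine ⟨D, H, interior {x | χ x = 1} ∩ φ.source, hAc.union hD₂o, ?_, ?_, ?_, ?_, ?_, ?_, ?_⟩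
  · intro x
    by_cases hx : x ∈ A
    · right
      refine ⟨hAs hx, hAs hx, fun l _ => ?_⟩
      simpa using φ.map_source (hAs hx)
    · left; exact hx
  · exact isOpen_interior.inter hsrc
  · exact ⟨mem_interior_iff_mem_nhds.2 χ.eventuallyEq_one, mem_extChartAt_source x₀⟩
  · rintro ⟨⟨x, y⟩, l⟩ ⟨hxy, hl⟩
    by_cases hy : y ∈ A
    · obtain ⟨hx, hy, hl'⟩ : (x, y) ∈ D₂ := hxy.resolve_left fun h => h hy
      refine ContinuousAt.continuousWithinAt ?_
      have hev : H =ᶠ[𝓝 ((x, y), l)] fun q =>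
          φ.symm (φ q.1.1 + (q.2 * χ q.1.2) • (φ q.1.2 - φ q.1.1)) := by
        have h1 : ∀ᶠ q : (M × M) × ℝ in 𝓝 ((x, y), l), q.1.1 ∈ φ.source :=
          (show ContinuousAt (fun q : (M × M) × ℝ => q.1.1) _ by fun_prop).eventually
            (hsrc.mem_nhds hx)
        have h2 : ∀ᶠ q : (M × M) × ℝ in 𝓝 ((x, y), l), q.1.2 ∈ φ.source :=
          (show ContinuousAt (fun q : (M × M) × ℝ => q.1.2) ((x, y), l) by fun_prop).eventually
            (hsrc.mem_nhds hy)
        filter_upwards [h1, h2] with q a b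
        simp only [hH, if_pos (show q.1.1 ∈ φ.source ∧ q.1.2 ∈ φ.source from ⟨a, b⟩)]
      refine ContinuousAt.congr ?_ hev.symm
      have hc1 : ContinuousAt (fun q : (M × M) × ℝ => φ q.1.1) ((x, y), l) :=
        ContinuousAt.comp (g := φ) (f := fun q : (M × M) × ℝ => q.1.1) (hcφ x hx) (by fun_prop)
      have hc2 : ContinuousAt (fun q : (M × M) × ℝ => φ q.1.2) ((x, y), l) :=
        ContinuousAt.comp (g := φ) (f := fun q : (M × M) × ℝ => q.1.2) (hcφ y hy) (by fun_prop)
      have hc3 : ContinuousAt (fun q : (M × M) × ℝ => q.2 * χ q.1.2) ((x, y), l) := by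
        have := χ.continuous
        fun_prop
      refine ContinuousAt.comp (g := φ.symm) ?_ (hc1.add (hc3.smul (hc2.sub hc1)))
      refine hcφs _ (hl' _ ⟨mul_nonneg hl.1 χ.nonneg, mul_le_one₀ hl.2 χ.nonneg χ.le_one⟩)
    · refine ContinuousAt.continuousWithinAt ?_
      have hev : H =ᶠ[𝓝 ((x, y), l)] fun q => q.1.1 := by
        have h1 : ∀ᶠ q : (M × M) × ℝ in 𝓝 ((x, y), l), q.1.2 ∉ A :=
          (show ContinuousAt (fun q : (M × M) × ℝ => q.1.2) ((x, y), l) by fun_prop).eventually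
            ((isClosed_tsupport χ).isOpen_compl.mem_nhds hy)
        filter_upwards [h1] with q a
        exact hHA q.1.1 q.1.2 q.2 a
      exact ContinuousAt.congr (by fun_prop) hev.symm
  · intro x y
    simp only [hH, zero_mul, zero_smul, add_zero]
    split_ifs with h
    · exact φ.left_inv h.1
    · rfl
  · intro y l
    simp only [hH, sub_self, smul_zero, add_zero]
    split_ifs with h
    · exact φ.left_inv h.1
    · rfl
  · rintro x y hxy ⟨hy1, hys⟩
    have hχ : y ∈ {x | χ x = 1} := interior_subset hy1
    rw [mem_ofPred_eq] at hχ
    have hyA : y ∈ A := subset_tsupport _ (by simp [Function.mem_support, hχ])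
    obtain ⟨hx, hy, _⟩ : (x, y) ∈ D₂ := hxy.resolve_left fun h => h hyA
    simp only [hH, if_pos (show x ∈ φ.source ∧ y ∈ φ.source from ⟨hx, hy⟩), hχ, mul_one, one_smul,
      add_sub_cancel]
    exact φ.left_inv hy

/-- On a compact manifold, maps which are close to each other are homotopic. -/
theorem exists_homotopic_of_close (E : Type*) [NormedAddCommGroup E] [NormedSpace ℝ E]
    [FiniteDimensional ℝ E] {M : Type*} [TopologicalSpace M] [ChartedSpace E M]
    [IsManifold 𝓘(ℝ, E) ∞ M] [T2Space M] [CompactSpace M] (S : Type*) [TopologicalSpace S] :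
    ∃ D : Set (M × M), IsOpen D ∧ (∀ x, (x, x) ∈ D) ∧
      ∀ f g : C(S, M), (∀ s, (g s, f s) ∈ D) → g.Homotopic f := by
  choose D H O hDo hDd hOo hxO hHc hH0 hHd hH1 using
    fun x₀ : M => exists_local_deformation (E := E) x₀
  -- Local deformations are composed one after the other. Points that have already arrived stay put,
  -- because each deformation is constant on the diagonal, so after a finite cover every point has
  -- arrived.
  have key : ∀ t : Finset M, ∃ (D' : Set (M × M)) (R : M × M → M), IsOpen D' ∧ (∀ x, (x, x) ∈ D') ∧
      ContinuousOn R D' ∧ (∀ y, R (y, y) = y) ∧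
      (∀ x y, (x, y) ∈ D' → (∃ k ∈ t, y ∈ O k) → R (x, y) = y) ∧
      ∀ f g : C(S, M), (∀ s, (g s, f s) ∈ D') →
        ∃ g' : C(S, M), (∀ s, g' s = R (g s, f s)) ∧ g.Homotopic g' := by
    classical
    intro t
    induction t using Finset.induction_on with
    | empty =>
      exact ⟨univ, Prod.fst, isOpen_univ, fun _ => mem_univ _, continuous_fst.continuousOn,
        fun _ => rfl, by simp, fun f g _ => ⟨g, fun _ => rfl, .refl g⟩⟩
    | insert k t _ ih =>
      obtain ⟨D', R, hD'o, hD'd, hRc, hRd, hR1, hRh⟩ := ih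
      have hpc : ContinuousOn (fun p : M × M => (R p, p.2)) D' := hRc.prodMk continuousOn_snd
      refine ⟨D' ∩ (fun p => (R p, p.2)) ⁻¹' D k, fun p => H k ((R p, p.2), 1),
        hpc.isOpen_inter_preimage hD'o (hDo k), fun x => ⟨hD'd x, ?_⟩, ?_, ?_, ?_, ?_⟩
      · simp only [mem_preimage, hRd]; exact hDd k x
      · refine (hHc k).comp ((hpc.mono inter_subset_left).prodMk continuousOn_const) ?_
        exact fun p hp => ⟨hp.2, by simp⟩
      · intro y; simp only [hRd, hHd]
      · rintro x y ⟨hxy, hxy2⟩ ⟨i, hi, hyi⟩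
        rcases Finset.mem_insert.1 hi with rfl | hi
        · exact hH1 _ _ _ hxy2 hyi
        · simp only [hR1 x y hxy ⟨i, hi, hyi⟩, hHd]
      · intro f g hfg
        obtain ⟨g', hg', hgg'⟩ := hRh f g fun s => (hfg s).1
        have hmem : ∀ s, (g' s, f s) ∈ D k := fun s => by rw [hg']; exact (hfg s).2
        have hcont : Continuous fun q : unitInterval × S => H k ((g' q.2, f q.2), (q.1 : ℝ)) := by
          refine (hHc k).comp_continuous (by fun_prop) fun q => ⟨hmem q.2, q.1.2⟩
        refine ⟨⟨fun s => H k ((g' s, f s), 1), ?_⟩, fun s => by simp [hg'], hgg'.trans ⟨?_⟩⟩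
        · exact (hHc k).comp_continuous (by fun_prop) fun s => ⟨hmem s, by simp⟩
        · exact
            { toFun := fun q => H k ((g' q.2, f q.2), (q.1 : ℝ))
              continuous_toFun := hcont
              map_zero_left := fun s => by simp [hH0]
              map_one_left := fun s => by simp }
  obtain ⟨t, ht⟩ := isCompact_univ.elim_finite_subcover O hOo fun x _ => mem_iUnion.2 ⟨x, hxO x⟩
  obtain ⟨D', R, hD'o, hD'd, _, _, hR1, hRh⟩ := key t
  refine ⟨D', hD'o, hD'd, fun f g hfg => ?_⟩
  obtain ⟨g', hg', hgg'⟩ := hRh f g hfg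
  have : g' = f := by
    ext s
    rw [hg', hR1 _ _ (hfg s)]
    simpa using ht (mem_univ (f s))
  rwa [this] at hgg'

end Homotopy

/-! ### Level sets at the boundary of the shell, the crossing lemma and cutoffs. -/

section Shell

open Topology

/-- Near a regular point of `κ`, a level set of `κ` that bounds an open set `A` from above lies in
the closure of `A`. -/
theorem mem_closure_of_regular {E : Type*} [NormedAddCommGroup E] [NormedSpace ℝ E]
    {κ : E → ℝ} {κ' : E →L[ℝ] ℝ} {y₀ w : E} (h : HasStrictFDerivAt κ κ' y₀) (hw : κ' w = 1)
    {A B T : Set E} (hA : IsOpen A) (hB : IsOpen B) (hAB : Disjoint A B) (hT : T ∈ 𝓝 y₀)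
    (hTAB : ∀ y ∈ T, κ y ≠ κ y₀ → y ∈ A ∪ B) :
    ∃ N ∈ 𝓝 y₀, ∀ y ∈ N, ∀ p ∈ N, κ y = κ y₀ → p ∈ A → κ y₀ ≤ κ p → y ∈ closure A := by
  set m := ‖w‖ + 1 with hm
  have hm0 : 0 < m := by positivity
  -- With this error κ still grows at rate at least 1/2 in the direction w.
  have h1 := h.isLittleO.def (show (0 : ℝ) < 1 / (2 * m) by positivity)
  obtain ⟨R, hR, hRsub⟩ : ∃ R > 0, Metric.ball y₀ R ⊆ T ∧ ∀ y ∈ Metric.ball y₀ R,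
      ∀ z ∈ Metric.ball y₀ R, ‖κ y - κ z - κ' (y - z)‖ ≤ 1 / (2 * m) * ‖y - z‖ := by
    rw [nhds_prod_eq] at h1
    obtain ⟨s, hs, hs'⟩ := Filter.mem_prod_self_iff.1 h1
    obtain ⟨R, hR, hRs⟩ := Metric.mem_nhds_iff.1 (Filter.inter_mem hT hs)
    exact ⟨R, hR, fun y hy => (hRs hy).1, fun y hy z hz =>
      hs' (show (y, z) ∈ s ×ˢ s from ⟨(hRs hy).2, (hRs hz).2⟩)⟩
  obtain ⟨hRT, hlip⟩ := hRsub
  have hinc : ∀ y ∈ Metric.ball y₀ R, ∀ τ : ℝ, 0 ≤ τ → y + τ • w ∈ Metric.ball y₀ R →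
      κ y + τ / 2 ≤ κ (y + τ • w) := by
    intro y hy τ hτ hy'
    have h2 := hlip _ hy' y hy
    simp only [add_sub_cancel_left, map_smul, hw, smul_eq_mul, mul_one, norm_smul,
      Real.norm_eq_abs, abs_of_nonneg hτ] at h2
    have h3 : 1 / (2 * m) * (τ * ‖w‖) ≤ τ / 2 := by
      rw [div_mul_eq_mul_div, div_le_div_iff₀ (by positivity) (by norm_num)]
      nlinarith [norm_nonneg w]
    linarith [(abs_le.1 h2).1]
  set τ₀ := R / (2 * m) with hτ₀
  have hτ₀0 : 0 < τ₀ := by positivity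
  have hτw : ∀ τ, 0 ≤ τ → τ ≤ τ₀ → ‖τ • w‖ < R / 2 := by
    intro τ h0 h1
    rw [norm_smul, Real.norm_eq_abs, abs_of_nonneg h0]
    calc τ * ‖w‖ ≤ τ₀ * ‖w‖ := by gcongr
      _ < τ₀ * m := by gcongr; simp [hm]
      _ = R / 2 := by rw [hτ₀]; field_simp
  have hN : {y | |κ y - κ y₀| < τ₀ / 4} ∈ 𝓝 y₀ := by
    have := h.continuousAt.sub (continuousAt_const (y := κ y₀))
    have := this.abs.eventually_lt (continuousAt_const (y := τ₀ / 4)) (by simp; positivity)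
    exact this
  obtain ⟨r, hr, hrN⟩ := Metric.mem_nhds_iff.1 (Filter.inter_mem hN
    (Metric.ball_mem_nhds y₀ (half_pos hR)))
  refine ⟨Metric.ball y₀ r, Metric.ball_mem_nhds _ hr, fun y hy p hp hya hpA hpa => ?_⟩
  have hshift : ∀ q ∈ Metric.ball y₀ r, ∀ τ, 0 ≤ τ → τ ≤ τ₀ → q + τ • w ∈ Metric.ball y₀ R := by
    intro q hq τ h0 h1
    have h2 := (hrN hq).2
    rw [mem_ball_iff_norm] at h2 ⊢
    calc ‖q + τ • w - y₀‖ = ‖(q - y₀) + τ • w‖ := by congr 1; abel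
      _ ≤ ‖q - y₀‖ + ‖τ • w‖ := norm_add_le _ _
      _ < R := by linarith [hτw τ h0 h1]
  have hballR : ∀ q ∈ Metric.ball y₀ r, q ∈ Metric.ball y₀ R := fun q hq => by
    simpa using hshift q hq 0 le_rfl hτ₀0.le
  have hstep : ∀ C : Set E, Convex ℝ C → C ⊆ A ∪ B → (C ∩ A).Nonempty → C ⊆ A :=
    fun C hC hCAB hCA => hC.isPreconnected.subset_left_of_subset_union hA hB hAB hCAB hCA
  have hAB' : ∀ z ∈ Metric.ball y₀ R, κ y₀ < κ z → z ∈ A ∪ B := fun z hz h =>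
    hTAB z (hRT hz) h.ne'
  have hline : ∀ q : E, ∀ I : Set ℝ, Convex ℝ I → Convex ℝ ((fun τ : ℝ => q + τ • w) '' I) := by
    intro q I hI
    have := hI.affine_image (AffineMap.lineMap (k := ℝ) q (q + w))
    have h2 : (fun τ : ℝ => q + τ • w) = AffineMap.lineMap (k := ℝ) q (q + w) := by
      ext τ; simp [AffineMap.lineMap_apply, add_comm]
    rwa [h2]
  -- On the side κ > κ y₀ every point near y₀ lies in A or B, so connected pieces touching A remain
  -- in A. Go up from p, across along the translated ball, and down to y.
  have e1 : p + τ₀ • w ∈ A := by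
    refine hstep _ (hline p (Icc 0 τ₀) (convex_Icc _ _)) ?_ ⟨p, ⟨0, ⟨le_rfl, hτ₀0.le⟩, by simp⟩, hpA⟩
      ⟨τ₀, ⟨hτ₀0.le, le_rfl⟩, rfl⟩
    rintro _ ⟨τ, ⟨h0, h1⟩, rfl⟩
    rcases h0.eq_or_lt with rfl | h0'
    · left; simpa using hpA
    · refine hAB' _ (hshift p hp τ h0 h1) ?_
      have := hinc p (hballR p hp) τ h0 (hshift p hp τ h0 h1)
      dsimp only
      linarith
  have e2 : y + τ₀ • w ∈ A := by
    refine hstep ((fun q => q + τ₀ • w) '' Metric.ball y₀ r) ?_ ?_ ⟨_, ⟨p, hp, rfl⟩, e1⟩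
      ⟨y, hy, rfl⟩
    · have := (convex_ball y₀ r).translate (τ₀ • w)
      simpa [image_add_right, add_comm] using this
    · rintro _ ⟨q, hq, rfl⟩
      refine hAB' _ (hshift q hq τ₀ hτ₀0.le le_rfl) ?_
      have h2 := hinc q (hballR q hq) τ₀ hτ₀0.le (hshift q hq τ₀ hτ₀0.le le_rfl)
      have h3 : |κ q - κ y₀| < τ₀ / 4 := (hrN hq).1
      dsimp only
      linarith [(abs_lt.1 h3).1]
  have e3 : (fun τ : ℝ => y + τ • w) '' Ioc 0 τ₀ ⊆ A := by
    refine hstep _ (hline y (Ioc 0 τ₀) (convex_Ioc _ _)) ?_ ⟨_, ⟨τ₀, ⟨hτ₀0, le_rfl⟩, rfl⟩, e2⟩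
    rintro _ ⟨τ, ⟨h0, h1⟩, rfl⟩
    refine hAB' _ (hshift y hy τ h0.le h1) ?_
    have := hinc y (hballR y hy) τ h0.le (hshift y hy τ h0.le h1)
    dsimp only
    linarith
  have hlim : Filter.Tendsto (fun τ : ℝ => y + τ • w) (𝓝[>] 0) (𝓝 y) := by
    have : ContinuousAt (fun τ : ℝ => y + τ • w) 0 := by fun_prop
    have h2 := this.tendsto
    simp only [zero_smul, add_zero] at h2
    exact h2.mono_left nhdsWithin_le_nhds
  refine mem_closure_of_tendsto hlim ?_
  filter_upwards [Ioc_mem_nhdsGT hτ₀0] with τ hτ using e3 ⟨τ, hτ, rfl⟩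

variable {E : Type*} [NormedAddCommGroup E] [NormedSpace ℝ E]
  {M : Type*} [TopologicalSpace M] [ChartedSpace E M] [IsManifold 𝓘(ℝ, E) ∞ M]

/-- If `k` takes finitely many values on the boundary of `U`, then near a regular point of the
closure of `U` the level set of `k` lies in the closure of `U`. -/
theorem exists_level_subset_closure {k : M → ℝ} (hk : ContMDiff 𝓘(ℝ, E) 𝓘(ℝ, ℝ) ∞ k)
    {U : Set M} (hU : IsOpen U) {c : Finset ℝ} (hc : ∀ x ∈ frontier U, k x ∈ c) {x : M}
    (hx : x ∈ closure U) (hdk : modelD E k x ≠ 0) :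
    ∃ N ∈ 𝓝 x, ∀ y ∈ N, k y = k x → y ∈ closure U := by
  set φ := extChartAt 𝓘(ℝ, E) x with hφ
  have hxs : x ∈ φ.source := mem_extChartAt_source x
  have hxt : φ x ∈ φ.target := mem_extChartAt_target x
  have htgt : IsOpen φ.target := isOpen_extChartAt_target x
  have hcs := continuousOn_extChartAt_symm (I := 𝓘(ℝ, E)) x
  have hκ : ContDiffAt ℝ ∞ (fun y => k (φ.symm y)) (φ x) := contDiffAt_coordFun hk x hxt
  set κ : E → ℝ := fun y => k (φ.symm y) with hκdef
  have hκx : κ (φ x) = k x := by simp [hκdef, φ.left_inv hxs]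
  have hstrict : HasStrictFDerivAt κ (fderiv ℝ κ (φ x)) (φ x) := hκ.hasStrictFDerivAt (by simp)
  obtain ⟨w, hw⟩ : ∃ w, fderiv ℝ κ (φ x) w = 1 := by
    obtain ⟨v, hv⟩ := ContinuousLinearMap.exists_ne_zero hdk
    have h1 := mfderiv_eq_fderiv_chart x hxs (hk.mdifferentiable (by simp) x) v
    refine ⟨(modelD E k x v)⁻¹ • chartD x x v, ?_⟩
    rw [map_smul, ← h1, smul_eq_mul, inv_mul_cancel₀ hv]
  -- points of a neighbourhood with values different from `k x` are not in the boundary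
  have hgap : ∀ᶠ y in 𝓝 x, k y ∈ c → k y = k x := by
    have hf : ((c : Set ℝ) \ {k x}).Finite := c.finite_toSet.subset sdiff_subset
    have h1 : ((c : Set ℝ) \ {k x})ᶜ ∈ 𝓝 (k x) := hf.isClosed.isOpen_compl.mem_nhds (by simp)
    filter_upwards [hk.continuous.continuousAt.preimage_mem_nhds h1] with y hy hyc
    by_contra hne
    exact hy ⟨hyc, hne⟩
  have hcsx : ContinuousAt φ.symm (φ x) := hcs.continuousAt (htgt.mem_nhds hxt)
  have hgap' : ∀ᶠ z in 𝓝 (φ x), k (φ.symm z) ∈ c → k (φ.symm z) = k x := by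
    have := hcsx.tendsto
    rw [φ.left_inv hxs] at this
    exact this.eventually hgap
  set T := φ.target ∩ {z | k (φ.symm z) ∈ c → k (φ.symm z) = k x} with hT
  have hTn : T ∈ 𝓝 (φ x) := Filter.inter_mem (htgt.mem_nhds hxt) hgap'
  set A := φ.target ∩ φ.symm ⁻¹' U
  set B := φ.target ∩ φ.symm ⁻¹' (closure U)ᶜ
  have hA : IsOpen A := hcs.isOpen_inter_preimage htgt hU
  have hB : IsOpen B := hcs.isOpen_inter_preimage htgt isClosed_closure.isOpen_compl
  have hAB : Disjoint A B := by
    rw [disjoint_left]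
    exact fun z hz hz' => hz'.2 (subset_closure hz.2)
  have hTAB : ∀ y ∈ T, κ y ≠ κ (φ x) → y ∈ A ∪ B := by
    rintro z ⟨hz, hz'⟩ hne
    rw [hκx] at hne
    by_cases h1 : φ.symm z ∈ U
    · exact Or.inl ⟨hz, h1⟩
    · refine Or.inr ⟨hz, fun h2 => hne (hz' (hc _ ?_))⟩
      rw [hU.frontier_eq]
      exact ⟨h2, h1⟩
  obtain ⟨N₁, hN₁, h₁⟩ := mem_closure_of_regular hstrict hw hA hB hAB hTn hTAB
  -- Points of U near x may lie on either side of the level; the other side is treated by replacing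
  -- κ by -κ.
  have hstrict' : HasStrictFDerivAt (fun y => -κ y) (-fderiv ℝ κ (φ x)) (φ x) := hstrict.neg
  obtain ⟨N₂, hN₂, h₂⟩ := mem_closure_of_regular (w := -w) hstrict' (by simp [hw]) hA hB hAB hTn
    (by simpa [neg_inj] using hTAB)
  have hφc : ContinuousAt φ x := continuousAt_extChartAt x
  have hN : φ.source ∩ φ ⁻¹' (N₁ ∩ N₂) ∈ 𝓝 x := Filter.inter_mem
    ((isOpen_extChartAt_source x).mem_nhds hxs)
    (hφc.preimage_mem_nhds (Filter.inter_mem hN₁ hN₂))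
  refine ⟨_, hN, fun y ⟨hys, hy1, hy2⟩ hky => ?_⟩
  obtain ⟨p, ⟨hps, hp1, hp2⟩, hpU⟩ := mem_closure_iff_nhds.1 hx _ hN
  have hpA : φ p ∈ A := ⟨φ.map_source hps, by simpa [φ.left_inv hps] using hpU⟩
  have hκy : κ (φ y) = κ (φ x) := by rw [hκx, ← hky]; simp [hκdef, φ.left_inv hys]
  have hycl : φ y ∈ closure A := by
    rcases le_total (κ (φ x)) (κ (φ p)) with hle | hle
    · exact h₁ _ hy1 _ hp1 hκy hpA hle
    · exact h₂ _ hy2 _ hp2 (by simpa using hκy) hpA (by simpa using hle)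
  have hcy : ContinuousAt φ.symm (φ y) := hcs.continuousAt (htgt.mem_nhds (φ.map_source hys))
  have h3 := mem_closure_image hcy hycl
  rw [φ.left_inv hys] at h3
  exact closure_mono (by rintro _ ⟨z, hz, rfl⟩; exact hz.2) h3

/-- A connected set that meets the boundaries of `U` and of `V` meets the part of the shell where
`k` is at a definite distance from its boundary values. -/
theorem exists_crossing_constant [CompactSpace M] [T2Space M] {k : M → ℝ}
    (hk : ContMDiff 𝓘(ℝ, E) 𝓘(ℝ, ℝ) ∞ k) {U V : Set M} (hU : IsOpen U) (hV : IsOpen V)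
    (hUV : closure U ⊆ V) {c : Finset ℝ} (hcne : c.Nonempty) (hcU : ∀ x ∈ frontier U, k x ∈ c)
    (hcV : ∀ x ∈ frontier V, k x ∈ c)
    (hreg : ∀ x ∈ closure (V \ closure U) ∩ closure U, modelD E k x ≠ 0) :
    ∃ δ > 0, ∀ T : Set M, IsPreconnected T → (T ∩ frontier U).Nonempty → (T ∩ frontier V).Nonempty →
      ∃ z ∈ T, z ∈ V \ closure U ∧ δ ≤ Metric.infDist (k z) (c : Set ℝ) := by
  set W := V \ closure U with hW
  have hWo : IsOpen W := hV.sdiff isClosed_closure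
  set F := closure W ∩ closure U with hF
  have hFU : ∀ x ∈ F, x ∈ frontier U := by
    rintro x ⟨hx1, hx2⟩
    rw [hU.frontier_eq]
    refine ⟨hx2, fun hxU => ?_⟩
    obtain ⟨y, hy1, hy2⟩ := mem_closure_iff.1 hx1 U hU hxU
    exact hy2.2 (subset_closure hy1)
  have hWV : ∀ x ∈ closure V, x ∉ closure U → x ∈ closure W := by
    intro x hx hxU
    rw [mem_closure_iff] at hx ⊢
    intro o ho hxo
    obtain ⟨y, hy1, hy2⟩ := hx (o ∩ (closure U)ᶜ) (ho.inter isClosed_closure.isOpen_compl)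
      ⟨hxo, hxU⟩
    exact ⟨y, hy1.1, hy2, hy1.2⟩
  set A := closure W ∩ k ⁻¹' (c : Set ℝ) with hA
  have hAc : IsClosed A := isClosed_closure.inter (c.finite_toSet.isClosed.preimage hk.continuous)
  have hloc : ∀ x ∈ F, ∃ N ∈ 𝓝 x, ∀ y ∈ N, y ∈ A → y ∈ closure U := by
    intro x hx
    obtain ⟨N, hN, h⟩ := exists_level_subset_closure hk hU hcU hx.2 (hreg x hx)
    have hf : ((c : Set ℝ) \ {k x}).Finite := c.finite_toSet.subset sdiff_subset
    have h1 : ((c : Set ℝ) \ {k x})ᶜ ∈ 𝓝 (k x) := hf.isClosed.isOpen_compl.mem_nhds (by simp)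
    refine ⟨_, Filter.inter_mem hN (hk.continuous.continuousAt.preimage_mem_nhds h1), ?_⟩
    rintro y ⟨hy1, hy2⟩ hyA
    refine h y hy1 ?_
    by_contra hne
    exact hy2 ⟨hyA.2, hne⟩
  -- Removing the closed set `closure U` leaves G closed: near F the boundary levels of k lie inside
  -- `closure U`. This is where regularity enters.
  set G := A \ closure U with hG
  have hGc : IsClosed G := by
    rw [← isOpen_compl_iff, isOpen_iff_mem_nhds]
    intro x hx
    by_cases hxA : x ∈ A
    · have hxU : x ∈ closure U := by_contra fun h => hx ⟨hxA, h⟩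
      obtain ⟨N, hN, h⟩ := hloc x ⟨hxA.1, hxU⟩
      filter_upwards [hN] with y hy hyG using hyG.2 (h y hy hyG.1)
    · filter_upwards [hAc.isOpen_compl.mem_nhds hxA] with y hy hyG using hy hyG.1
  have hFc : IsClosed F := isClosed_closure.inter isClosed_closure
  have hFG : Disjoint F G := disjoint_left.2 fun x hx hx' => hx'.2 hx.2
  obtain ⟨O, O', hO, hO', hFO, hGO, hOO⟩ := SeparatedNhds.of_isCompact_isCompact hFc.isCompact
    hGc.isCompact hFG
  -- Disjoint open sets containing `closure U` and `frontier V`. A connected set meeting both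
  -- boundaries must leave their union.
  set P₁ := interior (closure U) ∪ (O ∩ V) with hP₁
  set P₂ := (O' ∩ (closure U)ᶜ) ∪ (closure V)ᶜ with hP₂
  have hP₁o : IsOpen P₁ := isOpen_interior.union (hO.inter hV)
  have hP₂o : IsOpen P₂ := (hO'.inter isClosed_closure.isOpen_compl).union
    isClosed_closure.isOpen_compl
  have hdisj : Disjoint P₁ P₂ := by
    rw [disjoint_left]
    rintro x (h1 | ⟨h1, h2⟩) (⟨h3, h4⟩ | h3)
    · exact h4 (interior_subset h1)
    · exact h3 (subset_closure (hUV (interior_subset h1)))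
    · exact disjoint_left.1 hOO h1 h3
    · exact h3 (subset_closure h2)
  have hclU : ∀ x ∈ closure U, x ∈ P₁ := by
    intro x hx
    by_cases hi : x ∈ interior (closure U)
    · exact Or.inl hi
    · refine Or.inr ⟨hFO ⟨?_, hx⟩, hUV hx⟩
      rw [mem_closure_iff]
      intro o ho hxo
      by_contra hne
      refine hi (mem_interior.2 ⟨o ∩ V, fun y hy => ?_, ho.inter hV, hxo, hUV hx⟩)
      by_contra hyU
      exact hne ⟨y, hy.1, hy.2, hyU⟩
  have hbV : ∀ x ∈ frontier V, x ∈ P₂ := by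
    intro x hx
    have hxU : x ∉ closure U := fun h => by
      rw [hV.frontier_eq] at hx
      exact hx.2 (hUV h)
    exact Or.inl ⟨hGO ⟨⟨hWV x (frontier_subset_closure hx) hxU, hcV x hx⟩, hxU⟩, hxU⟩
  -- Z is compact and k avoids c on it, so the distance from k to c has a positive minimum there.
  set Z := (P₁ ∪ P₂)ᶜ with hZ
  have hZW : ∀ z ∈ Z, z ∈ W ∧ k z ∉ c := by
    intro z hz
    have h1 : z ∉ closure U := fun h => hz (Or.inl (hclU z h))
    have h2 : z ∈ closure V := by_contra fun h => hz (Or.inr (Or.inr h))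
    have h3 : z ∈ V := by
      by_contra h
      exact hz (Or.inr (hbV z (by rw [hV.frontier_eq]; exact ⟨h2, h⟩)))
    refine ⟨⟨h3, h1⟩, fun h4 => hz (Or.inr (Or.inl ⟨hGO ⟨⟨hWV z h2 h1, h4⟩, h1⟩, h1⟩))⟩
  have hZc : IsCompact Z := (hP₁o.union hP₂o).isClosed_compl.isCompact
  have hmeet : ∀ T : Set M, IsPreconnected T → (T ∩ frontier U).Nonempty →
      (T ∩ frontier V).Nonempty → (T ∩ Z).Nonempty := by
    rintro T hT ⟨x, hxT, hx⟩ ⟨y, hyT, hy⟩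
    by_contra hne
    have hsub : T ⊆ P₁ ∪ P₂ := fun z hz => by_contra fun h => hne ⟨z, hz, h⟩
    exact disjoint_left.1 hdisj (hT.subset_left_of_subset_union hP₁o hP₂o hdisj hsub
      ⟨x, hxT, hclU x (frontier_subset_closure hx)⟩ hyT) (hbV y hy)
  rcases Z.eq_empty_or_nonempty with hZe | hZne
  · refine ⟨1, one_pos, fun T h1 h2 h3 => ?_⟩
    have := hmeet T h1 h2 h3
    simp [hZe] at this
  · have hcont : Continuous fun z => Metric.infDist (k z) (c : Set ℝ) :=
      (Metric.continuous_infDist_pt _).comp hk.continuous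
    obtain ⟨z₀, hz₀, hmin⟩ := hZc.exists_isMinOn hZne hcont.continuousOn
    refine ⟨Metric.infDist (k z₀) c, ?_, fun T h1 h2 h3 => ?_⟩
    · refine (c.finite_toSet.isClosed.notMem_iff_infDist_pos (by simpa using hcne)).1 ?_
      exact (hZW z₀ hz₀).2
    · obtain ⟨z, hzT, hz⟩ := hmeet T h1 h2 h3
      exact ⟨z, hzT, (hZW z hz).1, hmin hz⟩

/-- A smooth cutoff function supported in `W` that is locally a function of `k`. -/
structure IsLevelCutoff (E : Type*) [NormedAddCommGroup E] [NormedSpace ℝ E]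
    {M : Type*} [TopologicalSpace M] [ChartedSpace E M] (k : M → ℝ) (W : Set M) (Θ : M → ℝ) :
    Prop where
  smooth : ContMDiff 𝓘(ℝ, E) 𝓘(ℝ, ℝ) ∞ Θ
  mem_Icc : ∀ x, Θ x ∈ Icc (0 : ℝ) 1
  mem_of_ne : ∀ x, Θ x ≠ 0 → x ∈ W
  modelD_eq_zero : ∀ x ∉ W, modelD E Θ x = 0
  ker : ∀ x v, modelD E k x v = 0 → modelD E Θ x v = 0

-- Take β ∘ k on W and zero elsewhere, where β is a smooth function on ℝ that vanishes within
-- distance a of c. On the frontier of W the values of k lie in c, so β ∘ k vanishes near it and the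
-- extension is smooth.
omit [IsManifold 𝓘(ℝ, E) ∞ M] in
theorem exists_levelCutoff {k : M → ℝ} (hk : ContMDiff 𝓘(ℝ, E) 𝓘(ℝ, ℝ) ∞ k) {W : Set M}
    (hW : IsOpen W) {c : Set ℝ} (hc : ∀ x ∈ frontier W, k x ∈ c) {a b : ℝ} (ha : 0 < a)
    (hab : a < b) :
    ∃ Θ : M → ℝ, IsLevelCutoff E k W Θ ∧ (∀ x ∈ W, b ≤ Metric.infDist (k x) c → Θ x = 1) ∧
      ∀ x, Θ x ≠ 0 → a < Metric.infDist (k x) c := by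
  have hcd : Continuous fun r : ℝ => Metric.infDist r c := Metric.continuous_infDist_pt _
  obtain ⟨β, hβ0, hβ1, hβ⟩ := exists_contMDiffMap_zero_one_of_isClosed (n := ⊤) 𝓘(ℝ, ℝ)
    (s := {r : ℝ | Metric.infDist r c ≤ a}) (t := {r : ℝ | b ≤ Metric.infDist r c})
    (isClosed_le hcd continuous_const) (isClosed_le continuous_const hcd)
    (disjoint_left.2 fun r (h1 : _ ≤ a) (h2 : b ≤ _) => by linarith)
  have hβs : ContMDiff 𝓘(ℝ, E) 𝓘(ℝ, ℝ) ∞ fun x => β (k x) := β.contMDiff.comp hk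
  set Θ : M → ℝ := W.indicator fun x => β (k x) with hΘ
  have hin : ∀ x ∈ W, Θ =ᶠ[𝓝 x] fun x => β (k x) := fun x hx => by
    filter_upwards [hW.mem_nhds hx] with y hy using indicator_of_mem hy _
  have hout : ∀ x ∉ W, Θ =ᶠ[𝓝 x] fun _ => 0 := by
    intro x hx
    by_cases hxc : x ∈ closure W
    · have h0 : Metric.infDist (k x) c < a := by
        rw [Metric.infDist_zero_of_mem (hc x (by rw [hW.frontier_eq]; exact ⟨hxc, hx⟩))]
        exact ha
      filter_upwards [(hcd.comp hk.continuous).continuousAt.eventually_lt continuousAt_const h0]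
        with y hy
      by_cases hyW : y ∈ W
      · rw [hΘ, indicator_of_mem hyW]; exact hβ0 (le_of_lt hy)
      · exact indicator_of_notMem hyW _
    · filter_upwards [isClosed_closure.isOpen_compl.mem_nhds hxc] with y hy
      exact indicator_of_notMem (fun h => hy (subset_closure h)) _
  refine ⟨Θ, ⟨fun x => ?_, fun x => ?_, fun x hx => ?_, fun x hx => ?_, fun x v hv => ?_⟩,
    fun x hx hb => ?_,
    fun x hx => ?_⟩
  · by_cases hx : x ∈ W
    · exact (hβs x).congr_of_eventuallyEq (hin x hx)
    · exact contMDiffAt_const.congr_of_eventuallyEq (hout x hx)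
  · by_cases hx : x ∈ W
    · rw [(hin x hx).self_of_nhds]; exact hβ _
    · rw [(hout x hx).self_of_nhds]; simp
  · exact by_contra fun h => hx (indicator_of_notMem h _)
  · exact ((hout x hx).mfderiv_eq).trans mfderiv_const
  · by_cases hx : x ∈ W
    · have h1 : modelD E Θ x = (fderiv ℝ β (k x)).comp (modelD E k x) := by
        refine ((hin x hx).mfderiv_eq).trans ?_
        have h2 := mfderiv_comp (I := 𝓘(ℝ, E)) (I' := 𝓘(ℝ, ℝ)) (I'' := 𝓘(ℝ, ℝ)) x
          (β.contMDiff.mdifferentiable (by simp) (k x)) (hk.mdifferentiable (by simp) x)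
        rw [mfderiv_eq_fderiv] at h2
        exact h2
      rw [h1, ContinuousLinearMap.comp_apply, hv, map_zero]
    · have h1 : modelD E Θ x = 0 := ((hout x hx).mfderiv_eq).trans mfderiv_const
      rw [h1]; rfl
  · rw [(hin x hx).self_of_nhds]; exact hβ1 hb
  · by_contra h
    by_cases hxW : x ∈ W
    · rw [(hin x hxW).self_of_nhds] at hx
      exact hx (hβ0 (not_lt.1 h))
    · exact hx (hout x hxW).self_of_nhds

end Shell

/-! ### Hamiltonian fields in charts and uniform comparison of the metrics with coordinate norms. -/

section NormComparison

open Topology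

/-- Locally valid bounds hold uniformly on compact sets. -/
theorem _root_.IsCompact.exists_uniform_bound {X : Type*} [TopologicalSpace X] {s : Set X}
    (hs : IsCompact s) {P : ℝ → X → Prop} (hmono : ∀ x C C', C ≤ C' → P C x → P C' x)
    (hloc : ∀ x ∈ s, ∃ C, ∀ᶠ y in 𝓝 x, P C y) : ∃ C > 0, ∀ x ∈ s, P C x := by
  refine hs.induction_on (p := fun s => ∃ C > 0, ∀ x ∈ s, P C x) ⟨1, one_pos, by simp⟩ ?_ ?_ ?_
  · rintro s t hst ⟨C, hC, h⟩
    exact ⟨C, hC, fun x hx => h x (hst hx)⟩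
  · rintro s t ⟨C, hC, h⟩ ⟨C', hC', h'⟩
    refine ⟨max C C', lt_max_of_lt_left hC, ?_⟩
    rintro x (hx | hx)
    · exact hmono x _ _ (le_max_left _ _) (h x hx)
    · exact hmono x _ _ (le_max_right _ _) (h' x hx)
  · intro x hx
    obtain ⟨C, h⟩ := hloc x hx
    exact ⟨_, nhdsWithin_le_nhds h, max C 1, by positivity,
      fun y hy => hmono y _ _ (le_max_left _ _) hy⟩

theorem _root_.ContinuousAt.exists_eventually_le {X : Type*} [TopologicalSpace X] {f : X → ℝ} {x : X}
    (h : ContinuousAt f x) : ∃ L, ∀ᶠ y in 𝓝 x, f y ≤ L :=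
  ⟨_, (h.eventually_lt continuousAt_const (lt_add_one _)).mono fun _ h => h.le⟩

/-- Cauchy-Schwarz for a curve whose squared speed is bounded by a density. -/
theorem sq_norm_sub_le_lintegral {F : Type*} [NormedAddCommGroup F] [NormedSpace ℝ F]
    [CompleteSpace F] {f f' : ℝ → F} {e : ℝ → ℝ≥0∞} {C a b : ℝ} (hab : a ≤ b) (hC : 0 ≤ C)
    (hf : ∀ τ ∈ Icc a b, HasDerivAt f (f' τ) τ) (hf' : ContinuousOn f' (Icc a b))
    (he : ∀ τ ∈ Ioc a b, ENNReal.ofReal (‖f' τ‖ ^ 2) ≤ ENNReal.ofReal C * e τ) :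
    ENNReal.ofReal (‖f b - f a‖ ^ 2) ≤
      ENNReal.ofReal (C * (b - a)) * ∫⁻ τ in Ioc a b, e τ := by
  have hu : uIcc a b = Icc a b := uIcc_of_le hab
  have hint : IntervalIntegrable f' volume a b := (hu ▸ hf').intervalIntegrable
  have h1 : ∫ τ in a..b, f' τ = f b - f a :=
    intervalIntegral.integral_eq_sub_of_hasDerivAt (by rwa [hu]) hint
  have hmeas : AEMeasurable (fun τ => ‖f' τ‖ₑ) (volume.restrict (Ioc a b)) :=
    (hint.1.aestronglyMeasurable).enorm
  have h2 : ‖f b - f a‖ₑ ≤ ∫⁻ τ in Ioc a b, ‖f' τ‖ₑ := by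
    rw [← h1, intervalIntegral.integral_of_le hab]
    exact enorm_integral_le_lintegral_enorm _
  have h3 := ENNReal.lintegral_mul_le_Lp_mul_Lq (volume.restrict (Ioc a b))
    Real.HolderConjugate.two_two hmeas (aemeasurable_const (b := (1 : ℝ≥0∞)))
  simp only [Pi.mul_apply, mul_one, one_pow, lintegral_one, Measure.restrict_apply_univ,
    Real.volume_Ioc, ENNReal.rpow_two] at h3
  have h4 : ∫⁻ τ in Ioc a b, ‖f' τ‖ₑ ^ 2 ≤ ENNReal.ofReal C * ∫⁻ τ in Ioc a b, e τ := by
    rw [← lintegral_const_mul' _ _ ENNReal.ofReal_ne_top]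
    refine setLIntegral_mono' measurableSet_Ioc fun τ hτ => ?_
    refine le_trans (le_of_eq ?_) (he τ hτ)
    rw [← ofReal_norm, ENNReal.ofReal_pow (norm_nonneg _)]
  have hs : ∀ x : ℝ≥0∞, (x ^ ((1 : ℝ) / 2)) ^ 2 = x := fun x => by
    rw [← ENNReal.rpow_natCast, ← ENNReal.rpow_mul]; norm_num
  calc ENNReal.ofReal (‖f b - f a‖ ^ 2) = ‖f b - f a‖ₑ ^ 2 := by
        rw [← ofReal_norm, ENNReal.ofReal_pow (norm_nonneg _)]
    _ ≤ ((∫⁻ τ in Ioc a b, ‖f' τ‖ₑ ^ 2) ^ ((1 : ℝ) / 2) *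
          (ENNReal.ofReal (b - a)) ^ ((1 : ℝ) / 2)) ^ 2 := by
        gcongr
        exact h2.trans h3
    _ = (∫⁻ τ in Ioc a b, ‖f' τ‖ₑ ^ 2) * ENNReal.ofReal (b - a) := by
        rw [mul_pow, hs, hs]
    _ ≤ (ENNReal.ofReal C * ∫⁻ τ in Ioc a b, e τ) * ENNReal.ofReal (b - a) := by gcongr
    _ = _ := by rw [ENNReal.ofReal_mul hC]; ring

variable {E : Type*} [NormedAddCommGroup E] [NormedSpace ℝ E]
  {M : Type*} [TopologicalSpace M] [ChartedSpace E M]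

/-- `X` is the Hamiltonian vector field of `k`. -/
def IsHamiltonianField (Ω : ∀ x : M, Tan E x →L[ℝ] Tan E x →L[ℝ] ℝ) (k : M → ℝ) (X : M → E) :
    Prop :=
  ∀ x w, modelForm Ω x (X x) w = -modelD E k x w

/-- A vector field in the chart around `x₀`. -/
def coordField (X : M → E) (x₀ : M) (y : E) : E :=
  chartD x₀ ((extChartAt 𝓘(ℝ, E) x₀).symm y) (X ((extChartAt 𝓘(ℝ, E) x₀).symm y))

theorem coordField_extChartAt (X : M → E) (x₀ : M) {x : M}
    (hx : x ∈ (extChartAt 𝓘(ℝ, E) x₀).source) :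
    coordField X x₀ (extChartAt 𝓘(ℝ, E) x₀ x) = chartD x₀ x (X x) := by
  rw [coordField, (extChartAt 𝓘(ℝ, E) x₀).left_inv hx]

variable [IsManifold 𝓘(ℝ, E) ∞ M] {Ω : ∀ x : M, Tan E x →L[ℝ] Tan E x →L[ℝ] ℝ}
  {J : ℝ → ∀ x : M, Tan E x →L[ℝ] Tan E x} {k : M → ℝ} {X : M → E}

section

variable [FiniteDimensional ℝ E]

/-- A non-degenerate bilinear form on a finite dimensional space as an isomorphism. -/
theorem exists_equiv_of_nondegenerate (B : E →L[ℝ] E →L[ℝ] ℝ)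
    (h : ∀ v, (∀ w, B v w = 0) → v = 0) : ∃ e : E ≃L[ℝ] (E →L[ℝ] ℝ), (e : E →L[ℝ] E →L[ℝ] ℝ) = B := by
  have hinj : Function.Injective (B : E →ₗ[ℝ] (E →L[ℝ] ℝ)) := by
    rw [← LinearMap.ker_eq_bot, LinearMap.ker_eq_bot']
    intro v hv
    exact h v fun w => by
      have : B v = 0 := hv
      rw [this]; rfl
  have hdim : Module.finrank ℝ E = Module.finrank ℝ (E →L[ℝ] ℝ) := by
    rw [← (LinearMap.toContinuousLinearMap : (E →ₗ[ℝ] ℝ) ≃ₗ[ℝ] _).finrank_eq]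
    exact (Subspace.dual_finrank_eq (K := ℝ) (V := E)).symm
  refine ⟨(LinearEquiv.ofInjectiveOfFinrankEq (B : E →ₗ[ℝ] (E →L[ℝ] ℝ)) hinj
    hdim).toContinuousLinearEquiv, ?_⟩
  ext v w
  rfl

theorem exists_hamiltonianField (hΩ : IsSymplecticForm Ω) (k : M → ℝ) :
    ∃ X : M → E, IsHamiltonianField Ω k X := by
  have : ∀ x : M, ∃ v : E, ∀ w, modelForm Ω x v w = -modelD E k x w := by
    intro x
    obtain ⟨e, he⟩ := exists_equiv_of_nondegenerate (modelForm Ω x) (hΩ.nondegenerate x)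
    refine ⟨e.symm (-modelD E k x), fun w => ?_⟩
    rw [← he]
    simp
  choose X hX using this
  exact ⟨X, hX⟩

omit [FiniteDimensional ℝ E] in
theorem coordForm_nondegenerate (hΩ : IsSymplecticForm Ω) (x₀ : M) {y : E}
    (hy : y ∈ (extChartAt 𝓘(ℝ, E) x₀).target) (v : E) (h : ∀ w, coordForm Ω x₀ y v w = 0) :
    v = 0 := by
  have h1 : chartDsymm x₀ y v = 0 := by
    have hnd : ∀ v : E, (∀ w : E, modelForm Ω ((extChartAt 𝓘(ℝ, E) x₀).symm y) v w = 0) → v = 0 :=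
      hΩ.nondegenerate ((extChartAt 𝓘(ℝ, E) x₀).symm y)
    refine hnd _ fun w => ?_
    have := h (chartD x₀ ((extChartAt 𝓘(ℝ, E) x₀).symm y) w)
    rwa [coordForm, ContinuousLinearMap.bilinearComp_apply, chartDsymm_chartD x₀ hy] at this
  rw [← chartD_chartDsymm x₀ hy v, h1, map_zero]

omit [FiniteDimensional ℝ E] in
theorem coordForm_coordField (hk : ContMDiff 𝓘(ℝ, E) 𝓘(ℝ, ℝ) ∞ k)
    (hX : IsHamiltonianField Ω k X) (x₀ : M) {y : E}
    (hy : y ∈ (extChartAt 𝓘(ℝ, E) x₀).target) :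
    coordForm Ω x₀ y (coordField X x₀ y) =
      -fderiv ℝ (fun y => k ((extChartAt 𝓘(ℝ, E) x₀).symm y)) y := by
  ext w
  have hx := (extChartAt 𝓘(ℝ, E) x₀).map_target hy
  have h1 := coordForm_chartD Ω x₀ hx (X ((extChartAt 𝓘(ℝ, E) x₀).symm y)) (chartDsymm x₀ y w)
  rw [(extChartAt 𝓘(ℝ, E) x₀).right_inv hy, chartD_chartDsymm x₀ hy, hX,
    mfderiv_eq_fderiv_chart x₀ hx (hk.mdifferentiable (by simp) _),
    (extChartAt 𝓘(ℝ, E) x₀).right_inv hy, chartD_chartDsymm x₀ hy] at h1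
  exact h1

/-- The field is only given pointwise, but in coordinates it is the inverse of the form applied to
-dk, and inversion of isomorphisms is smooth. -/
theorem contDiffAt_coordField (hΩ : IsSymplecticForm Ω) (hk : ContMDiff 𝓘(ℝ, E) 𝓘(ℝ, ℝ) ∞ k)
    (hX : IsHamiltonianField Ω k X) (x₀ : M) :
    ContDiffAt ℝ ∞ (coordField X x₀) (extChartAt 𝓘(ℝ, E) x₀ x₀) := by
  have := FiniteDimensional.complete ℝ E
  have hy := mem_extChartAt_target (I := 𝓘(ℝ, E)) x₀
  obtain ⟨e, he⟩ := exists_equiv_of_nondegenerate _ (coordForm_nondegenerate hΩ x₀ hy)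
  have h1 : ContDiffAt ℝ ∞ (fun y => ContinuousLinearMap.inverse (coordForm Ω x₀ y))
      (extChartAt 𝓘(ℝ, E) x₀ x₀) := by
    have h2 := contDiffAt_map_inverse (𝕜 := ℝ) (n := ∞) e
    rw [he] at h2
    exact h2.comp _ (contDiffAt_coordForm hΩ x₀)
  have h2 : ContDiffAt ℝ ∞ (fun y => -fderiv ℝ (fun y => k ((extChartAt 𝓘(ℝ, E) x₀).symm y)) y)
      (extChartAt 𝓘(ℝ, E) x₀ x₀) :=
    ((contDiffAt_coordFun hk x₀ hy).fderiv_right (m := ∞) (by simp)).neg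
  refine (h1.clm_apply h2).congr_of_eventuallyEq ?_
  filter_upwards [(isOpen_extChartAt_target x₀).mem_nhds hy] with y hy
  obtain ⟨e, he⟩ := exists_equiv_of_nondegenerate _ (coordForm_nondegenerate hΩ x₀ hy)
  rw [← coordForm_coordField hk hX x₀ hy, ← he, ContinuousLinearMap.inverse_equiv]
  simp

/-- The differential of a smooth function in the direction of the Hamiltonian vector field is
continuous. -/
theorem continuous_modelD_hamiltonianField (hΩ : IsSymplecticForm Ω)
    (hk : ContMDiff 𝓘(ℝ, E) 𝓘(ℝ, ℝ) ∞ k) (hX : IsHamiltonianField Ω k X)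
    {F : Type*} [NormedAddCommGroup F] [NormedSpace ℝ F] {f : M → F}
    (hf : ContMDiff 𝓘(ℝ, E) 𝓘(ℝ, F) ∞ f) : Continuous fun x => modelD E f x (X x) := by
  rw [continuous_iff_continuousAt]
  intro x₀
  have hy := mem_extChartAt_target (I := 𝓘(ℝ, E)) x₀
  have hφ : ContinuousAt (extChartAt 𝓘(ℝ, E) x₀) x₀ := continuousAt_extChartAt x₀
  have h1 : ContinuousAt (fun y => fderiv ℝ (fun y => f ((extChartAt 𝓘(ℝ, E) x₀).symm y)) y
      (coordField X x₀ y)) (extChartAt 𝓘(ℝ, E) x₀ x₀) :=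
    (((contDiffAt_coordFun hf x₀ hy).fderiv_right (m := ∞) (by simp)).clm_apply
      (contDiffAt_coordField hΩ hk hX x₀)).continuousAt
  refine (ContinuousAt.comp h1 hφ).congr ?_
  filter_upwards [(isOpen_extChartAt_source (I := 𝓘(ℝ, E)) x₀).mem_nhds (mem_extChartAt_source x₀)] with x hx
  simp only [Function.comp_apply]
  rw [coordField_extChartAt X x₀ hx, mfderiv_eq_fderiv_chart x₀ hx (hf.mdifferentiable (by simp) _)]

end

theorem coordForm_coordEnd (x₀ : M) {x : M}
    (hx : x ∈ (extChartAt 𝓘(ℝ, E) x₀).source) (t : ℝ) (v : E) :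
    coordForm Ω x₀ (extChartAt 𝓘(ℝ, E) x₀ x) (chartD x₀ x v)
      (coordEnd J x₀ (t, extChartAt 𝓘(ℝ, E) x₀ x) (chartD x₀ x v)) =
      modelForm Ω x v (modelEnd J t x v) := by
  rw [coordEnd_chartD J x₀ hx, coordForm_chartD Ω x₀ hx]

theorem coordForm_coordEnd_pos (hJ : IsCompatible Ω J) (x₀ : M) {y : E}
    (hy : y ∈ (extChartAt 𝓘(ℝ, E) x₀).target) (t : ℝ) {v : E} (hv : v ≠ 0) :
    0 < coordForm Ω x₀ y v (coordEnd J x₀ (t, y) v) := by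
  have hx := (extChartAt 𝓘(ℝ, E) x₀).map_target hy
  have h1 := coordForm_coordEnd (Ω := Ω) (J := J) x₀ hx t (chartDsymm x₀ y v)
  rw [(extChartAt 𝓘(ℝ, E) x₀).right_inv hy, chartD_chartDsymm x₀ hy] at h1
  rw [h1]
  refine hJ.pos t _ _ fun h => hv ?_
  rw [← chartD_chartDsymm x₀ hy v]
  have h0 : chartDsymm x₀ y v = 0 := h
  rw [h0, map_zero]

theorem form_nonneg (hJ : IsCompatible Ω J) (t : ℝ) (x : M) (v : E) :
    0 ≤ modelForm Ω x v (modelEnd J t x v) := by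
  by_cases hv : v = 0
  · simp [hv]
  · exact (hJ.pos t x v hv).le

/-- Periodicity reduces bounds over all times to the compact interval [0, 1]. -/
theorem modelEnd_fract (hJ : IsCompatible Ω J) (t : ℝ) (x : M) :
    modelEnd J (Int.fract t) x = modelEnd J t x := by
  have hp : Function.Periodic (fun t => modelEnd J t x) 1 := fun t => hJ.periodic t x
  have := hp.sub_int_mul_eq (n := ⌊t⌋) (x := t)
  rw [mul_one] at this
  exact this

variable [FiniteDimensional ℝ E]

/-- Locally uniform equivalence of the metrics `Ω(·, J_t ·)` with the norm in a chart. -/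
theorem exists_sq_norm_le_coordForm (hΩ : IsSymplecticForm Ω) (hJ : IsCompatible Ω J) (t₀ : ℝ)
    (x₀ : M) : ∃ C > 0, ∀ᶠ p in 𝓝 (t₀, extChartAt 𝓘(ℝ, E) x₀ x₀), ∀ v,
      ‖v‖ ^ 2 ≤ C * coordForm Ω x₀ p.2 v (coordEnd J x₀ p v) := by
  have hproper : ProperSpace E := FiniteDimensional.proper ℝ E
  have hy := mem_extChartAt_target (I := 𝓘(ℝ, E)) x₀
  set p₀ : ℝ × E := (t₀, extChartAt 𝓘(ℝ, E) x₀ x₀) with hp₀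
  have hcont : ∀ v : E, ContinuousAt (fun q : (ℝ × E) × E =>
      coordForm Ω x₀ q.1.2 q.2 (coordEnd J x₀ q.1 q.2)) (p₀, v) := by
    intro v
    have h1 : ContinuousAt (fun q : (ℝ × E) × E => coordForm Ω x₀ q.1.2) (p₀, v) :=
      ContinuousAt.comp (g := coordForm Ω x₀) (contDiffAt_coordForm hΩ x₀).continuousAt (by fun_prop)
    have h2 : ContinuousAt (fun q : (ℝ × E) × E => coordEnd J x₀ q.1) (p₀, v) :=
      ContinuousAt.comp (g := coordEnd J x₀) (contDiffAt_coordEnd hJ t₀ x₀).continuousAt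
        (by fun_prop)
    exact (h1.clm_apply continuousAt_snd).clm_apply (h2.clm_apply continuousAt_snd)
  have hsph : IsCompact (Metric.sphere (0 : E) 1) := isCompact_sphere 0 1
  obtain ⟨m, hm, hmin⟩ := hsph.exists_forall_le' (a := 0)
    (f := fun v => coordForm Ω x₀ p₀.2 v (coordEnd J x₀ p₀ v))
    (fun v _ => (ContinuousAt.comp (f := fun v : E => (p₀, v)) (hcont v)
      (by fun_prop)).continuousWithinAt) fun v hv =>
      coordForm_coordEnd_pos hJ x₀ hy t₀ (norm_ne_zero_iff.1 (by simp_all))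
  -- Positivity on the compact unit sphere persists for nearby p uniformly in v; homogeneity then
  -- extends it to all vectors.
  have hev : ∀ᶠ p in 𝓝 p₀, ∀ v ∈ Metric.sphere (0 : E) 1,
      m / 2 < coordForm Ω x₀ p.2 v (coordEnd J x₀ p v) := by
    refine hsph.eventually_forall_of_forall_eventually fun v hv => ?_
    exact (continuousAt_const.eventually_lt (hcont v) (by
      have := hmin v hv
      dsimp only at this ⊢
      linarith))
  refine ⟨2 / m, by positivity, hev.mono fun p hp v => ?_⟩
  by_cases hv : v = 0
  · simp [hv]
  have hn : 0 < ‖v‖ := norm_pos_iff.2 hv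
  have h1 := hp (‖v‖⁻¹ • v) (by simp [norm_smul, hn.ne'])
  simp only [map_smul, smul_apply, smul_eq_mul] at h1
  have h2 : ‖v‖ ^ 2 * (m / 2) ≤ coordForm Ω x₀ p.2 v (coordEnd J x₀ p v) := by
    have := mul_le_mul_of_nonneg_left h1.le (sq_nonneg ‖v‖)
    calc _ ≤ _ := this
      _ = _ := by field_simp
  calc ‖v‖ ^ 2 = 2 / m * (‖v‖ ^ 2 * (m / 2)) := by field_simp
    _ ≤ _ := by gcongr

variable [CompactSpace M]

/-- The differential of a smooth function is bounded with respect to the metrics `Ω(·, J_t ·)`. -/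
theorem exists_sq_norm_modelD_le (hΩ : IsSymplecticForm Ω) (hJ : IsCompatible Ω J)
    {F : Type*} [NormedAddCommGroup F] [NormedSpace ℝ F] {f : M → F}
    (hf : ContMDiff 𝓘(ℝ, E) 𝓘(ℝ, F) ∞ f) :
    ∃ C > 0, ∀ t x v, ‖modelD E f x v‖ ^ 2 ≤ C * modelForm Ω x v (modelEnd J t x v) := by
  suffices ∃ C > 0, ∀ p ∈ Icc (0 : ℝ) 1 ×ˢ (univ : Set M), ∀ v,
      ‖modelD E f p.2 v‖ ^ 2 ≤ C * modelForm Ω p.2 v (modelEnd J p.1 p.2 v) by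
    obtain ⟨C, hC, h⟩ := this
    refine ⟨C, hC, fun t x v => ?_⟩
    have := h (Int.fract t, x) ⟨⟨Int.fract_nonneg t, (Int.fract_lt_one t).le⟩, mem_univ _⟩ v
    rwa [modelEnd_fract hJ] at this
  refine (isCompact_Icc.prod isCompact_univ).exists_uniform_bound
    (fun p C C' hCC h v => (h v).trans (by gcongr; exact form_nonneg hJ _ _ _)) ?_
  · rintro ⟨t₀, x₀⟩ -
    have hy := mem_extChartAt_target (I := 𝓘(ℝ, E)) x₀
    obtain ⟨C, hC, h⟩ := exists_sq_norm_le_coordForm hΩ hJ t₀ x₀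
    have hd : ContinuousAt (fun y => fderiv ℝ (fun y => f ((extChartAt 𝓘(ℝ, E) x₀).symm y)) y)
        (extChartAt 𝓘(ℝ, E) x₀ x₀) :=
      ((contDiffAt_coordFun hf x₀ hy).fderiv_right (m := ∞) (by simp)).continuousAt
    obtain ⟨L, hL⟩ : ∃ L, ∀ᶠ y in 𝓝 (extChartAt 𝓘(ℝ, E) x₀ x₀),
        ‖fderiv ℝ (fun y => f ((extChartAt 𝓘(ℝ, E) x₀).symm y)) y‖ ≤ L :=
      hd.norm.exists_eventually_le
    have hφ : ContinuousAt (extChartAt 𝓘(ℝ, E) x₀) x₀ := continuousAt_extChartAt x₀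
    have hφ2 : ContinuousAt (fun p : ℝ × M => extChartAt 𝓘(ℝ, E) x₀ p.2) (t₀, x₀) :=
      ContinuousAt.comp (g := extChartAt 𝓘(ℝ, E) x₀) hφ continuousAt_snd
    have hφ1 : ContinuousAt (fun p : ℝ × M => (p.1, extChartAt 𝓘(ℝ, E) x₀ p.2)) (t₀, x₀) :=
      continuousAt_fst.prodMk hφ2
    refine ⟨L ^ 2 * C, ?_⟩
    filter_upwards [hφ1.eventually h, hφ2.eventually hL, continuousAt_snd.preimage_mem_nhds
      ((isOpen_extChartAt_source (I := 𝓘(ℝ, E)) x₀).mem_nhds (mem_extChartAt_source x₀))] with p h1 h2 hx v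
    have hx' : p.2 ∈ (extChartAt 𝓘(ℝ, E) x₀).source := hx
    have h3 := h1 (chartD x₀ p.2 v)
    rw [coordForm_coordEnd x₀ hx'] at h3
    rw [mfderiv_eq_fderiv_chart x₀ hx' (hf.mdifferentiable (by simp) _)]
    calc _ ≤ (L * ‖chartD x₀ p.2 v‖) ^ 2 := by
          gcongr
          exact (ContinuousLinearMap.le_opNorm _ _).trans (by gcongr)
      _ = L ^ 2 * ‖chartD x₀ p.2 v‖ ^ 2 := by ring
      _ ≤ L ^ 2 * (C * modelForm Ω p.2 v (modelEnd J p.1 p.2 v)) := by gcongr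
      _ = _ := by ring

end NormComparison

/-! ### Loops that nearly solve the Hamiltonian equation. -/

section AlmostOrbits

open Topology Filter

/-- Lets any time window of length at most one be measured by the slice energy, wherever it starts.
-/
theorem lintegral_Ioc_periodic {e : ℝ → ℝ≥0∞} (he : ∀ t, e (t + 1) = e t) (a : ℝ) :
    ∫⁻ t in Ioc a (a + 1), e t = ∫⁻ t in Ioc (0 : ℝ) 1, e t := by
  have h := (isAddFundamentalDomain_Ioc one_pos a).setLIntegral_eq
    (isAddFundamentalDomain_Ioc one_pos 0) e
    fun g x => Function.Periodic.map_vadd_zmultiples (f := e) (c := (1 : ℝ)) he g x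
  simpa using h

variable {E : Type*} [NormedAddCommGroup E] [NormedSpace ℝ E]
  {M : Type*} [TopologicalSpace M] [ChartedSpace E M]

/-- A loop whose deviation from the integral curves of `X` inside `W` is controlled by the
density `e`. -/
structure IsAlmostOrbit (Ω : ∀ x : M, Tan E x →L[ℝ] Tan E x →L[ℝ] ℝ)
    (J : ℝ → ∀ x : M, Tan E x →L[ℝ] Tan E x) (X : M → E) (W : Set M) (γ : ℝ → M)
    (e : ℝ → ℝ≥0∞) : Prop where
  smooth : ContMDiff 𝓘(ℝ, ℝ) 𝓘(ℝ, E) ∞ γ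
  periodic : ∀ t, γ (t + 1) = γ t
  density_periodic : ∀ t, e (t + 1) = e t
  le_density : ∀ t, γ t ∈ W → ENNReal.ofReal (modelForm Ω (γ t) (modelVel E γ t - X (γ t))
    (modelEnd J t (γ t) (modelVel E γ t - X (γ t)))) ≤ e t

variable {Ω : ∀ x : M, Tan E x →L[ℝ] Tan E x →L[ℝ] ℝ}
  {J : ℝ → ∀ x : M, Tan E x →L[ℝ] Tan E x} {k : M → ℝ} {X : M → E} {W : Set M} {γ : ℝ → M}
  {e : ℝ → ℝ≥0∞}

namespace IsAlmostOrbit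

theorem hasDerivAt_comp (h : IsAlmostOrbit Ω J X W γ e) {F : Type*} [NormedAddCommGroup F]
    [NormedSpace ℝ F] {f : M → F} (hf : ContMDiff 𝓘(ℝ, E) 𝓘(ℝ, F) ∞ f) (t : ℝ) :
    HasDerivAt (fun τ => f (γ τ)) (modelD E f (γ t) (modelVel E γ t)) t :=
  hasDerivAt_comp_curve (hf.mdifferentiable (by simp) _) (h.smooth.mdifferentiable (by simp) t)

theorem continuous_deriv_comp (h : IsAlmostOrbit Ω J X W γ e) {F : Type*} [NormedAddCommGroup F]
    [NormedSpace ℝ F] {f : M → F} (hf : ContMDiff 𝓘(ℝ, E) 𝓘(ℝ, F) ∞ f) :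
    Continuous fun t => modelD E f (γ t) (modelVel E γ t) := by
  have h1 : ContDiff ℝ ∞ fun τ => f (γ τ) := (hf.comp h.smooth).contDiff
  have h2 : deriv (fun τ => f (γ τ)) = fun t => modelD E f (γ t) (modelVel E γ t) :=
    funext fun t => (h.hasDerivAt_comp hf t).deriv
  rw [← h2]
  exact h1.continuous_deriv (by simp)

/-- A real bound in terms of the energy, from a pointwise bound by the density. -/
theorem sq_norm_sub_le (h : IsAlmostOrbit Ω J X W γ e) {F : Type*} [NormedAddCommGroup F]
    [NormedSpace ℝ F] [CompleteSpace F] {g g' : ℝ → F} {C r a b : ℝ} (hC : 0 ≤ C) (hr : 0 ≤ r)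
    (hab : a ≤ b) (hab' : b ≤ a + 1) (hg : ∀ τ, HasDerivAt g (g' τ) τ) (hg' : Continuous g')
    (he : ∀ τ, ENNReal.ofReal (‖g' τ‖ ^ 2) ≤ ENNReal.ofReal C * e τ)
    (hI : ∫⁻ t in Ioc (0 : ℝ) 1, e t ≤ ENNReal.ofReal r) :
    ‖g b - g a‖ ^ 2 ≤ C * (b - a) * r := by
  have h1 := sq_norm_sub_le_lintegral hab hC (fun τ _ => hg τ) hg'.continuousOn fun τ _ => he τ
  have h2 : ∫⁻ t in Ioc a b, e t ≤ ENNReal.ofReal r :=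
    (lintegral_mono_set (Ioc_subset_Ioc_right hab')).trans
      ((lintegral_Ioc_periodic h.density_periodic a).trans_le hI)
  have h3 : ENNReal.ofReal (‖g b - g a‖ ^ 2) ≤ ENNReal.ofReal (C * (b - a) * r) := by
    rw [ENNReal.ofReal_mul (mul_nonneg hC (sub_nonneg.2 hab))]
    exact h1.trans (by gcongr)
  exact (ENNReal.ofReal_le_ofReal_iff
    (mul_nonneg (mul_nonneg hC (sub_nonneg.2 hab)) hr)).1 h3

variable [IsManifold 𝓘(ℝ, E) ∞ M]

/-- A cutoff function varies little along an almost orbit. -/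
theorem sq_cutoff_sub_le (h : IsAlmostOrbit Ω J X W γ e) (hΩ : IsSymplecticForm Ω)
    (hX : IsHamiltonianField Ω k X) {Θ : M → ℝ} (hΘ : IsLevelCutoff E k W Θ) {C r a b : ℝ}
    (hC : 0 < C)
    (hCΘ : ∀ t x v, ‖modelD E Θ x v‖ ^ 2 ≤ C * modelForm Ω x v (modelEnd J t x v)) (hr : 0 ≤ r)
    (hab : a ≤ b) (hab' : b ≤ a + 1) (hI : ∫⁻ t in Ioc (0 : ℝ) 1, e t ≤ ENNReal.ofReal r) :
    (Θ (γ b) - Θ (γ a)) ^ 2 ≤ C * (b - a) * r := by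
  have := h.sq_norm_sub_le hC.le hr hab hab' (h.hasDerivAt_comp hΘ.smooth)
    (h.continuous_deriv_comp hΘ.smooth) (fun τ => ?_) hI
  · rwa [Real.norm_eq_abs, sq_abs] at this
  · by_cases hW : γ τ ∈ W
    · have h1 : modelD E Θ (γ τ) (X (γ τ)) = 0 := hΘ.ker _ _ (by
        have h2 := hX (γ τ) (X (γ τ))
        have h3 : modelForm Ω (γ τ) (X (γ τ)) (X (γ τ)) = 0 := hΩ.alternating _ _
        linarith)
      have h2 : modelD E Θ (γ τ) (modelVel E γ τ) =
          modelD E Θ (γ τ) (modelVel E γ τ - X (γ τ)) := by rw [map_sub, h1, sub_zero]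
      rw [h2]
      calc _ ≤ _ := ENNReal.ofReal_le_ofReal (hCΘ τ (γ τ) _)
        _ = _ := ENNReal.ofReal_mul hC.le
        _ ≤ _ := by gcongr; exact h.le_density τ hW
    · simp [hΘ.modelD_eq_zero _ hW]

variable [FiniteDimensional ℝ E]

/-- The integrated equation of an integral curve holds approximately for an almost orbit. -/
theorem sq_norm_sub_integral_le (h : IsAlmostOrbit Ω J X W γ e) (hΩ : IsSymplecticForm Ω)
    (hk : ContMDiff 𝓘(ℝ, E) 𝓘(ℝ, ℝ) ∞ k) (hX : IsHamiltonianField Ω k X)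
    {F : Type*} [NormedAddCommGroup F] [NormedSpace ℝ F] [CompleteSpace F] {f : M → F}
    (hf : ContMDiff 𝓘(ℝ, E) 𝓘(ℝ, F) ∞ f) {C r a b : ℝ} (hC : 0 < C)
    (hCf : ∀ t x v, ‖modelD E f x v‖ ^ 2 ≤ C * modelForm Ω x v (modelEnd J t x v)) (hr : 0 ≤ r)
    (hab : a ≤ b) (hab' : b ≤ a + 1) (hI : ∫⁻ t in Ioc (0 : ℝ) 1, e t ≤ ENNReal.ofReal r)
    (hW : ∀ t, γ t ∈ W) :
    ‖f (γ b) - f (γ a) - ∫ τ in a..b, modelD E f (γ τ) (X (γ τ))‖ ^ 2 ≤ C * (b - a) * r := by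
  have hcont : Continuous fun τ => modelD E f (γ τ) (X (γ τ)) :=
    (continuous_modelD_hamiltonianField hΩ hk hX hf).comp h.smooth.continuous
  have := h.sq_norm_sub_le (g := fun τ => f (γ τ) - ∫ σ in a..τ, modelD E f (γ σ) (X (γ σ)))
    (g' := fun τ => modelD E f (γ τ) (modelVel E γ τ) - modelD E f (γ τ) (X (γ τ))) hC.le hr hab
    hab' (fun τ => (h.hasDerivAt_comp hf τ).sub (hcont.integral_hasStrictDerivAt a τ).hasDerivAt)
    ((h.continuous_deriv_comp hf).sub hcont) (fun τ => ?_) hI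
  · simp only [intervalIntegral.integral_same, sub_zero] at this
    rwa [sub_right_comm] at this
  · rw [← map_sub]
    calc _ ≤ _ := ENNReal.ofReal_le_ofReal (hCf τ (γ τ) _)
      _ = _ := ENNReal.ofReal_mul hC.le
      _ ≤ _ := by gcongr; exact h.le_density τ (hW τ)

end IsAlmostOrbit

variable [IsManifold 𝓘(ℝ, E) ∞ M] [FiniteDimensional ℝ E] [T2Space M]

/-- A continuous curve that solves the integrated equation against all test functions is an
integral curve. -/
theorem modelVel_eq_of_integral_eq (hΩ : IsSymplecticForm Ω)
    (hk : ContMDiff 𝓘(ℝ, E) 𝓘(ℝ, ℝ) ∞ k) (hX : IsHamiltonianField Ω k X) (hγ : Continuous γ)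
    (h : ∀ f : M → E, ContMDiff 𝓘(ℝ, E) 𝓘(ℝ, E) ∞ f → ∀ a b, a ≤ b → b ≤ a + 1 →
      f (γ b) - f (γ a) = ∫ τ in a..b, modelD E f (γ τ) (X (γ τ))) (t : ℝ) :
    MDifferentiableAt 𝓘(ℝ, ℝ) 𝓘(ℝ, E) γ t ∧ modelVel E γ t = X (γ t) := by
  have := FiniteDimensional.complete ℝ E
  have := isManifold_one E M
  obtain ⟨χ⟩ : Nonempty (SmoothBumpFunction 𝓘(ℝ, E) (γ t)) := inferInstance
  set φ := extChartAt 𝓘(ℝ, E) (γ t) with hφ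
  -- A globally smooth test function that agrees with the chart near γ t.
  set f : M → E := fun x => χ x • φ x with hf
  have hfs : ContMDiff 𝓘(ℝ, E) 𝓘(ℝ, E) ∞ f := χ.contMDiff_smul contMDiffOn_extChartAt
  have hfφ : f =ᶠ[𝓝 (γ t)] φ := by
    filter_upwards [χ.eventuallyEq_one] with x hx
    simp only [hf]
    rw [hx, Pi.one_apply, one_smul]
  have hcont : Continuous fun τ => modelD E f (γ τ) (X (γ τ)) :=
    (continuous_modelD_hamiltonianField hΩ hk hX hfs).comp hγ
  have hd : HasDerivAt (fun τ => f (γ τ)) (modelD E f (γ t) (X (γ t))) t := by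
    have h1 := ((hcont.integral_hasStrictDerivAt (t - 1 / 2) t).hasDerivAt).const_add
      (f (γ (t - 1 / 2)))
    refine h1.congr_of_eventuallyEq ?_
    filter_upwards [Icc_mem_nhds (show t - 1 / 2 < t by linarith) (show t < t + 1 / 2 by linarith)]
      with τ hτ
    have := h f hfs (t - 1 / 2) τ hτ.1 (by linarith [hτ.2])
    rw [← this]
    abel
  have hD : modelD E f (γ t) = chartD (γ t) (γ t) := hfφ.mfderiv_eq
  rw [hD] at hd
  have hd' : HasDerivAt (fun τ => φ (γ τ)) (chartD (γ t) (γ t) (X (γ t))) t := by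
    refine hd.congr_of_eventuallyEq ?_
    filter_upwards [hγ.continuousAt.eventually hfφ] with τ hτ using hτ.symm
  obtain ⟨h1, h2⟩ := velocity_of_hasDerivAt_chart (γ t) hγ.continuousAt
    (mem_extChartAt_source (γ t)) hd'
  refine ⟨h1, ?_⟩
  rw [← chartDsymm_chartD' (γ t) (mem_extChartAt_source (γ t)) (modelVel E γ t), h2,
    chartDsymm_chartD' (γ t) (mem_extChartAt_source (γ t))]

end AlmostOrbits

/-! ### Limits of almost orbits and the energy gap for slices. -/

section Compactness

open Topology Filter

/-- The continuous map on the circle defined by a continuous periodic function. -/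
theorem exists_continuousMap_of_periodic {M : Type*} [TopologicalSpace M] {γ : ℝ → M}
    (hγ : Continuous γ) (hp : ∀ t, γ (t + 1) = γ t) :
    ∃ g : C(UnitAddCircle, M), ∀ t : ℝ, g (t : UnitAddCircle) = γ t := by
  have hp' : Function.Periodic γ 1 := hp
  refine ⟨⟨hp'.lift, ?_⟩, fun t => hp'.lift_coe t⟩
  rw [QuotientAddGroup.isOpenQuotientMap_mk.isQuotientMap.continuous_iff]
  exact hγ

/-- Continuous functions on the circle with a common modulus of continuity and values in a compact
set have a uniformly convergent subsequence. -/
theorem exists_subseq_tendsto_circle {β : Type*} [MetricSpace β] {s : Set β} (hs : IsCompact s)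
    (g : ℕ → C(UnitAddCircle, β)) (hg : ∀ n x, g n x ∈ s) {σ : ℝ → ℝ} (hσ : Tendsto σ (𝓝 0) (𝓝 0))
    (hgσ : ∀ n (a b : ℝ), a ≤ b → b ≤ a + 1 →
      dist (g n (a : UnitAddCircle)) (g n (b : UnitAddCircle)) ≤ σ (b - a)) :
    ∃ (f : C(UnitAddCircle, β)) (ψ : ℕ → ℕ), StrictMono ψ ∧
      ∀ ε > 0, ∀ᶠ n in atTop, ∀ x, dist (g (ψ n) x) (f x) < ε := by
  set G : ℕ → BoundedContinuousFunction UnitAddCircle β :=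
    fun n => BoundedContinuousFunction.mkOfCompact (g n) with hG
  have hc := BoundedContinuousFunction.arzela_ascoli s hs (range G) (by
    rintro f x ⟨n, rfl⟩; exact hg n x) (by
    intro x
    obtain ⟨a, rfl⟩ := QuotientAddGroup.mk_surjective x
    rw [Metric.equicontinuousAt_iff_right]
    intro ε hε
    rw [QuotientAddGroup.nhds_eq, eventually_map]
    have h0 : Tendsto (fun b : ℝ => |b - a|) (𝓝 a) (𝓝 0) := by
      have : Continuous fun b : ℝ => |b - a| := by fun_prop
      simpa using this.tendsto a
    filter_upwards [(hσ.comp h0).eventually (gt_mem_nhds hε),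
      h0.eventually (gt_mem_nhds one_pos)] with b hb hb1
    rintro ⟨_, n, rfl⟩
    refine lt_of_le_of_lt ?_ hb
    rw [abs_lt] at hb1
    rcases le_total a b with hab | hab
    · have := hgσ n a b hab (by linarith)
      rwa [← abs_of_nonneg (sub_nonneg.2 hab)] at this
    · have := hgσ n b a hab (by linarith)
      rw [dist_comm, ← abs_of_nonneg (sub_nonneg.2 hab), abs_sub_comm] at this
      exact this)
  obtain ⟨f, -, ψ, hψ, hlim⟩ := hc.tendsto_subseq (x := G) fun n => subset_closure ⟨n, rfl⟩
  refine ⟨f.toContinuousMap, ψ, hψ, fun ε hε => ?_⟩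
  filter_upwards [Metric.tendsto_nhds.1 hlim ε hε] with n hn x
  exact (BoundedContinuousFunction.dist_coe_le_dist x).trans_lt hn

variable {E : Type*} [NormedAddCommGroup E] [NormedSpace ℝ E] [FiniteDimensional ℝ E]
  {M : Type*} [TopologicalSpace M] [ChartedSpace E M] [IsManifold 𝓘(ℝ, E) ∞ M] [T2Space M]
  [CompactSpace M]
  {Ω : ∀ x : M, Tan E x →L[ℝ] Tan E x →L[ℝ] ℝ}
  {J : ℝ → ∀ x : M, Tan E x →L[ℝ] Tan E x} {k : M → ℝ} {X : M → E} {W : Set M}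

/-- Almost orbits whose energy tends to zero converge to a closed orbit. -/
theorem exists_orbit_of_tendsto_zero (hΩ : IsSymplecticForm Ω) (hJ : IsCompatible Ω J)
    (hk : ContMDiff 𝓘(ℝ, E) 𝓘(ℝ, ℝ) ∞ k) (hX : IsHamiltonianField Ω k X)
    {Q : Set M} (hQ : IsClosed Q) (hQW : Q ⊆ W)
    {γ : ℕ → ℝ → M} {e : ℕ → ℝ → ℝ≥0∞} (h : ∀ n, IsAlmostOrbit Ω J X W (γ n) (e n))
    (hγ : ∀ n t, γ n t ∈ Q) {r : ℕ → ℝ} (hr0 : ∀ n, 0 ≤ r n) (hr1 : ∀ n, r n ≤ 1)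
    (hr : Tendsto r atTop (𝓝 0))
    (hI : ∀ n, ∫⁻ t in Ioc (0 : ℝ) 1, e n t ≤ ENNReal.ofReal (r n)) :
    ∃ γ₀ : ℝ → M, (∀ t, MDifferentiableAt 𝓘(ℝ, ℝ) 𝓘(ℝ, E) γ₀ t ∧ modelVel E γ₀ t = X (γ₀ t)) ∧
      (∀ t, γ₀ (t + 1) = γ₀ t) ∧ (∀ t, γ₀ t ∈ W) ∧
      ((∀ n, IsContractibleLoop (γ n)) → IsContractibleLoop γ₀) := by
  have := FiniteDimensional.complete ℝ E
  -- A Euclidean embedding supplies the metric for Arzelà-Ascoli and for the uniform closeness of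
  -- loops.
  obtain ⟨d, ι, hι, hιc, -⟩ := exists_embedding_euclidean_of_compact (I := 𝓘(ℝ, E)) (M := M)
  obtain ⟨C, hC, hCι⟩ := exists_sq_norm_modelD_le hΩ hJ hι
  obtain ⟨S, hS⟩ := isCompact_univ.exists_bound_of_continuousOn
    (continuous_modelD_hamiltonianField hΩ hk hX hι).continuousOn
  choose g hg using fun n => exists_continuousMap_of_periodic (h n).smooth.continuous (h n).periodic
  have hW : ∀ n t, γ n t ∈ W := fun n t => hQW (hγ n t)
  -- The modulus of continuity is the sum of the drift along X, linear in time, and the deviation,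
  -- at most the root of time by Cauchy-Schwarz.
  obtain ⟨f, ψ, hψ, hlim⟩ := exists_subseq_tendsto_circle (isCompact_range hι.continuous)
    (fun n => (⟨ι, hι.continuous⟩ : C(M, _)).comp (g n)) (fun n x => ⟨_, rfl⟩)
    (σ := fun δ => S * |δ| + √(C * |δ|)) (by
      have : Continuous fun δ : ℝ => S * |δ| + √(C * |δ|) := by fun_prop
      simpa using this.tendsto 0) (by
      intro n a b hab hab'
      simp only [ContinuousMap.comp_apply, ContinuousMap.coe_mk, hg]
      have h1 := (h n).sq_norm_sub_integral_le hΩ hk hX hι hC hCι (hr0 n) hab hab' (hI n) (hW n)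
      have h2 := Real.le_sqrt_of_sq_le (h1.trans (mul_le_of_le_one_right
        (mul_nonneg hC.le (sub_nonneg.2 hab)) (hr1 n)))
      have h3 := intervalIntegral.norm_integral_le_of_norm_le_const (a := a) (b := b)
        (f := fun τ => modelD E ι (γ n τ) (X (γ n τ))) (C := S) fun τ _ => hS _ (mem_univ _)
      have h4 := norm_le_insert' (ι (γ n b) - ι (γ n a))
        (∫ τ in a..b, modelD E ι (γ n τ) (X (γ n τ)))
      rw [dist_comm, dist_eq_norm, abs_of_nonneg (sub_nonneg.2 hab)]
      rw [abs_of_nonneg (sub_nonneg.2 hab)] at h3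
      linarith)
  simp only [ContinuousMap.comp_apply, ContinuousMap.coe_mk] at hlim
  have hpt : ∀ x, Tendsto (fun n => ι (g (ψ n) x)) atTop (𝓝 (f x)) := fun x =>
    Metric.tendsto_nhds.2 fun ε hε => (hlim ε hε).mono fun n hn => hn x
  have hrange : ∀ x, f x ∈ range ι := fun x =>
    hιc.isClosed_range.mem_of_tendsto (hpt x) (Eventually.of_forall fun n => ⟨_, rfl⟩)
  choose f₀ hf₀ using hrange
  have hf₀c : Continuous f₀ := by
    rw [hιc.isInducing.continuous_iff]
    exact f.continuous.congr fun x => (hf₀ x).symm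
  set F₀ : C(UnitAddCircle, M) := ⟨f₀, hf₀c⟩ with hF₀
  set γ₀ : ℝ → M := fun t => f₀ (t : UnitAddCircle) with hγ₀
  have hγ₀c : Continuous γ₀ := hf₀c.comp (AddCircle.continuous_mk' 1)
  have hptM : ∀ t, Tendsto (fun n => γ (ψ n) t) atTop (𝓝 (γ₀ t)) := by
    intro t
    rw [hιc.isInducing.tendsto_nhds_iff]
    have := hpt (t : UnitAddCircle)
    simp only [hg] at this
    rw [hγ₀]
    simp only [hf₀]
    exact this
  have hγ₀W : ∀ t, γ₀ t ∈ W := fun t =>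
    hQW (hQ.mem_of_tendsto (hptM t) (Eventually.of_forall fun n => hγ _ _))
  refine ⟨γ₀, ?_, fun t => ?_, hγ₀W, fun hcontr => ?_⟩
  · refine modelVel_eq_of_integral_eq hΩ hk hX hγ₀c fun p hp a b hab hab' => ?_
    obtain ⟨Cp, hCp, hCp'⟩ := exists_sq_norm_modelD_le hΩ hJ hp
    have hpc := continuous_modelD_hamiltonianField hΩ hk hX hp
    obtain ⟨Sp, hSp⟩ := isCompact_univ.exists_bound_of_continuousOn hpc.continuousOn
    have h1 : Tendsto (fun n => ∫ τ in a..b, modelD E p (γ (ψ n) τ) (X (γ (ψ n) τ))) atTop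
        (𝓝 (∫ τ in a..b, modelD E p (γ₀ τ) (X (γ₀ τ)))) := by
      refine intervalIntegral.tendsto_integral_filter_of_dominated_convergence (fun _ => Sp) ?_ ?_
        intervalIntegrable_const ?_
      · exact Eventually.of_forall fun n =>
          (hpc.comp (h (ψ n)).smooth.continuous).aestronglyMeasurable
      · exact Eventually.of_forall fun n => ae_of_all _ fun τ _ => hSp _ (mem_univ _)
      · exact ae_of_all _ fun τ _ => (hpc.tendsto _).comp (hptM τ)
    have h2 : Tendsto (fun n => p (γ (ψ n) b) - p (γ (ψ n) a) -
        ∫ τ in a..b, modelD E p (γ (ψ n) τ) (X (γ (ψ n) τ))) atTop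
        (𝓝 (p (γ₀ b) - p (γ₀ a) - ∫ τ in a..b, modelD E p (γ₀ τ) (X (γ₀ τ)))) :=
      (((hp.continuous.tendsto _).comp (hptM b)).sub
        ((hp.continuous.tendsto _).comp (hptM a))).sub h1
    have h3 : Tendsto (fun n => √(Cp * (b - a) * r (ψ n))) atTop (𝓝 0) := by
      have : Continuous fun x : ℝ => √(Cp * (b - a) * x) := by fun_prop
      have h4 := (this.tendsto 0).comp (hr.comp hψ.tendsto_atTop)
      simpa [Function.comp_def] using h4
    have h5 := squeeze_zero_norm (fun n => Real.le_sqrt_of_sq_le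
      ((h (ψ n)).sq_norm_sub_integral_le hΩ hk hX hp hCp hCp' (hr0 _) hab hab' (hI _) (hW _))) h3
    exact sub_eq_zero.1 (tendsto_nhds_unique h2 h5)
  · simp only [hγ₀]
    rw [AddCircle.coe_add, AddCircle.coe_period, add_zero]
  · obtain ⟨D, hD, hDd, hhom⟩ := exists_homotopic_of_close (M := M) E UnitAddCircle
    obtain ⟨m, hm, hmin⟩ := hD.isClosed_compl.isCompact.exists_forall_le' (a := 0)
      (f := fun p : M × M => dist (ι p.1) (ι p.2)) (by
        have := hι.continuous
        fun_prop) (by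
        rintro ⟨x, y⟩ hxy
        refine dist_pos.2 fun he => hxy ?_
        have he' := hιc.injective he
        dsimp only at he'
        rw [he']
        exact hDd y)
    obtain ⟨n, hn⟩ := (hlim m hm).exists
    have hH : (g (ψ n)).Homotopic F₀ := by
      refine hhom F₀ (g (ψ n)) fun x => ?_
      by_contra hx
      have h1 := hmin _ hx
      have h2 := hn x
      rw [← hf₀ x] at h2
      exact absurd h2 (not_lt.2 h1)
    obtain ⟨q, hq, y, hy⟩ := hcontr (ψ n)
    have hqg : q = g (ψ n) := by
      ext x
      obtain ⟨t, rfl⟩ := QuotientAddGroup.mk_surjective x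
      exact (hq t).trans (hg (ψ n) t).symm
    exact ⟨F₀, fun t => rfl, y, hH.symm.trans (hqg ▸ hy)⟩

/-- Almost orbits that enter the region `Θ = 1` have a definite amount of energy, unless there is
a closed orbit. -/
theorem exists_energy_gap (hΩ : IsSymplecticForm Ω) (hJ : IsCompatible Ω J)
    (hk : ContMDiff 𝓘(ℝ, E) 𝓘(ℝ, ℝ) ∞ k) (hX : IsHamiltonianField Ω k X) {Θ : M → ℝ}
    (hΘ : IsLevelCutoff E k W Θ) (P : Prop)
    (hno : ∀ γ : ℝ → M,
      (∀ t, MDifferentiableAt 𝓘(ℝ, ℝ) 𝓘(ℝ, E) γ t ∧ modelVel E γ t = X (γ t)) →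
      (∀ t, γ (t + 1) = γ t) → (∀ t, γ t ∈ W) → ¬ (IsContractibleLoop γ ∨ P)) :
    ∃ η > 0, ∀ (γ : ℝ → M) (e : ℝ → ℝ≥0∞), IsAlmostOrbit Ω J X W γ e →
      (IsContractibleLoop γ ∨ P) → (∃ t, Θ (γ t) = 1) →
      ENNReal.ofReal η < ∫⁻ t in Ioc (0 : ℝ) 1, e t := by
  by_contra! hcon
  obtain ⟨C, hC, hCΘ⟩ := exists_sq_norm_modelD_le hΩ hJ hΘ.smooth
  -- The bound r ≤ 1 / (8 C) keeps the oscillation of Θ below 1/2, and the bound r ≤ 1 keeps the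
  -- family equicontinuous.
  set r : ℕ → ℝ := fun n => min 1 (1 / (8 * C)) * (1 / ((n : ℝ) + 1)) with hr
  have hm : 0 < min 1 (1 / (8 * C)) := by positivity
  have hrpos : ∀ n, 0 < r n := fun n => by positivity
  have hrm : ∀ n, r n ≤ min 1 (1 / (8 * C)) := fun n =>
    mul_le_of_le_one_right hm.le (by
      rw [div_le_one (by positivity)]; linarith [(Nat.cast_nonneg n : (0 : ℝ) ≤ n)])
  choose γ e h hcon' hΘ1 hI using fun n => hcon (r n) (hrpos n)
  -- Low energy confines the whole loop to the closed set Θ ≥ 1/2 inside W, so the limit loop cannot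
  -- escape from W.
  have hQ : ∀ n t, 1 / 2 ≤ Θ (γ n t) := by
    intro n t
    obtain ⟨t₀, ht₀⟩ := hΘ1 n
    obtain ⟨t₁, ht₁, hγt⟩ : ∃ t₁ ∈ Ico t₀ (t₀ + 1), γ n t = γ n t₁ := by
      have hp : Function.Periodic (γ n) 1 := (h n).periodic
      exact hp.exists_mem_Ico one_pos t t₀
    have h1 := (h n).sq_cutoff_sub_le hΩ hX hΘ hC hCΘ (hrpos n).le ht₁.1 ht₁.2.le (hI n)
    have h2 : C * (t₁ - t₀) * r n ≤ 1 / 8 := by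
      have h3 : r n ≤ 1 / (8 * C) := (hrm n).trans (min_le_right _ _)
      have h4 : C * r n ≤ 1 / 8 := by
        calc C * r n ≤ C * (1 / (8 * C)) := by gcongr
          _ = 1 / 8 := by field_simp
      have h5 : t₁ - t₀ ≤ 1 := by linarith [ht₁.2]
      nlinarith [mul_pos hC (hrpos n)]
    rw [hγt]
    rw [ht₀] at h1
    by_contra hlt
    nlinarith
  obtain ⟨γ₀, h1, h2, h3, h4⟩ := exists_orbit_of_tendsto_zero hΩ hJ hk hX
    (Q := {x | 1 / 2 ≤ Θ x}) (isClosed_le continuous_const hΘ.smooth.continuous)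
    (fun x (hx : 1 / 2 ≤ Θ x) => hΘ.mem_of_ne x fun h0 => by rw [h0] at hx; norm_num at hx) h hQ
    (fun n => (hrpos n).le) (fun n => (hrm n).trans (min_le_left _ _)) (by
      have := (tendsto_one_div_add_atTop_nhds_zero_nat (𝕜 := ℝ)).const_mul (min 1 (1 / (8 * C)))
      simpa [hr] using this) hI
  -- P stands for the absence of all closed orbits; if it holds, contractibility of the limit is not
  -- needed.
  by_cases hP : P
  · exact hno γ₀ h1 h2 h3 (Or.inr hP)
  · exact hno γ₀ h1 h2 h3 (Or.inl (h4 fun n => (hcon' n).resolve_right hP))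

end Compactness

/-! ### The graph construction: removing the Hamiltonian term. -/

section Graph

open Topology

variable {E : Type*} [NormedAddCommGroup E] [NormedSpace ℝ E]

/-- The almost complex structure on `ℝ × ℝ × E` that turns graphs of solutions of
`∂u/∂t = x + A ∂u/∂s` into holomorphic curves. -/
def graphEnd (A : E →L[ℝ] E) (x : E) : ℝ × (ℝ × E) →L[ℝ] ℝ × (ℝ × E) :=
  (ContinuousLinearMap.inl ℝ ℝ (ℝ × E)).comp
      (-((ContinuousLinearMap.fst ℝ ℝ E).comp (ContinuousLinearMap.snd ℝ ℝ (ℝ × E)))) +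
    (ContinuousLinearMap.inr ℝ ℝ (ℝ × E)).comp
      ((ContinuousLinearMap.inl ℝ ℝ E).comp (ContinuousLinearMap.fst ℝ ℝ (ℝ × E)) +
        (ContinuousLinearMap.inr ℝ ℝ E).comp
          (A.comp ((ContinuousLinearMap.snd ℝ ℝ E).comp (ContinuousLinearMap.snd ℝ ℝ (ℝ × E))) +
            (ContinuousLinearMap.fst ℝ ℝ (ℝ × E)).smulRight x -
            ((ContinuousLinearMap.fst ℝ ℝ E).comp
              (ContinuousLinearMap.snd ℝ ℝ (ℝ × E))).smulRight (A x)))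

@[simp]
theorem graphEnd_apply (A : E →L[ℝ] E) (x : E) (v : ℝ × (ℝ × E)) :
    graphEnd A x v = (-v.2.1, (v.1, A v.2.2 + v.1 • x - v.2.1 • A x)) := by
  simp [graphEnd]

/-- The projection along the graph direction. -/
def graphProj (x : E) : ℝ × (ℝ × E) →L[ℝ] E :=
  (ContinuousLinearMap.snd ℝ ℝ E).comp (ContinuousLinearMap.snd ℝ ℝ (ℝ × E)) -
    ((ContinuousLinearMap.fst ℝ ℝ E).comp (ContinuousLinearMap.snd ℝ ℝ (ℝ × E))).smulRight x

@[simp]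
theorem graphProj_apply (x : E) (v : ℝ × (ℝ × E)) : graphProj x v = v.2.2 - v.2.1 • x := by
  simp [graphProj]

/-- The scalar product on `ℝ × ℝ × E` for which `graphEnd A x` is an isometry. -/
def graphForm (B : E →L[ℝ] E →L[ℝ] ℝ) (A : E →L[ℝ] E) (x : E) :
    ℝ × (ℝ × E) →L[ℝ] ℝ × (ℝ × E) →L[ℝ] ℝ :=
  (ContinuousLinearMap.fst ℝ ℝ (ℝ × E)).smulRight (ContinuousLinearMap.fst ℝ ℝ (ℝ × E)) +
    ((ContinuousLinearMap.fst ℝ ℝ E).comp (ContinuousLinearMap.snd ℝ ℝ (ℝ × E))).smulRight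
      ((ContinuousLinearMap.fst ℝ ℝ E).comp (ContinuousLinearMap.snd ℝ ℝ (ℝ × E))) +
    B.bilinearComp (graphProj x) (A.comp (graphProj x))

@[simp]
theorem graphForm_apply (B : E →L[ℝ] E →L[ℝ] ℝ) (A : E →L[ℝ] E) (x : E) (v w : ℝ × (ℝ × E)) :
    graphForm B A x v w = v.1 * w.1 + v.2.1 * w.2.1 +
      B (v.2.2 - v.2.1 • x) (A (w.2.2 - w.2.1 • x)) := by
  simp [graphForm, ContinuousLinearMap.bilinearComp_apply]

theorem graphEnd_graphEnd {A : E →L[ℝ] E} (hA : ∀ v, A (A v) = -v) (x : E) (v : ℝ × (ℝ × E)) :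
    graphEnd A x (graphEnd A x v) = -v := by
  obtain ⟨a, b, v⟩ := v
  simp [hA]

/-- The projection v.2.2 - v.2.1 • x intertwines the graph structure with A, and on the first two
coordinates the structure is a rotation by a right angle. -/
theorem graphForm_graphEnd {B : E →L[ℝ] E →L[ℝ] ℝ} {A : E →L[ℝ] E}
    (hBA : ∀ v w, B (A v) (A w) = B v w) (x : E) (v w : ℝ × (ℝ × E)) :
    graphForm B A x (graphEnd A x v) (graphEnd A x w) = graphForm B A x v w := by
  obtain ⟨a, b, v⟩ := v
  obtain ⟨a', b', w⟩ := w
  have h1 : A v + a • x - b • A x - a • x = A (v - b • x) := by simp; abel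
  have h2 : A w + a' • x - b' • A x - a' • x = A (w - b' • x) := by simp; abel
  simp only [graphForm_apply, graphEnd_apply, h1, h2, hBA]
  ring

/-- B is alternating, and invariance with A² = -1 gives B v (A w) = B w (A v). -/
theorem graphForm_symm {B : E →L[ℝ] E →L[ℝ] ℝ} {A : E →L[ℝ] E} (hA : ∀ v, A (A v) = -v)
    (hBA : ∀ v w, B (A v) (A w) = B v w) (hB : ∀ v, B v v = 0) (x : E) (v w : ℝ × (ℝ × E)) :
    graphForm B A x v w = graphForm B A x w v := by
  have hanti : ∀ v w, B v w = -B w v := by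
    intro v w
    have := hB (v + w)
    simp only [map_add, add_apply, hB] at this
    linarith
  have h1 : ∀ v w, B v (A w) = B w (A v) := by
    intro v w
    rw [← hBA v (A w), hA, map_neg, hanti (A v) w, neg_neg]
  simp only [graphForm_apply, h1 (v.2.2 - v.2.1 • x)]
  ring

theorem sq_norm_le_graphForm {B : E →L[ℝ] E →L[ℝ] ℝ} {A : E →L[ℝ] E} {x : E} {L : ℝ} (hL : 1 ≤ L)
    (hB : ∀ v, ‖v‖ ^ 2 ≤ L * B v (A v)) (hx : ‖x‖ ≤ L) (v : ℝ × (ℝ × E)) :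
    ‖v‖ ^ 2 ≤ 3 * L ^ 2 * graphForm B A x v v := by
  obtain ⟨a, b, v⟩ := v
  simp only [graphForm_apply]
  set p := v - b • x with hp
  have h1 := hB p
  have hBp : 0 ≤ B p (A p) := nonneg_of_mul_nonneg_right ((sq_nonneg ‖p‖).trans h1) (by linarith)
  have h2 : ‖v‖ ≤ ‖p‖ + |b| * L := by
    calc ‖v‖ = ‖p + b • x‖ := by rw [hp, sub_add_cancel]
      _ ≤ ‖p‖ + ‖b • x‖ := norm_add_le _ _
      _ ≤ _ := by rw [norm_smul, Real.norm_eq_abs]; gcongr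
  have h3 : ‖v‖ ^ 2 ≤ 2 * L * B p (A p) + 2 * L ^ 2 * b ^ 2 := by
    have : ‖v‖ ^ 2 ≤ (‖p‖ + |b| * L) ^ 2 := by gcongr
    nlinarith [sq_nonneg (‖p‖ - |b| * L), sq_abs b]
  have h4 : ‖(a, b, v)‖ ^ 2 ≤ a ^ 2 + b ^ 2 + ‖v‖ ^ 2 := by
    rw [Prod.norm_mk, Prod.norm_mk, Real.norm_eq_abs, Real.norm_eq_abs]
    rcases max_cases |a| (max |b| ‖v‖) with ⟨h, _⟩ | ⟨h, _⟩ <;>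
      rcases max_cases |b| ‖v‖ with ⟨h', _⟩ | ⟨h', _⟩ <;> rw [h]
    · rw [sq_abs]; linarith [sq_nonneg b, sq_nonneg ‖v‖]
    · rw [sq_abs]; linarith [sq_nonneg b, sq_nonneg ‖v‖]
    · rw [h', sq_abs]; nlinarith [sq_nonneg a, sq_nonneg ‖v‖]
    · rw [h']; nlinarith [sq_nonneg a, sq_nonneg b]
  have hL2 : 1 ≤ L ^ 2 := one_le_pow₀ hL
  have hLL : L ≤ L ^ 2 := by nlinarith
  nlinarith [mul_le_mul_of_nonneg_right hL2 (sq_nonneg a),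
    mul_le_mul_of_nonneg_right hL2 (sq_nonneg b), mul_le_mul_of_nonneg_right hLL hBp,
    mul_nonneg (sq_nonneg L) hBp, sq_nonneg a, sq_nonneg b]

theorem abs_graphForm_le {B : E →L[ℝ] E →L[ℝ] ℝ} {A : E →L[ℝ] E} {x : E} {L : ℝ} (hL : 1 ≤ L)
    (hB : ‖B‖ ≤ L) (hA : ‖A‖ ≤ L) (hx : ‖x‖ ≤ L) (v w : ℝ × (ℝ × E)) :
    |graphForm B A x v w| ≤ 6 * L ^ 4 * ‖v‖ * ‖w‖ := by
  have hp : ∀ v : ℝ × (ℝ × E), ‖v.2.2 - v.2.1 • x‖ ≤ 2 * L * ‖v‖ := by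
    intro v
    have h1 : ‖v.2.2‖ ≤ ‖v‖ := (norm_snd_le v.2).trans (norm_snd_le v)
    have h2 : ‖v.2.1‖ ≤ ‖v‖ := (norm_fst_le v.2).trans (norm_snd_le v)
    calc _ ≤ ‖v.2.2‖ + ‖v.2.1 • x‖ := norm_sub_le _ _
      _ ≤ ‖v‖ + ‖v‖ * L := by rw [norm_smul]; gcongr
      _ ≤ _ := by nlinarith [norm_nonneg v]
  have h1 : |v.1 * w.1| ≤ ‖v‖ * ‖w‖ := by
    rw [abs_mul]; exact mul_le_mul (norm_fst_le v) (norm_fst_le w) (abs_nonneg _) (norm_nonneg _)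
  have h2 : |v.2.1 * w.2.1| ≤ ‖v‖ * ‖w‖ := by
    rw [abs_mul]
    exact mul_le_mul ((norm_fst_le v.2).trans (norm_snd_le v))
      ((norm_fst_le w.2).trans (norm_snd_le w)) (abs_nonneg _) (norm_nonneg _)
  have h3 : |B (v.2.2 - v.2.1 • x) (A (w.2.2 - w.2.1 • x))| ≤ 4 * L ^ 4 * (‖v‖ * ‖w‖) := by
    have hL0 : 0 ≤ L := by linarith
    calc _ ≤ ‖B‖ * ‖v.2.2 - v.2.1 • x‖ * ‖A (w.2.2 - w.2.1 • x)‖ := B.le_opNorm₂ _ _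
      _ ≤ L * (2 * L * ‖v‖) * (L * (2 * L * ‖w‖)) := by
        gcongr
        · exact hp v
        · exact (A.le_opNorm _).trans (by gcongr; exact hp w)
      _ = _ := by ring
  have hL4 : 1 ≤ L ^ 4 := one_le_pow₀ hL
  have h0 : 0 ≤ ‖v‖ * ‖w‖ := by positivity
  rw [graphForm_apply]
  refine (abs_add_three _ _ _).trans ?_
  nlinarith

theorem contDiffAt_graphEnd {G : Type*} [NormedAddCommGroup G] [NormedSpace ℝ G] {A : G → E →L[ℝ] E}
    {x : G → E} {n : WithTop ℕ∞} {p : G} (hA : ContDiffAt ℝ n A p) (hx : ContDiffAt ℝ n x p) :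
    ContDiffAt ℝ n (fun q => graphEnd (A q) (x q)) p := by
  have hAx := hA.clm_apply hx
  unfold graphEnd
  refine contDiffAt_const.add (contDiffAt_const.clm_comp (contDiffAt_const.add
    (contDiffAt_const.clm_comp (((hA.clm_comp contDiffAt_const).add ?_).sub ?_))))
  · exact contDiffAt_const.smulRight hx
  · exact contDiffAt_const.smulRight hAx

end Graph

/-! ### Monotonicity for the inhomogeneous equation in a coordinate ball. -/

section LocalBound

open Topology

variable {E : Type*} [NormedAddCommGroup E] [NormedSpace ℝ E]

/-- Bounds on the geometry at a point `p` of a coordinate neighbourhood. -/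
structure IsBoundedGeometry (L : ℝ) (B : E → E →L[ℝ] E →L[ℝ] ℝ) (A : ℝ × E → E →L[ℝ] E)
    (x : E → E) (p : ℝ × E) : Prop where
  norm_form_le : ‖B p.2‖ ≤ L
  norm_end_le : ‖A p‖ ≤ L
  norm_field_le : ‖x p.2‖ ≤ L
  sq_norm_le : ∀ v, ‖v‖ ^ 2 ≤ L * B p.2 v (A p v)
  diff : DifferentiableAt ℝ (fun q : ℝ × E => graphEnd (A q) (x q.2)) p
  norm_graph_le : ‖graphEnd (A p) (x p.2)‖ ≤ L
  norm_fderiv_le : ‖fderiv ℝ (fun q : ℝ × E => graphEnd (A q) (x q.2)) p‖ ≤ L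

-- Each quantity is continuous at p₀, hence bounded nearby; L is the largest of the bounds, at least
-- one.
set_option synthInstance.maxHeartbeats 200000 in
theorem exists_isBoundedGeometry {B : E → E →L[ℝ] E →L[ℝ] ℝ} {A : ℝ × E → E →L[ℝ] E}
    {x : E → E} {p₀ : ℝ × E} (hB : ContinuousAt B p₀.2) (hA : ContDiffAt ℝ ∞ A p₀)
    (hx : ContDiffAt ℝ ∞ x p₀.2) {C : ℝ} (hC : 0 < C)
    (hlow : ∀ᶠ p in 𝓝 p₀, ∀ v, ‖v‖ ^ 2 ≤ C * B p.2 v (A p v)) :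
    ∃ L ≥ 1, ∀ᶠ p in 𝓝 p₀, IsBoundedGeometry L B A x p := by
  have hx' : ContDiffAt ℝ ∞ (fun q : ℝ × E => x q.2) p₀ :=
    ContDiffAt.comp (g := x) p₀ hx contDiffAt_snd
  have hB' : ContinuousAt (fun q : ℝ × E => B q.2) p₀ :=
    ContinuousAt.comp (g := B) hB continuousAt_snd
  have hG := contDiffAt_graphEnd hA hx'
  obtain ⟨L₁, h₁⟩ := (ContinuousAt.norm (E := E →L[ℝ] E →L[ℝ] ℝ) hB').exists_eventually_le
  obtain ⟨L₂, h₂⟩ := hA.continuousAt.norm.exists_eventually_le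
  obtain ⟨L₃, h₃⟩ := hx'.continuousAt.norm.exists_eventually_le
  obtain ⟨L₄, h₄⟩ := hG.continuousAt.norm.exists_eventually_le
  obtain ⟨L₅, h₅⟩ := (hG.fderiv_right (m := ∞) (by simp)).continuousAt.norm.exists_eventually_le
  have h₆ : ∀ᶠ p in 𝓝 p₀, DifferentiableAt ℝ (fun q : ℝ × E => graphEnd (A q) (x q.2)) p :=
    ((hG.of_le (m := 1) (by simp)).eventually (by simp)).mono
      fun p hp => hp.differentiableAt one_ne_zero
  set L := max 1 (max C (max L₁ (max L₂ (max L₃ (max L₄ L₅))))) with hL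
  have e0 : C ≤ L := by simp [hL]
  have e1 : L₁ ≤ L := by simp [hL]
  have e2 : L₂ ≤ L := by simp [hL]
  have e3 : L₃ ≤ L := by simp [hL]
  have e4 : L₄ ≤ L := by simp [hL]
  have e5 : L₅ ≤ L := by simp [hL]
  refine ⟨L, le_max_left _ _, ?_⟩
  filter_upwards [hlow, h₁, h₂, h₃, h₄, h₅, h₆] with p b0 b1 b2 b3 b4 b5 b6
  refine ⟨b1.trans e1, b2.trans e2, b3.trans e3, fun v => (b0 v).trans ?_, b6, b4.trans e4,
    b5.trans e5⟩
  have : 0 ≤ B p.2 v (A p v) := nonneg_of_mul_nonneg_right ((sq_nonneg ‖v‖).trans (b0 v)) hC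
  gcongr

/-- Local monotonicity: a solution of `∂y/∂t = x(y) + A(t, y) ∂y/∂s` that leaves a coordinate
neighbourhood inside a box has a definite amount of area plus energy in the box. -/
theorem exists_local_energy_bound {B : E → E →L[ℝ] E →L[ℝ] ℝ} {A : ℝ × E → E →L[ℝ] E}
    {x : E → E} {p₀ : ℝ × E} {L R : ℝ} (hL : 1 ≤ L) (hR : 0 < R)
    (hgeom : ∀ p ∈ Metric.ball p₀ R, IsBoundedGeometry L B A x p)
    (hsq : ∀ p ∈ Metric.ball p₀ R, ∀ v, A p (A p v) = -v)
    (hinv : ∀ p ∈ Metric.ball p₀ R, ∀ v w, B p.2 (A p v) (A p w) = B p.2 v w)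
    (halt : ∀ p ∈ Metric.ball p₀ R, ∀ v, B p.2 v v = 0) :
    ∃ ε > 0, ∀ (N : Set (ℝ × ℝ)) (y : ℝ × ℝ → E) (a b z₁ : ℝ × ℝ), IsOpen N →
      (∀ z ∈ N, (z.2, y z) ∈ Metric.ball p₀ R) → (∀ z ∈ N, ContDiffAt ℝ 2 y z) →
      (∀ z ∈ N, fderiv ℝ y z (0, 1) = x (y z) + A (z.2, y z) (fderiv ℝ y z (1, 0))) →
      z₁ ∈ N → z₁ ∈ Icc a b →
      IsClosed {z | z ∈ N ∧ (z.2, y z) ∈ Metric.closedBall (z₁.2, y z₁) (R / 4)} →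
      (∀ z ∈ Icc a b, z ∈ N → a.1 < z.1 ∧ z.1 < b.1 ∧ a.2 < z.2 ∧ z.2 < b.2) →
      ENNReal.ofReal ε ≤ ∫⁻ z in Icc a b ∩ N, ENNReal.ofReal (1 + ‖fderiv ℝ y z (1, 0)‖ ^ 2) := by
  obtain ⟨K, hK, hmono⟩ := exists_monotonicity_constant
  -- One constant dominating 3 L², 6 L⁴ and L, the bounds of the graph geometry.
  set D := 6 * L ^ 4 with hD
  have hL4 : 1 ≤ L ^ 4 := one_le_pow₀ hL
  have hLL : L ≤ L ^ 4 := le_self_pow₀ hL (by norm_num)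
  have hL24 : L ^ 2 ≤ L ^ 4 := pow_le_pow_right₀ hL (by norm_num)
  have hD1 : 1 ≤ D := by rw [hD]; linarith
  have hLD : L ≤ D := by rw [hD]; linarith
  have hD0 : 0 < D := by linarith
  -- The first bound is the smallness required by monotonicity; the second keeps the ρ-ball of the
  -- form P within coordinate distance R / 4 of its centre.
  set ρ := min (1 / (48 * D ^ 5)) (R / (4 * D)) with hρ
  have hρ0 : 0 < ρ := by positivity
  have hρ1 : 48 * (D ^ 5 * ρ) ≤ 1 := by
    calc 48 * (D ^ 5 * ρ) ≤ 48 * (D ^ 5 * (1 / (48 * D ^ 5))) := by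
          gcongr; exact min_le_left _ _
      _ = 1 := by field_simp
  have hρ2 : D * ρ ≤ R / 4 := by
    calc D * ρ ≤ D * (R / (4 * D)) := by gcongr; exact min_le_right _ _
      _ = R / 4 := by field_simp
  refine ⟨ρ ^ 2 / (K * D), by positivity, ?_⟩
  intro N y a b z₁ hN hNR hy heq hz₁ hz₁ab hcl hbd
  set w : ℝ × ℝ → ℝ × (ℝ × E) := fun z => (z.1, (z.2, y z)) with hw
  set p₁ : ℝ × E := (z₁.2, y z₁) with hp₁
  set c : ℝ × (ℝ × E) := w z₁ with hc
  set j : ℝ × (ℝ × E) → ℝ × (ℝ × E) →L[ℝ] ℝ × (ℝ × E) :=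
    fun q => graphEnd (A q.2) (x q.2.2) with hj
  have hp₁R : p₁ ∈ Metric.ball p₀ R := hNR z₁ hz₁
  have hg₁ := hgeom p₁ hp₁R
  set P := graphForm (B p₁.2) (A p₁) (x p₁.2) with hP
  have hlow : ∀ v, ‖v‖ ^ 2 ≤ D * P v v := fun v => by
    have h1 := sq_norm_le_graphForm hL hg₁.sq_norm_le hg₁.norm_field_le v
    have h2 : 0 ≤ P v v := nonneg_of_mul_nonneg_right ((sq_nonneg ‖v‖).trans h1) (by positivity)
    refine h1.trans ?_
    gcongr
    rw [hD]; nlinarith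
  have hup : ∀ v w, |P v w| ≤ D * ‖v‖ * ‖w‖ :=
    abs_graphForm_le hL hg₁.norm_form_le hg₁.norm_end_le hg₁.norm_field_le
  have hwd : ∀ z ∈ N, ∀ v, fderiv ℝ w z v = (v.1, (v.2, fderiv ℝ y z v)) := by
    intro z hz v
    have h1 : HasFDerivAt y (fderiv ℝ y z) z := ((hy z hz).differentiableAt (by simp)).hasFDerivAt
    have h2 : HasFDerivAt w ((ContinuousLinearMap.fst ℝ ℝ ℝ).prod
        ((ContinuousLinearMap.snd ℝ ℝ ℝ).prod (fderiv ℝ y z))) z :=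
      hasFDerivAt_fst.prodMk (hasFDerivAt_snd.prodMk h1)
    rw [h2.fderiv]; rfl
  have hjd : ∀ z ∈ N, HasFDerivAt j ((fderiv ℝ (fun q : ℝ × E => graphEnd (A q) (x q.2))
      (z.2, y z)).comp (ContinuousLinearMap.snd ℝ ℝ (ℝ × E))) (w z) := by
    intro z hz
    exact HasFDerivAt.comp (g := fun q : ℝ × E => graphEnd (A q) (x q.2)) (w z)
      (hgeom _ (hNR z hz)).diff.hasFDerivAt hasFDerivAt_snd
  have hcurve : IsAlmostComplexCurve D P (graphEnd (A p₁) (x p₁.2)) j c w N := by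
    refine ⟨hD1, graphForm_symm (hsq _ hp₁R) (hinv _ hp₁R) (halt _ hp₁R) _, hlow, hup,
      graphEnd_graphEnd (hsq _ hp₁R) _, graphForm_graphEnd (hinv _ hp₁R) _, hN, fun z hz => ?_,
      fun z hz => (hjd z hz).differentiableAt, fun z hz => graphEnd_graphEnd (hsq _ (hNR z hz)) _,
      fun z hz => ?_, fun z hz => (hgeom _ (hNR z hz)).norm_graph_le.trans hLD, fun z hz => ?_,
      fun z hz => ?_⟩
    · exact contDiffAt_fst.prodMk (contDiffAt_snd.prodMk (hy z hz))
    · have h1 := (convex_ball p₀ R).norm_image_sub_le_of_norm_fderiv_le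
        (fun p hp => (hgeom p hp).diff) (fun p hp => (hgeom p hp).norm_fderiv_le) hp₁R (hNR z hz)
      refine h1.trans ?_
      gcongr
      exact norm_snd_le (w z - c)
    · rw [(hjd z hz).fderiv]
      refine (ContinuousLinearMap.opNorm_comp_le _ _).trans ?_
      calc _ ≤ L * 1 := by
            gcongr
            · exact (hgeom _ (hNR z hz)).norm_fderiv_le
            · exact ContinuousLinearMap.norm_snd_le ..
        _ ≤ D := by linarith
    · rw [hwd z hz, hwd z hz, heq z hz]
      simp [hj, hw, add_comm]
  have hPρ : ∀ v, P v v ≤ ρ ^ 2 → ‖v‖ ≤ R / 4 := by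
    intro v hv
    have h1 : ‖v‖ ^ 2 ≤ (D * ρ) ^ 2 := by
      calc ‖v‖ ^ 2 ≤ D * P v v := hlow v
        _ ≤ D * ρ ^ 2 := by gcongr
        _ ≤ D * (D * ρ ^ 2) := le_mul_of_one_le_left (by positivity) hD1
        _ = _ := by ring
    exact ((sq_le_sq₀ (norm_nonneg v) (by positivity)).1 h1).trans hρ2
  set S := {z | z ∈ N ∧ P (w z - c) (w z - c) ≤ ρ ^ 2} with hS
  have hwc : ∀ z ∈ N, ContinuousAt (fun z => P (w z - c) (w z - c)) z := by
    intro z hz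
    have : ContinuousAt w z :=
      (continuousAt_fst.prodMk (continuousAt_snd.prodMk (hy z hz).continuousAt))
    fun_prop
  have hScl : IsClosed S := by
    have h1 := ContinuousOn.preimage_isClosed_of_isClosed
      (fun z hz => (hwc z hz.1).continuousWithinAt) hcl (isClosed_Iic (a := ρ ^ 2))
    convert h1 using 1
    ext z
    constructor
    · rintro ⟨hz, hz'⟩
      refine ⟨⟨hz, ?_⟩, hz'⟩
      rw [mem_closedBall_iff_norm]
      exact (norm_snd_le (w z - c)).trans (hPρ _ hz')
    · rintro ⟨⟨hz, -⟩, hz'⟩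
      exact ⟨hz, hz'⟩
  -- The s-derivative of the graph has first component 1, so it never vanishes, even where u is
  -- constant in s.
  have hmain := hmono hcurve hρ0 hρ1 hScl hz₁ab hz₁ rfl (by
    rw [hwd z₁ hz₁]; simp) fun z hz hzN _ => hbd z hz hzN
  set I := ∫ z in Icc a b ∩ S, P (fderiv ℝ w z (1, 0)) (fderiv ℝ w z (1, 0)) with hI
  -- Positivity also yields integrability, since the Bochner integral of a non-integrable function
  -- is zero.
  have hI0 : 0 < I := by
    have : 0 < ρ ^ 2 := by positivity
    by_contra h
    nlinarith
  have hint : IntegrableOn (fun z => P (fderiv ℝ w z (1, 0)) (fderiv ℝ w z (1, 0))) (Icc a b ∩ S) := by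
    by_contra h
    exact hI0.ne' (integral_undef h)
  have hIl : ENNReal.ofReal I ≤
      ENNReal.ofReal D * ∫⁻ z in Icc a b ∩ N, ENNReal.ofReal (1 + ‖fderiv ℝ y z (1, 0)‖ ^ 2) := by
    rw [hI, ofReal_integral_eq_lintegral_ofReal hint (Filter.Eventually.of_forall fun z =>
      hcurve.nonneg _), ← lintegral_const_mul' _ _ ENNReal.ofReal_ne_top]
    refine (setLIntegral_mono' (measurableSet_Icc.inter hScl.measurableSet) fun z hz => ?_).trans
      (lintegral_mono_set (inter_subset_inter_right _ fun z hz => hz.1))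
    rw [← ENNReal.ofReal_mul hD0.le]
    refine ENNReal.ofReal_le_ofReal ?_
    have h1 := (le_abs_self _).trans (hup (fderiv ℝ w z (1, 0)) (fderiv ℝ w z (1, 0)))
    refine h1.trans ?_
    rw [mul_assoc]
    gcongr
    rw [hwd z hz.2.1, Prod.norm_mk, Prod.norm_mk]
    simp only [norm_one, norm_zero]
    have h0 := norm_nonneg (fderiv ℝ y z (1, 0))
    rw [max_eq_right h0]
    rcases max_cases 1 ‖fderiv ℝ y z (1, 0)‖ with ⟨h, _⟩ | ⟨h, _⟩ <;> rw [h] <;> nlinarith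
  rw [ENNReal.ofReal_div_of_pos (by positivity)]
  refine ENNReal.div_le_of_le_mul' ?_
  calc ENNReal.ofReal (ρ ^ 2) ≤ ENNReal.ofReal (K * I) := ENNReal.ofReal_le_ofReal hmain
    _ = ENNReal.ofReal K * ENNReal.ofReal I := ENNReal.ofReal_mul hK.le
    _ ≤ ENNReal.ofReal K * (ENNReal.ofReal D * ∫⁻ z in Icc a b ∩ N,
        ENNReal.ofReal (1 + ‖fderiv ℝ y z (1, 0)‖ ^ 2)) := by gcongr
    _ = _ := by rw [← mul_assoc, ← ENNReal.ofReal_mul hK.le]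

end LocalBound

/-! ### Solutions over W and their local monotonicity. -/

section Trajectories

open Topology

variable {E : Type*} [NormedAddCommGroup E] [NormedSpace ℝ E]
  {M : Type*} [TopologicalSpace M] [ChartedSpace E M] [IsManifold 𝓘(ℝ, E) ∞ M]
  {Ω : ∀ x : M, Tan E x →L[ℝ] Tan E x →L[ℝ] ℝ}
  {J : ℝ → ∀ x : M, Tan E x →L[ℝ] Tan E x} {k : M → ℝ} {X : M → E} {W : Set M}

theorem coordEnd_coordEnd (hJ : IsCompatible Ω J) (x₀ : M) {y : E}
    (hy : y ∈ (extChartAt 𝓘(ℝ, E) x₀).target) (t : ℝ) (v : E) :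
    coordEnd J x₀ (t, y) (coordEnd J x₀ (t, y) v) = -v := by
  have hx := (extChartAt 𝓘(ℝ, E) x₀).map_target hy
  have h := fun v => coordEnd_chartD J x₀ hx t v
  rw [(extChartAt 𝓘(ℝ, E) x₀).right_inv hy] at h
  rw [← chartD_chartDsymm x₀ hy v, h, h, ← map_neg]
  exact congrArg _ (hJ.sq_eq_neg t _ _)

theorem coordForm_coordEnd_coordEnd (hJ : IsCompatible Ω J) (x₀ : M) {y : E}
    (hy : y ∈ (extChartAt 𝓘(ℝ, E) x₀).target) (t : ℝ) (v w : E) :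
    coordForm Ω x₀ y (coordEnd J x₀ (t, y) v) (coordEnd J x₀ (t, y) w) = coordForm Ω x₀ y v w := by
  have hx := (extChartAt 𝓘(ℝ, E) x₀).map_target hy
  have h := fun v => coordEnd_chartD J x₀ hx t v
  have h' := fun v w => coordForm_chartD Ω x₀ hx v w
  rw [(extChartAt 𝓘(ℝ, E) x₀).right_inv hy] at h h'
  rw [← chartD_chartDsymm x₀ hy v, ← chartD_chartDsymm x₀ hy w, h, h, h', h']
  exact hJ.invariant t _ _ _

theorem coordForm_self (hΩ : IsSymplecticForm Ω) (x₀ : M) {y : E}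
    (hy : y ∈ (extChartAt 𝓘(ℝ, E) x₀).target) (v : E) : coordForm Ω x₀ y v v = 0 := by
  have hx := (extChartAt 𝓘(ℝ, E) x₀).map_target hy
  have h' := fun v w => coordForm_chartD Ω x₀ hx v w
  rw [(extChartAt 𝓘(ℝ, E) x₀).right_inv hy] at h'
  rw [← chartD_chartDsymm x₀ hy v, h']
  exact hΩ.alternating _ _

/-- A map that solves the Floer equation in the region `W`, with an energy density `e`. -/
structure IsLocalTrajectory (Ω : ∀ x : M, Tan E x →L[ℝ] Tan E x →L[ℝ] ℝ)
    (J : ℝ → ∀ x : M, Tan E x →L[ℝ] Tan E x) (X : M → E) (W : Set M) (u : ℝ → ℝ → M)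
    (e : ℝ → ℝ → ℝ≥0∞) : Prop where
  smooth : ContMDiff 𝓘(ℝ, ℝ × ℝ) 𝓘(ℝ, E) ∞ (fun z : ℝ × ℝ ↦ u z.1 z.2)
  periodic : ∀ s t, u s (t + 1) = u s t
  density_periodic : ∀ s t, e s (t + 1) = e s t
  eqn : ∀ s t, u s t ∈ W → modelVel E (u s) t =
    X (u s t) + modelEnd J t (u s t) (modelVel E (fun s' => u s' t) s)
  le_density : ∀ s t, u s t ∈ W → ENNReal.ofReal (modelForm Ω (u s t)
    (modelVel E (fun s' => u s' t) s) (modelEnd J t (u s t) (modelVel E (fun s' => u s' t) s))) ≤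
      e s t

namespace IsLocalTrajectory

variable {u : ℝ → ℝ → M} {e : ℝ → ℝ → ℝ≥0∞}

omit [IsManifold 𝓘(ℝ, E) ∞ M] in
theorem smooth_left (h : IsLocalTrajectory Ω J X W u e) (t : ℝ) :
    ContMDiff 𝓘(ℝ, ℝ) 𝓘(ℝ, E) ∞ fun s => u s t := by
  have h1 : ContMDiff 𝓘(ℝ, ℝ) 𝓘(ℝ, ℝ × ℝ) ∞ fun s : ℝ => (s, t) :=
    (contDiff_id.prodMk contDiff_const).contMDiff
  exact h.smooth.comp h1

omit [IsManifold 𝓘(ℝ, E) ∞ M] in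
theorem smooth_right (h : IsLocalTrajectory Ω J X W u e) (s : ℝ) :
    ContMDiff 𝓘(ℝ, ℝ) 𝓘(ℝ, E) ∞ (u s) := by
  have h1 : ContMDiff 𝓘(ℝ, ℝ) 𝓘(ℝ, ℝ × ℝ) ∞ fun t : ℝ => (s, t) :=
    (contDiff_const.prodMk contDiff_id).contMDiff
  exact h.smooth.comp h1

theorem contDiffAt_chart (h : IsLocalTrajectory Ω J X W u e) (x₀ : M) {z : ℝ × ℝ}
    (hz : u z.1 z.2 ∈ (extChartAt 𝓘(ℝ, E) x₀).source) :
    ContDiffAt ℝ ∞ (fun z : ℝ × ℝ => extChartAt 𝓘(ℝ, E) x₀ (u z.1 z.2)) z := by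
  have h1 : ContMDiffAt 𝓘(ℝ, E) 𝓘(ℝ, E) ∞ (extChartAt 𝓘(ℝ, E) x₀) (u z.1 z.2) :=
    contMDiffAt_extChartAt' (by simpa using hz)
  exact (ContMDiffAt.comp z h1 (h.smooth z)).contDiffAt

theorem fderiv_chart_left (h : IsLocalTrajectory Ω J X W u e) (x₀ : M) {z : ℝ × ℝ}
    (hz : u z.1 z.2 ∈ (extChartAt 𝓘(ℝ, E) x₀).source) :
    fderiv ℝ (fun z : ℝ × ℝ => extChartAt 𝓘(ℝ, E) x₀ (u z.1 z.2)) z (1, 0) =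
      chartD x₀ (u z.1 z.2) (modelVel E (fun s => u s z.2) z.1) := by
  have h1 := hasDerivAt_chart_curve x₀ ((h.smooth_left z.2).mdifferentiable (by simp) z.1) hz
  have h2 := ((h.contDiffAt_chart x₀ hz).differentiableAt (by simp)).hasFDerivAt
  have h3 : HasDerivAt (fun s : ℝ => (s, z.2)) ((1, 0) : ℝ × ℝ) z.1 :=
    (hasDerivAt_id z.1).prodMk (hasDerivAt_const _ _)
  exact (HasFDerivAt.comp_hasDerivAt (f := fun s : ℝ => (s, z.2)) z.1 h2 h3).unique h1

theorem fderiv_chart_right (h : IsLocalTrajectory Ω J X W u e) (x₀ : M) {z : ℝ × ℝ}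
    (hz : u z.1 z.2 ∈ (extChartAt 𝓘(ℝ, E) x₀).source) :
    fderiv ℝ (fun z : ℝ × ℝ => extChartAt 𝓘(ℝ, E) x₀ (u z.1 z.2)) z (0, 1) =
      chartD x₀ (u z.1 z.2) (modelVel E (u z.1) z.2) := by
  have h1 := hasDerivAt_chart_curve x₀ ((h.smooth_right z.1).mdifferentiable (by simp) z.2) hz
  have h2 := ((h.contDiffAt_chart x₀ hz).differentiableAt (by simp)).hasFDerivAt
  have h3 : HasDerivAt (fun t : ℝ => (z.1, t)) ((0, 1) : ℝ × ℝ) z.2 :=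
    (hasDerivAt_const _ _).prodMk (hasDerivAt_id z.2)
  exact (HasFDerivAt.comp_hasDerivAt (f := fun t : ℝ => (z.1, t)) z.2 h2 h3).unique h1

end IsLocalTrajectory

variable [FiniteDimensional ℝ E] [T2Space M]

/-- Local monotonicity for solutions of the Floer equation. -/
theorem exists_local_trajectory_bound (hΩ : IsSymplecticForm Ω) (hJ : IsCompatible Ω J)
    (hk : ContMDiff 𝓘(ℝ, E) 𝓘(ℝ, ℝ) ∞ k) (hX : IsHamiltonianField Ω k X) {Θ : M → ℝ}
    (hΘ : IsLevelCutoff E k W Θ) (t₀ : ℝ) {x₀ : M} (hx₀ : Θ x₀ = 1) :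
    ∃ ε > 0, ∀ᶠ p in 𝓝 (t₀, x₀), ∀ (u : ℝ → ℝ → M) (e : ℝ → ℝ → ℝ≥0∞),
      IsLocalTrajectory Ω J X W u e → ∀ a b z₁ : ℝ × ℝ, z₁ ∈ Icc a b → z₁.2 = p.1 →
      u z₁.1 z₁.2 = p.2 →
      (∀ z ∈ Icc a b, (z.1 = a.1 ∨ z.1 = b.1 ∨ z.2 = a.2 ∨ z.2 = b.2) → Θ (u z.1 z.2) ≤ 1 / 2) →
      ENNReal.ofReal ε ≤ volume (Icc a b) + ∫⁻ z in Icc a b, e z.1 z.2 := by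
  have hproper : ProperSpace E := FiniteDimensional.proper ℝ E
  set φ := extChartAt 𝓘(ℝ, E) x₀ with hφ
  set y₀ := φ x₀ with hy₀
  set p₀ : ℝ × E := (t₀, y₀) with hp₀
  have hsrc : IsOpen φ.source := isOpen_extChartAt_source x₀
  have htgt : IsOpen φ.target := isOpen_extChartAt_target x₀
  have hxs : x₀ ∈ φ.source := mem_extChartAt_source x₀
  have hyt : y₀ ∈ φ.target := mem_extChartAt_target x₀
  have hφc : ContinuousOn φ φ.source := continuousOn_extChartAt x₀
  have hφsc : ContinuousOn φ.symm φ.target := continuousOn_extChartAt_symm x₀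
  obtain ⟨C, hC, hlow⟩ := exists_sq_norm_le_coordForm hΩ hJ t₀ x₀
  obtain ⟨L, hL, hgeom⟩ := exists_isBoundedGeometry (p₀ := p₀)
    (contDiffAt_coordForm hΩ x₀).continuousAt (contDiffAt_coordEnd hJ t₀ x₀)
    (contDiffAt_coordField hΩ hk hX x₀) hC hlow
  have htgt' : ∀ᶠ p in 𝓝 p₀, p.2 ∈ φ.target :=
    continuous_snd.continuousAt.preimage_mem_nhds (htgt.mem_nhds hyt)
  -- In the coordinate ball Θ exceeds 1/2. This places the curve over W, where the equation holds,
  -- and keeps it away from the boundary of the box.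
  have hΘ' : ∀ᶠ p in 𝓝 p₀, 1 / 2 < Θ (φ.symm p.2) := by
    have h1 : ContinuousAt (fun y => Θ (φ.symm y)) y₀ :=
      hΘ.smooth.continuous.continuousAt.comp (hφsc.continuousAt (htgt.mem_nhds hyt))
    have h2 : ContinuousAt (fun p : ℝ × E => Θ (φ.symm p.2)) p₀ :=
      ContinuousAt.comp (g := fun y => Θ (φ.symm y)) h1 continuousAt_snd
    refine continuousAt_const.eventually_lt h2 ?_
    simp only [hp₀, hy₀, φ.left_inv hxs, hx₀]
    norm_num
  obtain ⟨R, hR, hball⟩ := Metric.eventually_nhds_iff_ball.1 (hgeom.and (htgt'.and hΘ'))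
  obtain ⟨ε, hε, hbound⟩ := exists_local_energy_bound hL hR (fun p hp => (hball p hp).1)
    (fun p hp v => coordEnd_coordEnd hJ x₀ (hball p hp).2.1 p.1 v)
    (fun p hp v w => coordForm_coordEnd_coordEnd hJ x₀ (hball p hp).2.1 p.1 v w)
    (fun p hp v => coordForm_self hΩ x₀ (hball p hp).2.1 v)
  have hL0 : 0 < L := by linarith
  refine ⟨ε / L, by positivity, ?_⟩
  have hφx : ContinuousAt (fun p : ℝ × M => (p.1, φ p.2)) (t₀, x₀) :=
    continuousAt_fst.prodMk (ContinuousAt.comp (g := φ) (hφc.continuousAt (hsrc.mem_nhds hxs))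
      continuousAt_snd)
  filter_upwards [hφx.preimage_mem_nhds (Metric.ball_mem_nhds p₀ (half_pos hR)),
    continuousAt_snd.preimage_mem_nhds (hsrc.mem_nhds hxs)] with p hpR hps u e hu a b z₁ hz₁ ht₁ hx₁ hbd
  have hpR' : (z₁.2, φ (u z₁.1 z₁.2)) ∈ Metric.ball p₀ (R / 2) := by rw [hx₁, ht₁]; exact hpR
  have hps' : u z₁.1 z₁.2 ∈ φ.source := by rw [hx₁]; exact hps
  have huc : Continuous fun z : ℝ × ℝ => u z.1 z.2 := hu.smooth.continuous
  set y : ℝ × ℝ → E := fun z => φ (u z.1 z.2) with hy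
  set N : Set (ℝ × ℝ) := {z | u z.1 z.2 ∈ φ.source ∧ (z.2, y z) ∈ Metric.ball p₀ R} with hN
  have hNo : IsOpen N := by
    have h1 : ContinuousOn (fun z : ℝ × ℝ => (z.2, y z)) ((fun z : ℝ × ℝ => u z.1 z.2) ⁻¹' φ.source) :=
      continuousOn_snd.prodMk (hφc.comp huc.continuousOn fun z hz => hz)
    exact h1.isOpen_inter_preimage (hsrc.preimage huc) Metric.isOpen_ball
  have hNΘ : ∀ z ∈ N, 1 / 2 < Θ (u z.1 z.2) := by
    rintro z ⟨hz1, hz2⟩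
    have := (hball _ hz2).2.2
    simpa only [hy, φ.left_inv hz1] using this
  have hNW : ∀ z ∈ N, u z.1 z.2 ∈ W := fun z hz =>
    hΘ.mem_of_ne _ (by linarith [hNΘ z hz] : (0 : ℝ) < Θ (u z.1 z.2)).ne'
  -- The closed coordinate ball has compact, hence closed, image in M, so limits of points of the
  -- curve in it cannot leave the chart. Centres in the half ball leave room for radius R / 4.
  have hcl : IsClosed {z | z ∈ N ∧ (z.2, y z) ∈ Metric.closedBall (z₁.2, y z₁) (R / 4)} := by
    have hsub : ∀ q ∈ Metric.closedBall (z₁.2, y z₁) (R / 4), q ∈ Metric.ball p₀ R := by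
      intro q hq
      rw [Metric.mem_closedBall] at hq
      rw [Metric.mem_ball] at hpR' ⊢
      linarith [dist_triangle q (z₁.2, y z₁) p₀]
    have hsub' : Metric.closedBall (y z₁) (R / 4) ⊆ φ.target := by
      intro v hv
      refine (hball (z₁.2, v) (hsub _ ?_)).2.1
      rw [Metric.mem_closedBall, Prod.dist_eq, dist_self]
      exact max_le (by positivity) hv
    have hK : IsClosed (φ.symm '' Metric.closedBall (y z₁) (R / 4)) :=
      ((isCompact_closedBall _ _).image_of_continuousOn (hφsc.mono hsub')).isClosed
    have h1 : IsClosed ({z : ℝ × ℝ | u z.1 z.2 ∈ φ.symm '' Metric.closedBall (y z₁) (R / 4)} ∩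
        {z : ℝ × ℝ | z.2 ∈ Metric.closedBall z₁.2 (R / 4)}) :=
      (hK.preimage huc).inter (Metric.isClosed_closedBall.preimage continuous_snd)
    convert h1 using 1
    ext z
    constructor
    · rintro ⟨hz, hz'⟩
      rw [Metric.mem_closedBall, Prod.dist_eq] at hz'
      exact ⟨⟨y z, (le_max_right _ _).trans hz', φ.left_inv hz.1⟩, (le_max_left _ _).trans hz'⟩
    · rintro ⟨⟨v, hv, hvz⟩, hz⟩
      have hyz : y z = v := by simp only [hy]; rw [← hvz, φ.right_inv (hsub' hv)]
      have hmem : (z.2, y z) ∈ Metric.closedBall (z₁.2, y z₁) (R / 4) := by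
        rw [Metric.mem_closedBall, Prod.dist_eq, hyz]
        exact max_le hz hv
      refine ⟨⟨?_, hsub _ hmem⟩, hmem⟩
      rw [← hvz]
      exact φ.map_target (hsub' hv)
  have hmain := hbound N y a b z₁ hNo (fun z hz => hz.2)
    (fun z hz => (hu.contDiffAt_chart x₀ hz.1).of_le (WithTop.coe_le_coe.2 (le_top : (2 : ℕ∞) ≤ ⊤))) (fun z hz => ?_)
    ⟨hps', Metric.ball_subset_ball (by linarith) hpR'⟩ hz₁ hcl fun z hz hzN => ?_
  · have h1 : ∫⁻ z in Icc a b ∩ N, ENNReal.ofReal (1 + ‖fderiv ℝ y z (1, 0)‖ ^ 2) ≤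
        ENNReal.ofReal L * (volume (Icc a b) + ∫⁻ z in Icc a b, e z.1 z.2) := by
      have h2 : volume (Icc a b) = ∫⁻ z in Icc a b, 1 := by simp
      rw [h2, ← lintegral_add_left measurable_const,
        ← lintegral_const_mul' _ _ ENNReal.ofReal_ne_top]
      refine (setLIntegral_mono' (measurableSet_Icc.inter hNo.measurableSet) fun z hz => ?_).trans
        (lintegral_mono_set inter_subset_left)
      rw [mul_add, mul_one, ENNReal.ofReal_add zero_le_one (by positivity)]
      refine add_le_add (ENNReal.ofReal_le_ofReal hL) ?_
      have h3 := (hball _ hz.2.2).1.sq_norm_le (fderiv ℝ y z (1, 0))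
      rw [hu.fderiv_chart_left x₀ hz.2.1] at h3
      have h4 := coordForm_coordEnd (Ω := Ω) (J := J) x₀ hz.2.1 z.2
        (modelVel E (fun s => u s z.2) z.1)
      rw [h4] at h3
      rw [hu.fderiv_chart_left x₀ hz.2.1]
      calc _ ≤ _ := ENNReal.ofReal_le_ofReal h3
        _ = _ := ENNReal.ofReal_mul hL0.le
        _ ≤ _ := by gcongr; exact hu.le_density z.1 z.2 (hNW z hz.2)
    rw [ENNReal.ofReal_div_of_pos hL0]
    exact ENNReal.div_le_of_le_mul' (hmain.trans h1)
  · rw [hu.fderiv_chart_left x₀ hz.1, hu.fderiv_chart_right x₀ hz.1,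
      hu.eqn z.1 z.2 (hNW z hz), map_add, ← coordField_extChartAt X x₀ hz.1,
      ← coordEnd_chartD J x₀ hz.1]
  · have hlt : ¬(z.1 = a.1 ∨ z.1 = b.1 ∨ z.2 = a.2 ∨ z.2 = b.2) := fun h =>
      absurd (hbd z hz h) (not_le.2 (hNΘ z hzN))
    push Not at hlt
    exact ⟨lt_of_le_of_ne hz.1.1 hlt.1.symm, lt_of_le_of_ne hz.2.1 hlt.2.1,
      lt_of_le_of_ne hz.1.2 hlt.2.2.1.symm, lt_of_le_of_ne hz.2.2 hlt.2.2.2⟩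

end Trajectories

/-! ### The box argument and the energy bound. -/

section EnergyBound

open Topology

/-- A set of small measure does not contain an interval. -/
theorem exists_mem_Ioo_notMem {A : Set ℝ} {a b : ℝ} (h : volume (A ∩ Ioo a b) < ENNReal.ofReal (b - a)) :
    ∃ t ∈ Ioo a b, t ∉ A := by
  by_contra! hA
  rw [inter_eq_right.2 hA, Real.volume_Ioo] at h
  exact lt_irrefl _ h

variable {E : Type*} [NormedAddCommGroup E] [NormedSpace ℝ E]
  {M : Type*} [TopologicalSpace M] [ChartedSpace E M] [IsManifold 𝓘(ℝ, E) ∞ M]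
  {Ω : ∀ x : M, Tan E x →L[ℝ] Tan E x →L[ℝ] ℝ}
  {J : ℝ → ∀ x : M, Tan E x →L[ℝ] Tan E x} {k : M → ℝ} {X : M → E} {W : Set M}

namespace IsLocalTrajectory

variable {u : ℝ → ℝ → M} {e : ℝ → ℝ → ℝ≥0∞}

/-- The deviation from X is J ∂_s u, which has the same length as ∂_s u. -/
theorem isAlmostOrbit (h : IsLocalTrajectory Ω J X W u e)
    (hJ : IsCompatible Ω J) (s : ℝ) : IsAlmostOrbit Ω J X W (u s) (e s) where
  smooth := h.smooth_right s
  periodic := h.periodic s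
  density_periodic := h.density_periodic s
  le_density t ht := by
    rw [h.eqn s t ht, add_sub_cancel_left]
    refine le_trans (le_of_eq (congrArg _ ?_)) (h.le_density s t ht)
    exact hJ.invariant t _ _ _

omit [IsManifold 𝓘(ℝ, E) ∞ M] in
theorem contDiff_comp (h : IsLocalTrajectory Ω J X W u e) {Θ : M → ℝ}
    (hΘ : ContMDiff 𝓘(ℝ, E) 𝓘(ℝ, ℝ) ∞ Θ) : ContDiff ℝ ∞ fun z : ℝ × ℝ => Θ (u z.1 z.2) :=
  (hΘ.comp h.smooth).contDiff

omit [IsManifold 𝓘(ℝ, E) ∞ M] in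
theorem hasDerivAt_comp_left (h : IsLocalTrajectory Ω J X W u e) {Θ : M → ℝ}
    (hΘ : ContMDiff 𝓘(ℝ, E) 𝓘(ℝ, ℝ) ∞ Θ) (s t : ℝ) :
    HasDerivAt (fun s => Θ (u s t))
      (fderiv ℝ (fun z : ℝ × ℝ => Θ (u z.1 z.2)) (s, t) (1, 0)) s := by
  have h2 := ((h.contDiff_comp hΘ).contDiffAt.differentiableAt (x := (s, t)) (by simp)).hasFDerivAt
  have h3 : HasDerivAt (fun s : ℝ => (s, t)) ((1, 0) : ℝ × ℝ) s :=
    (hasDerivAt_id s).prodMk (hasDerivAt_const _ _)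
  exact HasFDerivAt.comp_hasDerivAt (f := fun s : ℝ => (s, t)) s h2 h3

-- Over W the density controls ∂_s u; elsewhere the differential of the cutoff vanishes, so nothing
-- about u is needed.
omit [IsManifold 𝓘(ℝ, E) ∞ M] in
theorem sq_norm_fderiv_le (h : IsLocalTrajectory Ω J X W u e) {Θ : M → ℝ}
    (hΘ : IsLevelCutoff E k W Θ) {C : ℝ} (hC : 0 < C)
    (hCΘ : ∀ t x v, ‖modelD E Θ x v‖ ^ 2 ≤ C * modelForm Ω x v (modelEnd J t x v)) (s t : ℝ) :
    ENNReal.ofReal (‖fderiv ℝ (fun z : ℝ × ℝ => Θ (u z.1 z.2)) (s, t) (1, 0)‖ ^ 2) ≤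
      ENNReal.ofReal C * e s t := by
  have h1 : fderiv ℝ (fun z : ℝ × ℝ => Θ (u z.1 z.2)) (s, t) (1, 0) =
      modelD E Θ (u s t) (modelVel E (fun s' => u s' t) s) :=
    (h.hasDerivAt_comp_left hΘ.smooth s t).unique (hasDerivAt_comp_curve
      (hΘ.smooth.mdifferentiable (by simp) _) ((h.smooth_left t).mdifferentiable (by simp) s))
  rw [h1]
  by_cases hW : u s t ∈ W
  · calc _ ≤ _ := ENNReal.ofReal_le_ofReal (hCΘ t (u s t) _)
      _ = _ := ENNReal.ofReal_mul hC.le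
      _ ≤ _ := by gcongr; exact h.le_density s t hW
  · simp [hΘ.modelD_eq_zero _ hW]

omit [IsManifold 𝓘(ℝ, E) ∞ M] in
/-- The set of times at which the trajectory enters the region `Θ > 1/2` between two slices where
`Θ` vanishes is small. -/
theorem volume_times_le (h : IsLocalTrajectory Ω J X W u e) {Θ : M → ℝ}
    (hΘ : IsLevelCutoff E k W Θ) {C : ℝ} (hC : 0 < C)
    (hCΘ : ∀ t x v, ‖modelD E Θ x v‖ ^ 2 ≤ C * modelForm Ω x v (modelEnd J t x v)) {s₀ s₁ : ℝ}
    (hs : s₀ ≤ s₁) (h0 : ∀ t, Θ (u s₀ t) = 0) {r : ℝ}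
    (hE : ∫⁻ s, ∫⁻ t in Ioc (0 : ℝ) 1, e s t ≤ ENNReal.ofReal r) (a : ℝ) :
    volume ({t | ∃ s ∈ Ioo s₀ s₁, 1 / 2 < Θ (u s t)} ∩ Ioc a (a + 1)) ≤
      ENNReal.ofReal (4 * (s₁ - s₀) * C * r) := by
  set B := {t | ∃ s ∈ Ioo s₀ s₁, 1 / 2 < Θ (u s t)} with hB
  have huc : Continuous fun z : ℝ × ℝ => Θ (u z.1 z.2) := (h.contDiff_comp hΘ.smooth).continuous
  have hBo : IsOpen B := by
    have : B = Prod.snd '' ((Ioo s₀ s₁ ×ˢ univ) ∩ {z : ℝ × ℝ | 1 / 2 < Θ (u z.1 z.2)}) := by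
      ext t; simp [hB]
    rw [this]
    exact isOpenMap_snd _ ((isOpen_Ioo.prod isOpen_univ).inter (isOpen_lt continuous_const huc))
  set g : ℝ → ℝ → ℝ := fun s t => fderiv ℝ (fun z : ℝ × ℝ => Θ (u z.1 z.2)) (s, t) (1, 0) with hg
  have hgc : Continuous fun z : ℝ × ℝ => g z.1 z.2 :=
    ((h.contDiff_comp hΘ.smooth).continuous_fderiv (by simp)).clm_apply continuous_const
  -- At such a time the cutoff rises from 0 to more than 1/2 within length s₁ - s₀, which costs at
  -- least 1/4 after Cauchy-Schwarz.
  have hpt : ∀ t ∈ B, ENNReal.ofReal (1 / 4) ≤ ENNReal.ofReal (s₁ - s₀) *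
      ∫⁻ s in Ioc s₀ s₁, ENNReal.ofReal (‖g s t‖ ^ 2) := by
    rintro t ⟨s, hs', hΘs⟩
    have h1 := sq_norm_sub_le_lintegral (f := fun s => Θ (u s t)) (f' := fun s => g s t)
      (e := fun s => ENNReal.ofReal (‖g s t‖ ^ 2)) (C := 1) hs'.1.le zero_le_one
      (fun τ _ => h.hasDerivAt_comp_left hΘ.smooth τ t)
      (hgc.comp (by fun_prop : Continuous fun s : ℝ => (s, t))).continuousOn (by simp)
    rw [h0, sub_zero, one_mul] at h1
    refine le_trans (ENNReal.ofReal_le_ofReal ?_) (h1.trans (mul_le_mul'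
      (ENNReal.ofReal_le_ofReal (by linarith [hs'.2])) (lintegral_mono_set
        (Ioc_subset_Ioc_right hs'.2.le))))
    rw [Real.norm_eq_abs, sq_abs]
    nlinarith
  have hmeas : Measurable fun z : ℝ × ℝ => ENNReal.ofReal (‖g z.1 z.2‖ ^ 2) :=
    (hgc.norm.pow 2).measurable.ennreal_ofReal
  have h1 : ENNReal.ofReal (1 / 4) * volume (B ∩ Ioc a (a + 1)) ≤
      ENNReal.ofReal ((s₁ - s₀) * C * r) := by
    -- The order of integration is exchanged for the continuous |∂_s Θ|², because e is not assumed
    -- measurable.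
    have hswap : ∫⁻ t in Ioc a (a + 1), ∫⁻ s in Ioc s₀ s₁, ENNReal.ofReal (‖g s t‖ ^ 2) =
        ∫⁻ s in Ioc s₀ s₁, ∫⁻ t in Ioc a (a + 1), ENNReal.ofReal (‖g s t‖ ^ 2) :=
      lintegral_lintegral_swap (f := fun t s => ENNReal.ofReal (‖g s t‖ ^ 2))
        (hmeas.comp measurable_swap).aemeasurable
    calc ENNReal.ofReal (1 / 4) * volume (B ∩ Ioc a (a + 1))
        = ∫⁻ _t in B ∩ Ioc a (a + 1), ENNReal.ofReal (1 / 4) := by simp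
      _ ≤ ∫⁻ t in B ∩ Ioc a (a + 1), ENNReal.ofReal (s₁ - s₀) *
          ∫⁻ s in Ioc s₀ s₁, ENNReal.ofReal (‖g s t‖ ^ 2) :=
        setLIntegral_mono' (hBo.measurableSet.inter measurableSet_Ioc) fun t ht => hpt t ht.1
      _ ≤ ∫⁻ t in Ioc a (a + 1), ENNReal.ofReal (s₁ - s₀) *
          ∫⁻ s in Ioc s₀ s₁, ENNReal.ofReal (‖g s t‖ ^ 2) := lintegral_mono_set inter_subset_right
      _ = ENNReal.ofReal (s₁ - s₀) *
          ∫⁻ s in Ioc s₀ s₁, ∫⁻ t in Ioc a (a + 1), ENNReal.ofReal (‖g s t‖ ^ 2) := by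
        rw [lintegral_const_mul' _ _ ENNReal.ofReal_ne_top, hswap]
      _ ≤ ENNReal.ofReal (s₁ - s₀) *
          ∫⁻ s in Ioc s₀ s₁, ENNReal.ofReal C * ∫⁻ t in Ioc (0 : ℝ) 1, e s t := by
        gcongr with s
        rw [← lintegral_Ioc_periodic (h.density_periodic s) a,
          ← lintegral_const_mul' _ _ ENNReal.ofReal_ne_top]
        exact lintegral_mono fun t => h.sq_norm_fderiv_le hΘ hC hCΘ s t
      _ ≤ ENNReal.ofReal (s₁ - s₀) * (ENNReal.ofReal C * ENNReal.ofReal r) := by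
        rw [lintegral_const_mul' _ _ ENNReal.ofReal_ne_top]
        gcongr
        exact (setLIntegral_le_lintegral _ _).trans hE
      _ = _ := by
        rw [← ENNReal.ofReal_mul hC.le, ← ENNReal.ofReal_mul (sub_nonneg.2 hs), mul_assoc]
  have h4 : ENNReal.ofReal 4 * ENNReal.ofReal (1 / 4) = 1 := by
    rw [← ENNReal.ofReal_mul (by norm_num)]; norm_num
  calc volume (B ∩ Ioc a (a + 1))
      = ENNReal.ofReal 4 * (ENNReal.ofReal (1 / 4) * volume (B ∩ Ioc a (a + 1))) := by
        rw [← mul_assoc, h4, one_mul]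
    _ ≤ ENNReal.ofReal 4 * ENNReal.ofReal ((s₁ - s₀) * C * r) := by gcongr
    _ = _ := by rw [← ENNReal.ofReal_mul (by norm_num)]; congr 1; ring

end IsLocalTrajectory

variable [FiniteDimensional ℝ E] [T2Space M] [CompactSpace M]

/-- Monotonicity for solutions of the Floer equation, uniform over the region `Θ = 1`. -/
theorem exists_trajectory_bound (hΩ : IsSymplecticForm Ω) (hJ : IsCompatible Ω J)
    (hk : ContMDiff 𝓘(ℝ, E) 𝓘(ℝ, ℝ) ∞ k) (hX : IsHamiltonianField Ω k X) {Θ : M → ℝ}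
    (hΘ : IsLevelCutoff E k W Θ) :
    ∃ ε > 0, ∀ (u : ℝ → ℝ → M) (e : ℝ → ℝ → ℝ≥0∞),
      IsLocalTrajectory Ω J X W u e → ∀ a b z₁ : ℝ × ℝ, z₁ ∈ Icc a b → z₁.2 ∈ Icc (0 : ℝ) 1 →
      Θ (u z₁.1 z₁.2) = 1 →
      (∀ z ∈ Icc a b, (z.1 = a.1 ∨ z.1 = b.1 ∨ z.2 = a.2 ∨ z.2 = b.2) → Θ (u z.1 z.2) ≤ 1 / 2) →
      ENNReal.ofReal ε ≤ volume (Icc a b) + ∫⁻ z in Icc a b, e z.1 z.2 := by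
  have hQ : IsCompact {x | Θ x = 1} :=
    (isClosed_eq hΘ.smooth.continuous continuous_const).isCompact
  -- Writing the lower bound as exp(-C) makes it monotone in C, so the principle for upper bounds on
  -- compact sets applies.
  obtain ⟨C, -, hC⟩ := ((isCompact_Icc (a := (0 : ℝ)) (b := 1)).prod hQ).exists_uniform_bound
    (P := fun C p => ∀ (u : ℝ → ℝ → M) (e : ℝ → ℝ → ℝ≥0∞),
      IsLocalTrajectory Ω J X W u e → ∀ a b z₁ : ℝ × ℝ, z₁ ∈ Icc a b → z₁.2 = p.1 →
      u z₁.1 z₁.2 = p.2 →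
      (∀ z ∈ Icc a b, (z.1 = a.1 ∨ z.1 = b.1 ∨ z.2 = a.2 ∨ z.2 = b.2) → Θ (u z.1 z.2) ≤ 1 / 2) →
      ENNReal.ofReal (Real.exp (-C)) ≤ volume (Icc a b) + ∫⁻ z in Icc a b, e z.1 z.2)
    (fun p C C' hCC h u e hu a b z₁ h1 h2 h3 h4 =>
      (ENNReal.ofReal_le_ofReal (Real.exp_le_exp.2 (neg_le_neg hCC))).trans
        (h u e hu a b z₁ h1 h2 h3 h4)) (by
    rintro ⟨t₀, x₀⟩ ⟨-, hx₀⟩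
    obtain ⟨ε, hε, h⟩ := exists_local_trajectory_bound hΩ hJ hk hX hΘ t₀ hx₀
    refine ⟨-Real.log ε, ?_⟩
    rw [neg_neg, Real.exp_log hε]
    exact h)
  exact ⟨Real.exp (-C), Real.exp_pos _, fun u e hu a b z₁ h1 h2 h3 h4 =>
    hC (z₁.2, u z₁.1 z₁.2) ⟨h2, h3⟩ u e hu a b z₁ h1 rfl rfl h4⟩

/-- Trajectories that enter the region `Θ₁ = 1` have a definite amount of energy. -/
theorem exists_energy_bound (hΩ : IsSymplecticForm Ω) (hJ : IsCompatible Ω J)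
    (hk : ContMDiff 𝓘(ℝ, E) 𝓘(ℝ, ℝ) ∞ k) (hX : IsHamiltonianField Ω k X) {Θ₁ Θ₂ : M → ℝ}
    (hΘ₁ : IsLevelCutoff E k W Θ₁) (hΘ₂ : IsLevelCutoff E k W Θ₂)
    (h₁₂ : ∀ x, Θ₁ x ≠ 0 → Θ₂ x = 1) (P : Prop)
    (hno : ∀ γ : ℝ → M,
      (∀ t, MDifferentiableAt 𝓘(ℝ, ℝ) 𝓘(ℝ, E) γ t ∧ modelVel E γ t = X (γ t)) →
      (∀ t, γ (t + 1) = γ t) → (∀ t, γ t ∈ W) → ¬ (IsContractibleLoop γ ∨ P)) :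
    ∃ ε > 0, ∀ (u : ℝ → ℝ → M) (e : ℝ → ℝ → ℝ≥0∞), IsLocalTrajectory Ω J X W u e →
      (∀ s, IsContractibleLoop (u s) ∨ P) → (∃ s t, Θ₁ (u s t) = 1) →
      ENNReal.ofReal ε < ∫⁻ s, ∫⁻ t in Ioc (0 : ℝ) 1, e s t := by
  obtain ⟨η, hη, hgap⟩ := exists_energy_gap hΩ hJ hk hX hΘ₂ P hno
  obtain ⟨C, hC, hCΘ⟩ := exists_sq_norm_modelD_le hΩ hJ hΘ₁.smooth
  obtain ⟨ε₀, hε₀, hmono⟩ := exists_trajectory_bound hΩ hJ hk hX hΘ₁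
  -- The second entry makes area plus energy of the box, at most (4/η + 1) ε, smaller than ε₀; the
  -- third, with ε ≤ 1, keeps the bad times below measure 1/4.
  set ε := min 1 (min (ε₀ / (2 * (4 / η + 1))) (η / (128 * C))) with hε
  have hεpos : 0 < ε := by positivity
  have hε1 : ε ≤ 1 := min_le_left _ _
  have hε2 : 2 * (4 / η + 1) * ε ≤ ε₀ := by
    calc 2 * (4 / η + 1) * ε ≤ 2 * (4 / η + 1) * (ε₀ / (2 * (4 / η + 1))) := by
          gcongr; exact (min_le_right _ _).trans (min_le_left _ _)
      _ = ε₀ := by field_simp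
  have hε3 : 128 * C * ε ≤ η := by
    calc 128 * C * ε ≤ 128 * C * (η / (128 * C)) := by
          gcongr; exact (min_le_right _ _).trans (min_le_right _ _)
      _ = η := by field_simp
  refine ⟨ε, hεpos, fun u e hu hcon hcross => ?_⟩
  by_contra! hE
  have hΘu : Continuous fun z : ℝ × ℝ => Θ₁ (u z.1 z.2) := (hu.contDiff_comp hΘ₁.smooth).continuous
  obtain ⟨s₁, t₁, ht₁, hz₁⟩ : ∃ s₁, ∃ t₁ ∈ Ico (0 : ℝ) 1, Θ₁ (u s₁ t₁) = 1 := by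
    obtain ⟨s, t, h⟩ := hcross
    have hp : Function.Periodic (u s) 1 := hu.periodic s
    obtain ⟨t', ht', htt⟩ := hp.exists_mem_Ico₀ one_pos t
    exact ⟨s, t', ht', by rw [← htt, h]⟩
  -- slices that avoid the support of the cutoff
  set A := {s | ∃ t, 0 < Θ₁ (u s t)} with hA
  have hAo : IsOpen A := by
    have : A = Prod.fst '' {z : ℝ × ℝ | 0 < Θ₁ (u z.1 z.2)} := by
      ext s; simp [hA]
    rw [this]
    exact isOpenMap_fst _ (isOpen_lt continuous_const hΘu)
  -- A slice meeting the support of Θ₁ touches Θ₂ = 1 and so has energy more than η; Chebyshev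
  -- bounds the measure of such s.
  have hAv : volume A ≤ ENNReal.ofReal (ε / η) := by
    rw [ENNReal.ofReal_div_of_pos hη, ENNReal.le_div_iff_mul_le
      (Or.inl (ENNReal.ofReal_pos.2 hη).ne') (Or.inl ENNReal.ofReal_ne_top), mul_comm]
    calc ENNReal.ofReal η * volume A = ∫⁻ _s in A, ENNReal.ofReal η := by simp
      _ ≤ ∫⁻ s in A, ∫⁻ t in Ioc (0 : ℝ) 1, e s t := by
        refine setLIntegral_mono' hAo.measurableSet fun s ⟨t, ht⟩ => ?_
        exact (hgap (u s) (e s) (hu.isAlmostOrbit hJ s) (hcon s) ⟨t, h₁₂ _ ht.ne'⟩).le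
      _ ≤ _ := (setLIntegral_le_lintegral _ _).trans hE
  -- Twice the measure bound, so every window of length κ contains a slice on which Θ₁ vanishes.
  set κ := 2 * ε / η with hκ
  have hκ0 : 0 < κ := by positivity
  have hsl : ∀ a, ∃ s ∈ Ioo a (a + κ), s ∉ A := fun a => exists_mem_Ioo_notMem (by
    refine (measure_mono inter_subset_left).trans_lt (hAv.trans_lt ?_)
    rw [add_sub_cancel_left, ENNReal.ofReal_lt_ofReal_iff hκ0, hκ]
    have : 0 < ε / η := by positivity
    rw [mul_div_assoc]; linarith)
  have hA0 : ∀ s, s ∉ A → ∀ t, Θ₁ (u s t) = 0 := fun s hs t =>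
    le_antisymm (not_lt.1 fun h => hs ⟨t, h⟩) (hΘ₁.mem_Icc _).1
  obtain ⟨sm, hsm, hsmA⟩ := hsl (s₁ - κ)
  obtain ⟨sp, hsp, hspA⟩ := hsl s₁
  rw [sub_add_cancel] at hsm
  -- times that avoid the region where the cutoff is large
  set B := {t | ∃ s ∈ Ioo sm sp, 1 / 2 < Θ₁ (u s t)} with hB
  have hBv : ∀ a, volume (B ∩ Ioc a (a + 1)) < ENNReal.ofReal (1 / 4) := by
    intro a
    refine (hu.volume_times_le hΘ₁ hC hCΘ (hsm.2.trans hsp.1).le (hA0 sm hsmA) hE a).trans_lt ?_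
    rw [ENNReal.ofReal_lt_ofReal_iff (by norm_num)]
    have h1 : sp - sm ≤ 2 * κ := by linarith [hsp.2, hsm.1]
    calc 4 * (sp - sm) * C * ε ≤ 4 * (2 * κ) * C * 1 := by gcongr
      _ = (128 * C * ε) / η / 8 := by rw [hκ]; field_simp; norm_num
      _ ≤ η / η / 8 := by gcongr
      _ < 1 / 4 := by rw [div_self hη.ne']; norm_num
  obtain ⟨tp, htp, htpB⟩ : ∃ t ∈ Ioo t₁ (t₁ + 1 / 4), t ∉ B := exists_mem_Ioo_notMem (by
    refine (measure_mono ?_).trans_lt ((hBv t₁).trans_eq (by congr 1; ring))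
    exact inter_subset_inter_right _ fun t ht => ⟨ht.1, by linarith [ht.2]⟩)
  obtain ⟨tm, htm, htmB⟩ : ∃ t ∈ Ioo (t₁ - 1 / 4) t₁, t ∉ B := exists_mem_Ioo_notMem (by
    refine (measure_mono ?_).trans_lt ((hBv (t₁ - 1 / 4)).trans_eq (by congr 1; ring))
    exact inter_subset_inter_right _ fun t ht => ⟨ht.1, by linarith [ht.2]⟩)
  -- the box
  have hbox := hmono u e hu (sm, tm) (sp, tp) (s₁, t₁)
    ⟨⟨hsm.2.le, htm.2.le⟩, ⟨hsp.1.le, htp.1.le⟩⟩ ⟨ht₁.1, ht₁.2.le⟩ hz₁ (by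
    rintro ⟨s, t⟩ ⟨⟨hs1, ht1⟩, ⟨hs2, ht2⟩⟩ hbd
    dsimp only at hs1 hs2 ht1 ht2 hbd ⊢
    have hends : ∀ s, s ∉ A → Θ₁ (u s t) ≤ 1 / 2 := fun s hs => by
      rw [hA0 s hs]; norm_num
    rcases hs1.eq_or_lt with rfl | hs1
    · exact hends _ hsmA
    rcases hs2.eq_or_lt with rfl | hs2
    · exact hends _ hspA
    have hside : ∀ t, t ∉ B → Θ₁ (u s t) ≤ 1 / 2 := fun t ht =>
      not_lt.1 fun h => ht ⟨s, ⟨hs1, hs2⟩, h⟩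
    rcases hbd with rfl | rfl | rfl | rfl
    · exact absurd hs1 (lt_irrefl _)
    · exact absurd hs2 (lt_irrefl _)
    · exact hside _ htmB
    · exact hside _ htpB)
  have hIcc : Icc (sm, tm) (sp, tp) = Icc sm sp ×ˢ Icc tm tp := (Icc_prod_eq _ _)
  have hvol : volume (Icc (sm, tm) (sp, tp)) ≤ ENNReal.ofReal (2 * κ) := by
    rw [hIcc, Measure.volume_eq_prod, Measure.prod_prod, Real.volume_Icc, Real.volume_Icc,
      ← ENNReal.ofReal_mul (by linarith [hsp.1, hsm.2])]
    refine ENNReal.ofReal_le_ofReal ?_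
    have h1 : sp - sm ≤ 2 * κ := by linarith [hsp.2, hsm.1]
    have h2 : tp - tm ≤ 1 := by linarith [htp.2, htm.1]
    calc (sp - sm) * (tp - tm) ≤ 2 * κ * 1 := by
          gcongr
          linarith [htp.1, htm.2]
      _ = 2 * κ := mul_one _
  -- The box is shorter than one period in t, so its energy is counted at most once. Only the
  -- inequality in Tonelli's theorem is needed, which requires no measurability.
  have hen : ∫⁻ z in Icc (sm, tm) (sp, tp), e z.1 z.2 ≤ ENNReal.ofReal ε := by
    rw [hIcc, Measure.volume_eq_prod, ← Measure.prod_restrict]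
    refine (lintegral_prod_le _).trans ((setLIntegral_le_lintegral _ _).trans
      ((lintegral_mono fun s => ?_).trans hE))
    rw [← lintegral_Ioc_periodic (hu.density_periodic s) (t₁ - 1 / 4)]
    exact lintegral_mono_set fun t ht => ⟨by linarith [htm.1, ht.1], by linarith [htp.2, ht.2]⟩
  have hfin := hbox.trans (add_le_add hvol hen)
  rw [← ENNReal.ofReal_add (by positivity) hεpos.le,
    ENNReal.ofReal_le_ofReal_iff (by positivity)] at hfin
  have h3 : 2 * κ + ε = (4 / η + 1) * ε := by rw [hκ]; field_simp; norm_num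
  have h4 : 0 < (4 / η + 1) * ε := by positivity
  linarith

end EnergyBound

/-! ### From the Floer equation and the hypotheses on the shell to local trajectories. -/

section Reduction

open Topology

variable {E : Type*} [NormedAddCommGroup E] [NormedSpace ℝ E]
  {M : Type*} [TopologicalSpace M] [ChartedSpace E M] [IsManifold 𝓘(ℝ, E) ∞ M]
  {Ω : ∀ x : M, Tan E x →L[ℝ] Tan E x →L[ℝ] ℝ}
  {J : ℝ → ∀ x : M, Tan E x →L[ℝ] Tan E x} {K : ℝ → M → ℝ} {X : M → E} {W : Set M}

omit [IsManifold 𝓘(ℝ, E) ∞ M] in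
theorem IsHamiltonian.contMDiff (hK : IsHamiltonian E K) (t : ℝ) :
    ContMDiff 𝓘(ℝ, E) 𝓘(ℝ, ℝ) ∞ (K t) :=
  hK.smooth.comp (contMDiff_const.prodMk contMDiff_id)

/-- Smooth functions that agree on an open set have the same differential on its closure. -/
theorem modelD_congr_of_mem_closure {f g : M → ℝ} (hf : ContMDiff 𝓘(ℝ, E) 𝓘(ℝ, ℝ) ∞ f)
    (hg : ContMDiff 𝓘(ℝ, E) 𝓘(ℝ, ℝ) ∞ g) (hW : IsOpen W) (hfg : ∀ x ∈ W, f x = g x) {x : M}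
    (hx : x ∈ closure W) : modelD E f x = modelD E g x := by
  set φ := extChartAt 𝓘(ℝ, E) x with hφ
  have hxs : x ∈ φ.source := mem_extChartAt_source x
  have hxt : φ x ∈ φ.target := mem_extChartAt_target x
  have hc : ∀ {f : M → ℝ}, ContMDiff 𝓘(ℝ, E) 𝓘(ℝ, ℝ) ∞ f →
      ContinuousAt (fun y => fderiv ℝ (fun y => f (φ.symm y)) (φ y)) x := fun {f} hf =>
    ContinuousAt.comp (g := fun y => fderiv ℝ (fun y => f (φ.symm y)) y)
      ((contDiffAt_coordFun hf x hxt).fderiv_right (m := ∞) (by simp)).continuousAt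
      (continuousAt_extChartAt x)
  have key : fderiv ℝ (fun y => f (φ.symm y)) (φ x) = fderiv ℝ (fun y => g (φ.symm y)) (φ x) := by
    -- The points where the coordinate differentials differ form a neighbourhood of x, which would
    -- meet W, where the functions agree locally.
    by_contra hne
    have h1 := (hc hf).tendsto.prodMk_nhds (hc hg).tendsto
    have h2 : ∀ᶠ y in 𝓝 x, fderiv ℝ (fun y => f (φ.symm y)) (φ y) ≠
        fderiv ℝ (fun y => g (φ.symm y)) (φ y) :=
      h1.eventually ((isClosed_diagonal.isOpen_compl).mem_nhds (x := (_, _)) hne)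
    have h3 := h2.and ((isOpen_extChartAt_source (I := 𝓘(ℝ, E)) x).mem_nhds hxs)
    obtain ⟨y, hyW, hy, hys⟩ := ((mem_closure_iff_frequently.1 hx).and_eventually h3).exists
    refine hy (Filter.EventuallyEq.fderiv_eq ?_)
    have hyt := φ.map_source hys
    have h4 : ContinuousAt φ.symm (φ y) := (continuousOn_extChartAt_symm (I := 𝓘(ℝ, E)) x).continuousAt
      ((isOpen_extChartAt_target x).mem_nhds hyt)
    filter_upwards [h4.preimage_mem_nhds (hW.mem_nhds (by rwa [φ.left_inv hys]))] with z hz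
      using hfg _ hz
  ext v
  rw [mfderiv_eq_fderiv_chart x hxs (hf.mdifferentiable (by simp) x),
    mfderiv_eq_fderiv_chart x hxs (hg.mdifferentiable (by simp) x)]
  exact congrArg (fun A : E →L[ℝ] ℝ => A (chartD x x v)) key

-- With `isContractibleLoop_const` this turns the hypothesis on contractible orbits into regularity
-- of the Hamiltonian on the shell.
omit [IsManifold 𝓘(ℝ, E) ∞ M] in
theorem isOnePeriodicOrbit_const {x : M} (h : ∀ t, modelD E (K t) x = 0) :
    IsOnePeriodicOrbit Ω K fun _ => x := by
  refine ⟨⟨mdifferentiable_const, fun t w => ?_⟩, fun _ => rfl⟩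
  have h1 : velocity (E := E) (fun _ : ℝ => x) t = 0 := by
    rw [velocity, mfderiv_const]; rfl
  have h2 : diff (E := E) (K t) x w = 0 := congrArg (fun A : E →L[ℝ] ℝ => A w) (h t)
  rw [h1, h2, map_zero, neg_zero]
  rfl

omit [ChartedSpace E M] [IsManifold 𝓘(ℝ, E) ∞ M] in
theorem isContractibleLoop_const (x : M) : IsContractibleLoop fun _ => x :=
  ⟨ContinuousMap.const _ x, fun _ => rfl, x, .refl _⟩

/-- A Floer trajectory solves the equation `∂u/∂t = X(u) + J ∂u/∂s` where the Hamiltonian and the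
almost complex structure are known. -/
theorem IsFloerTrajectory.isLocalTrajectory (hΩ : IsSymplecticForm Ω) {k : M → ℝ}
    (hX : IsHamiltonianField Ω k X) {J' : ℝ → ∀ x : M, Tan E x →L[ℝ] Tan E x}
    (hJ' : IsCompatible Ω J') {u : ℝ → ℝ → M} (hu : IsFloerTrajectory Ω J' K u)
    (hK : ∀ t, ∀ x ∈ W, modelD E (K t) x = modelD E k x) (hJ : ∀ t, ∀ x ∈ W, J' t x = J t x) :
    IsLocalTrajectory Ω J X W u fun s t => ENNReal.ofReal (modelForm Ω (u s t)
      (modelVel E (fun s' => u s' t) s)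
        (modelEnd J' t (u s t) (modelVel E (fun s' => u s' t) s))) where
  smooth := hu.smooth
  periodic := hu.periodic
  density_periodic s t := by
    have h2 : ∀ x, modelEnd J' (t + 1) x = modelEnd J' t x := fun x => hJ'.periodic t x
    simp only [h2, hu.periodic]
  eqn s t hW := by
    set ξ := modelVel E (fun s' => u s' t) s
    set η := modelVel E (u s) t
    set B := modelForm Ω (u s t)
    set A := modelEnd J' t (u s t) with hA
    have hJA : modelEnd J t (u s t) = A := (hJ t _ hW).symm
    rw [hJA]
    have hfl : ∀ w : E, B (-(ξ + A η)) (A w) = modelD E (K t) (u s t) w := hu.floer s t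
    have hinv : ∀ v w : E, B (A v) (A w) = B v w := hJ'.invariant t (u s t)
    have hsq : ∀ v : E, A (A v) = -v := hJ'.sq_eq_neg t (u s t)
    have hnd : ∀ v : E, (∀ w : E, B v w = 0) → v = 0 := hΩ.nondegenerate (u s t)
    have h1 : η - (X (u s t) + A ξ) = 0 := by
      refine hnd _ fun w => ?_
      have h2 := hfl w
      rw [hK t _ hW] at h2
      -- Invariance under A and A² = -1 move A off the test vector, turning the gradient equation
      -- into the pairing of ∂_t u - X - A ∂_s u with w.
      have h3 : B (X (u s t)) w = -modelD E k (u s t) w := hX (u s t) w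
      have h4 := hinv ξ (A w)
      rw [hsq] at h4
      simp only [map_neg, map_add, neg_apply, add_apply, map_sub, sub_apply, hinv] at h2 h4 ⊢
      linarith
    exact sub_eq_zero.1 h1
  le_density s t hW := by
    have : modelEnd J t (u s t) = modelEnd J' t (u s t) := (hJ t _ hW).symm
    rw [this]

end Reduction

end Sympl

end

/-! ### The proposition. -/

theorem mainTheorem7
    {E : Type*} [NormedAddCommGroup E] [NormedSpace ℝ E] [FiniteDimensional ℝ E]
    {M : Type*} [TopologicalSpace M] [ChartedSpace E M] [IsManifold 𝓘(ℝ, E) ∞ M]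
    [CompactSpace M] [T2Space M]
    (Ω : ∀ x : M, Sympl.Tan E x →L[ℝ] Sympl.Tan E x →L[ℝ] ℝ) (hΩ : Sympl.IsSymplecticForm Ω)
    (U V : Set M) (hU : IsOpen U) (hV : IsOpen V) (hUV : closure U ⊆ V)
    (K : ℝ → M → ℝ) (hK : Sympl.IsHamiltonian E K) (hKnd : Sympl.IsNondegenerate Ω K)
    (hKU : Sympl.IsBoundedByLevelSets K U) (hKV : Sympl.IsBoundedByLevelSets K V)
    (hKaut : ∀ x ∈ Sympl.shell U V, ∀ t t' : ℝ, K t x = K t' x)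
    (hKorb : ∀ x : ℝ → M, Sympl.IsOnePeriodicOrbit Ω K x → Sympl.IsContractibleLoop x →
      ¬ Set.range x ⊆ Sympl.shell U V)
    (J : ℝ → ∀ x : M, Sympl.Tan E x →L[ℝ] Sympl.Tan E x) (hJ : Sympl.IsCompatible Ω J) :
    ∃ ε : ℝ, 0 < ε ∧
      ∀ (K' : ℝ → M → ℝ) (J' : ℝ → ∀ x : M, Sympl.Tan E x →L[ℝ] Sympl.Tan E x),
        Sympl.IsHamiltonian E K' → Sympl.IsNondegenerate Ω K' → Sympl.IsCompatible Ω J' →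
        (∀ x ∈ Sympl.shell U V, ∀ t : ℝ, K' t x = K t x ∧ J' t x = J t x) →
        ∀ u : ℝ → ℝ → M, Sympl.IsFloerTrajectory Ω J' K' u →
          ((∀ s : ℝ, Sympl.IsContractibleLoop (u s)) ∨
            ∀ x : ℝ → M, Sympl.IsOnePeriodicOrbit Ω K x →
              ¬ Set.range x ⊆ Sympl.shell U V) →
          (∃ s t : ℝ, u s t ∈ frontier U) → (∃ s t : ℝ, u s t ∈ frontier V) →
          ENNReal.ofReal ε < Sympl.energy Ω J' u := by
  classical
  obtain ⟨cU, hcU⟩ := hKU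
  obtain ⟨cV, hcV⟩ := hKV
  -- 0 is inserted only to make c nonempty: the distance to the empty set is 0 by convention.
  set c : Finset ℝ := insert 0 (cU ∪ cV) with hc
  set k := K 0 with hkdef
  have hk : ContMDiff 𝓘(ℝ, E) 𝓘(ℝ, ℝ) ∞ k := hK.contMDiff 0
  have hkU : ∀ x ∈ frontier U, k x ∈ c := fun x hx => by simp [hc, hkdef, hcU 0 x hx]
  have hkV : ∀ x ∈ frontier V, k x ∈ c := fun x hx => by simp [hc, hkdef, hcV 0 x hx]
  set W := V \ closure U with hWdef
  have hW : IsOpen W := hV.sdiff isClosed_closure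
  have hWsh : W ⊆ Sympl.shell U V := fun x hx =>
    ⟨subset_closure hx.1, fun h => hx.2 (subset_closure h)⟩
  have hkW : ∀ x ∈ frontier W, k x ∈ (c : Set ℝ) := by
    intro x hx
    rcases frontier_inter_subset V (closure U)ᶜ hx with h | h
    · exact hkV x h.1
    · rw [frontier_compl] at h
      exact hkU x (frontier_closure_subset h.2)
  have hdK : ∀ t, ∀ x ∈ closure W, Sympl.modelD E (K t) x = Sympl.modelD E k x := fun t x hx =>
    Sympl.modelD_congr_of_mem_closure (hK.contMDiff t) hk hW (fun y hy => hKaut y (hWsh hy) t 0) hx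
  -- A constant loop is an orbit only if its point is critical at all times, so the differentials
  -- are compared on the closure of W first.
  have hreg : ∀ x ∈ closure W ∩ closure U, Sympl.modelD E k x ≠ 0 := by
    rintro x ⟨hxW, hxU⟩ h0
    refine hKorb (fun _ => x) (Sympl.isOnePeriodicOrbit_const fun t => by rw [hdK t x hxW, h0])
      (Sympl.isContractibleLoop_const x) ?_
    rintro _ ⟨_, rfl⟩
    refine ⟨closure_mono sdiff_subset hxW, fun hx => ?_⟩
    obtain ⟨y, hyU, hyW⟩ := mem_closure_iff.1 hxW U hU hx
    exact hyW.2 (subset_closure hyU)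
  obtain ⟨δ, hδ, hcross⟩ := Sympl.exists_crossing_constant hk hU hV hUV (c := c)
    ⟨0, by simp [hc]⟩ hkU hkV hreg
  -- The thresholds δ/2 < δ for Θ₁ and δ/4 < δ/2 for Θ₂ make Θ₂ = 1 on the support of Θ₁.
  obtain ⟨Θ₁, hΘ₁, hΘ₁1, hΘ₁0⟩ := Sympl.exists_levelCutoff (E := E) hk hW hkW (half_pos hδ)
    (half_lt_self hδ)
  obtain ⟨Θ₂, hΘ₂, hΘ₂1, -⟩ := Sympl.exists_levelCutoff (E := E) hk hW hkW
    (half_pos (half_pos hδ)) (half_lt_self (half_pos hδ))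
  obtain ⟨X, hX⟩ := Sympl.exists_hamiltonianField hΩ k
  obtain ⟨ε, hε, hmain⟩ := Sympl.exists_energy_bound hΩ hJ hk hX hΘ₁ hΘ₂
    (fun x hx => hΘ₂1 x (hΘ₁.mem_of_ne x hx) (hΘ₁0 x hx).le)
    (∀ x : ℝ → M, Sympl.IsOnePeriodicOrbit Ω K x → ¬ Set.range x ⊆ Sympl.shell U V) (by
      intro γ hγ hper hγW hor
      have horb : Sympl.IsOnePeriodicOrbit Ω K γ := by
        refine ⟨⟨fun t => (hγ t).1, fun t w => ?_⟩, hper⟩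
        have h1 := hX (γ t) w
        rw [← (hγ t).2, ← hdK t _ (subset_closure (hγW t))] at h1
        exact h1
      have hrange : Set.range γ ⊆ Sympl.shell U V := by
        rintro _ ⟨t, rfl⟩
        exact hWsh (hγW t)
      rcases hor with h | h
      · exact hKorb γ horb h hrange
      · exact h γ horb hrange)
  refine ⟨ε, hε, fun K' J' hK' _ hJ' hagree u hu halt ⟨s, t, hst⟩ ⟨s', t', hst'⟩ => ?_⟩
  have hdK' : ∀ t, ∀ x ∈ W, Sympl.modelD E (K' t) x = Sympl.modelD E k x := fun t x hx =>
    Sympl.modelD_congr_of_mem_closure (hK'.contMDiff t) hk hW (fun y hy =>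
      ((hagree y (hWsh hy) t).1).trans (hKaut y (hWsh hy) t 0)) (subset_closure hx)
  refine hmain u _ (hu.isLocalTrajectory hΩ hX hJ' hdK' fun t x hx => (hagree x (hWsh hx) t).2)
    (fun s => halt.imp (fun h => h s) id) ?_
  -- The image of the whole cylinder is connected; the two boundaries may be met at unrelated
  -- parameters.
  obtain ⟨_, ⟨z, rfl⟩, hzW, hz⟩ := hcross (Set.range fun z : ℝ × ℝ => u z.1 z.2)
    (isPreconnected_range hu.smooth.continuous) ⟨_, ⟨(s, t), rfl⟩, hst⟩ ⟨_, ⟨(s', t'), rfl⟩, hst'⟩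
  exact ⟨z.1, z.2, hΘ₁1 _ hzW hz⟩
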